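/- Throughout, a domain $\Omega$ is a nonempty open simply connected subset of $\mathbb C$ with $\Omega\neq\mathbb C$, and $\mathbb D$ is the open unit disc. **Spinors.** Let $a_0,\dots,a_k$ be distinct points of $\Omega$. A spinor is a function on the double cover $[\Omega;a_0,\dots,a_k]$ of $\Omega\setminus\{a_0,\dots,a_k\}$, branching around each $a_i$, which changes sign between the two sheets. Fix a source index $j$. In the unit disc, $f_{[\mathbb D,a_j;(a_i)_{i\ne j}]}$ is the holomorphic spinor (unique up to the labelling of the sheets), continuous up to the boundary, with $$\operatorname{Im}\bigl[f(z)\sqrt{\nu_{\rm out}(z)}\bigr]=0\ \ (z\in\partial\mathbb D),\qquad \lim_{z\to a_i}\sqrt{z-a_i}\,f(z)\in i\mathbb R\ \ (i\ne j),\qquad \lim_{z\to a_j}\sqrt{z-a_j}\,f(z)=1,$$ where $\nu_{\rm out}(z)=z$ is the outer unit normal. In a general domain it is defined by $f_{[\Omega,a_j;(a_i)]}(z)=f_{[\mathbb D,\varphi(a_j);(\varphi(a_i))]}(\varphi(z))\,\varphi'(z)^{1/2}$ for a conformal map $\varphi$ of $\Omega$ onto $\mathbb D$. The number $\mathcal A_\Omega(a_j;(a_i)_{i\neq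 j})\in\mathbb C$ is defined by the expansion at the source $$f_{[\Omega,a_j;(a_i)]}(z)=\frac1{\sqrt{z-a_j}}+2\mathcal A_\Omega(a_j;(a_i)_{i\ne j})\sqrt{z-a_j}+O\bigl((z-a_j)^{3/2}\bigr).$$ **Correlation functions.** On the space of $(k+1)$-tuples of distinct points of $\Omega$ consider the differential form $$\mathcal L_{\Omega,k+1}=\sum_{j=0}^k\operatorname{Re}\bigl[\mathcal A_\Omega(a_j;(a_i)_{i\ne j})\,da_j\bigr].$$ The correlation function $\langle\sigma_{a_0}\cdots\sigma_{a_k}\rangle_\Omega^+$ is the exponential of a primitive of $\mathcal L_{\Omega,k+1}$; this determines it up to a positive multiplicative constant depending on $\Omega$ and $k$. **Statement.** There is a unique choice of these multiplicative constants, for all $\Omega$ and all $k\ge0$ (that is, there is exactly one family, indexed by $\Omega$ and $k\ge 0$, of exponentials of primitives of the forms $\mathcal L_{\Omega,k+1}$), such that for every domain $\Omega$ the following two conditions hold: 1. for every $k\ge1$ and all fixed distinct $a_1,\dots,a_k\in\Omega$, $$\frac{\langle\sigma_a\sigma_{a_1}\cdots\sigma_{a_k}\rangle_\Omega^+}{\langle\sigma_a\rangle_\Omega^+\,\langle\sigma_{a_1}\cdots\sigma_{a_k}\rangle_\Omega^+}\to1\quad\text{as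 } a\to\partial\Omega,\ \text{i.e. as } \operatorname{dist}(a,\partial\Omega)\to0;$$ 2. for distinct $a,b\in\Omega$, $$\frac{\langle\sigma_a\sigma_b\rangle_\Omega^+}{|a-b|^{-1/4}}\to1\quad\text{as }\ \mathcal D_\Omega(a;b):=\frac{|a-b|}{\operatorname{dist}(\{a,b\},\partial\Omega)}\to0.$$ Normalized in this way, the correlation functions are conformally covariant: for every conformal map $\varphi$ of a domain $\Omega$ onto a domain $\Omega'$, every $k\ge0$ and all distinct $a_0,\dots,a_k\in\Omega$, $$\langle\sigma_{a_0}\cdots\sigma_{a_k}\rangle_\Omega^+=\langle\sigma_{\varphi(a_0)}\cdots\sigma_{\varphi(a_k)}\rangle_{\Omega'}^+\prod_{j=0}^k|\varphi'(a_j)|^{1/8}.$$ -/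

import Mathlib

open Filter Topology Asymptotics

noncomputable section

namespace IsingSpin

/-- A simply connected planar domain: a (nonempty) open simply connected subset of `ℂ`,
different from `ℂ`. Bounded simply connected domains and the upper half-plane are examples. -/
structure PlanarDomain where
  carrier : Set ℂ
  isOpen : IsOpen carrier
  simplyConnected : IsSimplyConnected carrier
  ne_univ : carrier ≠ Set.univ

/-- The set of `n`-tuples of pairwise distinct points of `Ω`. -/
def configSet (Ω : PlanarDomain) (n : ℕ) : Set (Fin n → ℂ) :=
  {a | Function.Injective a ∧ ∀ j, a j ∈ Ω.carrier}

/-- `n`-tuples of pairwise distinct points of `Ω`, as a type. -/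
abbrev Config (Ω : PlanarDomain) (n : ℕ) : Type := configSet Ω n

/-- The first point of a configuration. -/
def Config.head {Ω : PlanarDomain} {n : ℕ} (b : Config Ω (n + 1)) : Config Ω 1 :=
  ⟨fun _ => b.1 0, fun _ _ _ => Subsingleton.elim _ _, fun _ => b.2.2 0⟩

/-- All the points of a configuration but the first one. -/
def Config.tail {Ω : PlanarDomain} {n : ℕ} (b : Config Ω (n + 1)) : Config Ω n :=
  ⟨fun j => b.1 j.succ, fun _ _ h => Fin.succ_injective n (b.2.1 h), fun j => b.2.2 j.succ⟩

/-- `φ` is a conformal map of `U` onto `V`. -/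
def IsConformalMap (φ : ℂ → ℂ) (U V : Set ℂ) : Prop :=
  DifferentiableOn ℂ φ U ∧ Set.BijOn φ U V

/-- The image of a configuration under a conformal map. -/
def Config.map {Ω Ω' : PlanarDomain} {n : ℕ} (φ : ℂ → ℂ)
    (hφ : IsConformalMap φ Ω.carrier Ω'.carrier) (b : Config Ω n) : Config Ω' n :=
  ⟨fun j => φ (b.1 j),
    fun i j h => b.2.1 (hφ.2.injOn (b.2.2 i) (b.2.2 j) h),
    fun j => hφ.2.mapsTo (b.2.2 j)⟩

/-! ### Holomorphic spinors -/

/-- The polynomial `∏ (z - a_j)`, whose square root defines the double cover. -/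
def coverPoly {n : ℕ} (a : Fin n → ℂ) (z : ℂ) : ℂ := ∏ j, (z - a j)

/-- The double cover of `S \ {a_0, …, a_{n-1}}` branching around each of the points `a_j`:
a point is a pair `(z, w)` with base point `z` and with `w` one of the two square roots of
`∏ (z - a_j)`. The two sheets are exchanged by `(z, w) ↦ (z, -w)`. -/
def doubleCover {n : ℕ} (S : Set ℂ) (a : Fin n → ℂ) : Set (ℂ × ℂ) :=
  {p | p.1 ∈ S ∧ (∀ j, p.1 ≠ a j) ∧ p.2 ^ 2 = coverPoly a p.1}

/-- Holomorphic spinors on the double cover of `U \ {a_0, …, a_{n-1}}`: functions which change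
sign between the sheets and are holomorphic along every local holomorphic section. -/
def IsHolomorphicSpinor {n : ℕ} (U : Set ℂ) (a : Fin n → ℂ) (F : ℂ × ℂ → ℂ) : Prop :=
  (∀ p ∈ doubleCover U a, F (p.1, -p.2) = -F p) ∧
  ∀ (V : Set ℂ) (w : ℂ → ℂ), IsOpen V → DifferentiableOn ℂ w V →
    (∀ z ∈ V, (z, w z) ∈ doubleCover U a) →
    DifferentiableOn ℂ (fun z => F (z, w z)) V

/-- Let `ζ` stand for `√(z - a_j)`, a local coordinate of the double cover near its branching
point over `a_j`. A local sheet is the germ of a holomorphic parametrization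
`ζ ↦ (a_j + ζ², w ζ)` of the double cover near this point, that is, one of the two
identifications of the double cover with that of `√(z - a_j)`. -/
def IsLocalSheet {n : ℕ} (a : Fin n → ℂ) (j : Fin n) (w : ℂ → ℂ) : Prop :=
  AnalyticAt ℂ w 0 ∧ ∀ᶠ ζ in 𝓝 (0 : ℂ), w ζ ^ 2 = coverPoly a (a j + ζ ^ 2)

/-- `F` solves the boundary value problem in the domain `D` with outer unit normal `ν`, with
source `a j` and the other branching points `a i`, `i ≠ j`: it is a holomorphic spinor,
continuous up to the boundary, such that
* `Im [F(z) √ν(z)] = 0` on the boundary (for either choice of the square root);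
* the limit of `√(z - a_i) F(z)` at each `a_i`, `i ≠ j`, is purely imaginary;
* the limit of `√(z - a_j) F(z)` at the source is `1`. -/
def SolvesBVP {n : ℕ} (D : Set ℂ) (ν : ℂ → ℂ) (a : Fin n → ℂ) (j : Fin n)
    (F : ℂ × ℂ → ℂ) : Prop :=
  IsHolomorphicSpinor D a F ∧
  ContinuousOn F (doubleCover (closure D) a) ∧
  (∀ p ∈ doubleCover (frontier D) a, ∀ s : ℂ, s ^ 2 = ν p.1 → (F p * s).im = 0) ∧
  (∀ i, i ≠ j → ∃ (w : ℂ → ℂ) (β : ℝ), IsLocalSheet a i w ∧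
    Tendsto (fun ζ => ζ * F (a i + ζ ^ 2, w ζ)) (𝓝[≠] 0) (𝓝 (β * Complex.I))) ∧
  ∃ w : ℂ → ℂ, IsLocalSheet a j w ∧
    Tendsto (fun ζ => ζ * F (a j + ζ ^ 2, w ζ)) (𝓝[≠] 0) (𝓝 1)

/-- The unit disc, as the reference bounded domain with smooth boundary. -/
def unitDisc : Set ℂ := Metric.ball 0 1

/-- `F` is the spinor `f_{[Ω, a_j; (a_i)_{i ≠ j}]}`. In the unit disc, where the outer unit normal
at the boundary point `z` is `z` itself, it solves the boundary value problem; in a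
simply connected domain `Ω` it is defined by conformal covariance,
`f_Ω(z) = f_𝔻(φ(z)) · φ'(z)^{1/2}` for a conformal map `φ : Ω → 𝔻`. Here `s` is a holomorphic
branch of `(φ')^{1/2}` and `(z, w) ↦ (φ z, w * q z)` is a lift of `φ` to the double covers. -/
def IsObservable {n : ℕ} (Ω : PlanarDomain) (a : Fin n → ℂ) (j : Fin n)
    (F : ℂ × ℂ → ℂ) : Prop :=
  ∃ φ q s : ℂ → ℂ, ∃ G : ℂ × ℂ → ℂ,
    IsConformalMap φ Ω.carrier unitDisc ∧
    DifferentiableOn ℂ s Ω.carrier ∧ (∀ z ∈ Ω.carrier, s z ^ 2 = deriv φ z) ∧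
    DifferentiableOn ℂ q Ω.carrier ∧
    (∀ z ∈ Ω.carrier, coverPoly (fun i => φ (a i)) (φ z) = coverPoly a z * q z ^ 2) ∧
    SolvesBVP unitDisc (fun z => z) (fun i => φ (a i)) j G ∧
    ∀ p ∈ doubleCover Ω.carrier a, F p = G (φ p.1, p.2 * q p.1) * s p.1

/-- `A` is the coefficient `𝒜_Ω(a_j; (a_i)_{i ≠ j})`, defined by the expansion
`f(z) = 1 / √(z - a_j) + 2 A √(z - a_j) + O((z - a_j)^{3/2})` of the spinor at its source. -/
def IsCoeffA {n : ℕ} (Ω : PlanarDomain) (a : Fin n → ℂ) (j : Fin n) (A : ℂ) : Prop :=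
  ∃ F : ℂ × ℂ → ℂ, IsObservable Ω a j F ∧
    ∃ w : ℂ → ℂ, IsLocalSheet a j w ∧
      (fun ζ => F (a j + ζ ^ 2, w ζ) - (1 / ζ + 2 * A * ζ)) =O[𝓝[≠] 0] (fun ζ => ζ ^ 3)

/-- `ℓ` is the value at `a` of the differential form `ℒ_{Ω,n} = ∑ Re [𝒜_Ω(a_j; …) da_j]`. -/
def IsFormL {n : ℕ} (Ω : PlanarDomain) (a : Fin n → ℂ) (ℓ : (Fin n → ℂ) →L[ℝ] ℝ) : Prop :=
  ∃ A : Fin n → ℂ, (∀ j, IsCoeffA Ω a j (A j)) ∧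
    ∀ v : Fin n → ℂ, ℓ v = ∑ j, (A j * v j).re

/-- `c` is the exponential of a primitive of `ℒ_{Ω,n}` on the space of `n`-tuples of distinct
points of `Ω`. -/
def IsExpPrimitive {Ω : PlanarDomain} {n : ℕ} (c : Config Ω n → ℝ) : Prop :=
  ∃ H : (Fin n → ℂ) → ℝ,
    (∀ a ∈ configSet Ω n, ∃ ℓ : (Fin n → ℂ) →L[ℝ] ℝ, IsFormL Ω a ℓ ∧ HasFDerivAt H ℓ a) ∧
    ∀ a : Config Ω n, c a = Real.exp (H a.1)

/-! ### Normalization -/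

/-- A family of functions of `k + 1` distinct points of `Ω`, for all domains `Ω` and all `k`. -/
abbrev CorrFamily : Type := (Ω : PlanarDomain) → (k : ℕ) → Config Ω (k + 1) → ℝ

/-- The quantity `𝒟_Ω(a; b) = |a - b| / dist({a; b}, ∂Ω)`. -/
def bulkDepth {Ω : PlanarDomain} (p : Config Ω 2) : ℝ :=
  ‖p.1 0 - p.1 1‖ /
    min (Metric.infDist (p.1 0) (frontier Ω.carrier)) (Metric.infDist (p.1 1) (frontier Ω.carrier))

/-- Decorrelation at the boundary: for fixed distinct `a_1, …, a_m ∈ Ω`, `m = k + 1 ≥ 1`,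
`⟨σ_a σ_{a_1} … σ_{a_m}⟩ / (⟨σ_a⟩ ⟨σ_{a_1} … σ_{a_m}⟩) → 1` as `a → ∂Ω`. -/
def BoundaryDecorrelation (corr : CorrFamily) : Prop :=
  ∀ (Ω : PlanarDomain) (k : ℕ) (as : Config Ω (k + 1)),
    Tendsto (fun b : Config Ω (k + 1 + 1) =>
        corr Ω (k + 1) b / (corr Ω 0 b.head * corr Ω k as))
      (comap (fun b => Metric.infDist (b.1 0) (frontier Ω.carrier)) (𝓝 0) ⊓ 𝓟 {b | b.tail = as})
      (𝓝 1)

/-- Normalization in the bulk: `⟨σ_a σ_b⟩ / |a - b|^{-1/4} → 1` as `𝒟_Ω(a; b) → 0`. -/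
def BulkNormalization (corr : CorrFamily) : Prop :=
  ∀ Ω : PlanarDomain,
    Tendsto (fun p : Config Ω 2 => corr Ω 1 p / ‖p.1 0 - p.1 1‖ ^ (-(1 / 4) : ℝ))
      (comap bulkDepth (𝓝 0)) (𝓝 1)

/-- A family of correlation functions (exponentials of primitives of the forms `ℒ_{Ω,k+1}`)
with the multiplicative constants fixed by the two asymptotic conditions. -/
def IsNormalizedCorr (corr : CorrFamily) : Prop :=
  (∀ (Ω : PlanarDomain) (k : ℕ), IsExpPrimitive (corr Ω k)) ∧
  BoundaryDecorrelation corr ∧ BulkNormalization corr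

/-- The conformal covariance rule with exponent `1/8` at each point. -/
def ConformallyCovariant (corr : CorrFamily) : Prop :=
  ∀ (Ω Ω' : PlanarDomain) (φ : ℂ → ℂ) (hφ : IsConformalMap φ Ω.carrier Ω'.carrier)
    (k : ℕ) (a : Config Ω (k + 1)),
    corr Ω k a = corr Ω' k (a.map φ hφ) * ∏ j, ‖deriv φ (a.1 j)‖ ^ (1 / 8 : ℝ)

end IsingSpin

end

open Filter Topology Asymptotics

noncomputable section

namespace IsingSpin

section

open Metric Set Complex ComplexConjugate

/-! ### Injective holomorphic functions -/

/-! The correlation functions can be written down. For points b_1, …, b_n of the unit disc let r_km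
be their pseudo-hyperbolic distances and Z = ∑_μ ∏_{k<m} r_km^{μ_k μ_m / 2}, the sum running over
all signs μ. The correlation is 2^{-n/4} Z^{1/2} ∏ (1 - |b_j|²)^{-1/8}, transported to a domain by a
Riemann map φ with a factor |φ'|^{1/8} at each point (`logCorr`).

The link with the boundary value problem is an explicit solution. Up to a real constant, the spinor
with source a_j is S(z) / √(∏ (z - a_k) ∏ (1 - conj a_k z)), where S sums over the μ with μ_j = +
the weights of Z times products of numerators or denominators of Blaschke factors. Flipping all
spins but a few fixed ones turns such a sum into its conjugate up to a known factor
(`conj_spinSum`). On the circle, with μ_j fixed, this is the boundary condition; at a_i, with μ_i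
and μ_j fixed, it is the condition that the limit be imaginary. At the source all terms agree, which
gives the normalization (`solvesBVP_discSolution`).

The solution is unique up to sign. For a difference D of solutions, D² is a function on the disc
with simple poles of residue -β_i² at the a_i, while D² z ≥ 0 on the circle. The residue theorem
equates a nonnegative integral with -2π ∑ β_i², so D vanishes (`spinor_eq_zero`, `SolvesBVP.sq_eq`).

Since f² (z - a_j) = 1 + 4𝒜 (z - a_j) + …, the coefficient is read off the square, where signs and
sheets disappear. The logarithmic derivative of S at the source is a Gibbs average of spins, and so
is the derivative of log Z. Hence ℒ is the differential of `logCorr` (`hasDerivAt_sourceProd`,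
`hasFDerivAt_discLogCorr`, `hasFDerivAt_logCorr`). Schwarz-Pick makes `logCorr` independent of φ,
and the configuration space is connected, so all candidates are positive multiples of its
exponential (`isExpPrimitive_iff`).

When one point tends to the boundary its r's tend to 1 and its spin decouples, so Z tends to twice
the partition function of the others (`tendsto_boundary`). For two points Z = 2 r^{-1/2} (1 + r).
The bulk limit must be uniform in the position of the pair, and follows from distortion bounds valid
for every univalent function, obtained from a rough area theorem (`tendsto_bulk`). If K_k are the
constants of another normalized family, the two limits force K_{k+1} = K_0 K_k and K_1 = 1, so all
are 1. Covariance is the chain rule for `logCorr`. -/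

theorem not_eventually_const_of_injOn {f : ℂ → ℂ} {U : Set ℂ} (hU : IsOpen U) (hi : InjOn f U)
    {z : ℂ} (hz : z ∈ U) : ¬ ∀ᶠ w in 𝓝 z, f w = f z := by
  intro h
  have h2 : ∀ᶠ w in 𝓝[≠] z, w = z := by
    filter_upwards [h.filter_mono nhdsWithin_le_nhds,
      (hU.eventually_mem hz).filter_mono nhdsWithin_le_nhds] with w h1 h2
    exact hi h2 hz h1
  obtain ⟨w, h3, h4⟩ := (h2.and self_mem_nhdsWithin).exists
  exact h4 h3

theorem nhds_le_map_of_injOn {f : ℂ → ℂ} {U : Set ℂ} (hU : IsOpen U)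
    (hd : DifferentiableOn ℂ f U) (hi : InjOn f U) {z : ℂ} (hz : z ∈ U) :
    𝓝 (f z) ≤ map f (𝓝 z) :=
  ((hd.analyticAt (hU.mem_nhds hz)).eventually_constant_or_nhds_le_map_nhds).resolve_left
    (not_eventually_const_of_injOn hU hi hz)

theorem isOpen_image_of_injOn {f : ℂ → ℂ} {U : Set ℂ} (hU : IsOpen U)
    (hd : DifferentiableOn ℂ f U) (hi : InjOn f U) : IsOpen (f '' U) := by
  rw [isOpen_iff_mem_nhds]
  rintro _ ⟨z, hz, rfl⟩
  exact nhds_le_map_of_injOn hU hd hi hz (image_mem_map (hU.mem_nhds hz))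

theorem continuousAt_leftInvOn {f g : ℂ → ℂ} {U : Set ℂ} (hU : IsOpen U)
    (hd : DifferentiableOn ℂ f U) (hg : LeftInvOn g f U) {z : ℂ} (hz : z ∈ U) :
    ContinuousAt g (f z) := by
  rw [ContinuousAt, hg hz]
  have h1 : Tendsto (g ∘ f) (𝓝 z) (𝓝 z) :=
    tendsto_id.congr' (by filter_upwards [hU.mem_nhds hz] with w hw using (hg hw).symm)
  exact (tendsto_map'_iff.2 h1).mono_left (nhds_le_map_of_injOn hU hd hg.injOn hz)

/-- Where f' ≠ 0 this is the inverse function theorem. Zeros of f' are isolated because f is nowhere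
locally constant, so the continuous inverse has only removable singularities. That f' has no zeros
at all is then a consequence of the chain rule. -/
theorem differentiableAt_leftInvOn {f g : ℂ → ℂ} {U : Set ℂ} (hU : IsOpen U)
    (hd : DifferentiableOn ℂ f U) (hg : LeftInvOn g f U) {z : ℂ} (hz : z ∈ U) :
    DifferentiableAt ℂ g (f z) := by
  have key : ∀ x ∈ U, deriv f x ≠ 0 → DifferentiableAt ℂ g (f x) := by
    intro x hx h
    have h1 : HasDerivAt f (deriv f x) (g (f x)) := by
      rw [hg hx]; exact (hd.differentiableAt (hU.mem_nhds hx)).hasDerivAt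
    refine (HasDerivAt.of_local_left_inverse (continuousAt_leftInvOn hU hd hg hx) h1 h
      ?_).differentiableAt
    filter_upwards [(isOpen_image_of_injOn hU hd hg.injOn).mem_nhds (mem_image_of_mem f hx)]
    rintro _ ⟨y, hy, rfl⟩
    rw [hg hy]
  have ha : AnalyticAt ℂ (deriv f) z := (hd.analyticAt (hU.mem_nhds hz)).deriv
  have hne : ∀ᶠ w in 𝓝[≠] z, deriv f w ≠ 0 := by
    refine ha.eventually_eq_zero_or_eventually_ne_zero.resolve_left fun h => ?_
    apply not_eventually_const_of_injOn hU hg.injOn hz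
    obtain ⟨ε, he, hb⟩ := Metric.eventually_nhds_iff_ball.1
      (h.and (hU.mem_nhds hz : ∀ᶠ w in 𝓝 z, w ∈ U))
    refine Metric.eventually_nhds_iff_ball.2 ⟨ε, he, fun y hy => ?_⟩
    exact isOpen_ball.is_const_of_deriv_eq_zero (convex_ball z ε).isPreconnected
      (hd.mono fun y hy => (hb y hy).2) (fun y hy => (hb y hy).1) hy (mem_ball_self he)
  refine (analyticAt_of_differentiable_on_punctured_nhds_of_continuousAt ?_
    (continuousAt_leftInvOn hU hd hg hz)).differentiableAt
  have hc : Tendsto g (𝓝[≠] (f z)) (𝓝[≠] z) := by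
    refine tendsto_nhdsWithin_iff.2 ⟨?_, ?_⟩
    · have := continuousAt_leftInvOn hU hd hg hz
      rw [ContinuousAt, hg hz] at this
      exact this.mono_left nhdsWithin_le_nhds
    · filter_upwards [((isOpen_image_of_injOn hU hd hg.injOn).eventually_mem
        (mem_image_of_mem f hz)).filter_mono nhdsWithin_le_nhds,
        self_mem_nhdsWithin]
      rintro _ ⟨y, hy, rfl⟩ hne h
      rw [mem_singleton_iff, hg hy] at h
      exact hne (by rw [h]; rfl)
  filter_upwards [hc.eventually hne,
    ((isOpen_image_of_injOn hU hd hg.injOn).eventually_mem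
        (mem_image_of_mem f hz)).filter_mono nhdsWithin_le_nhds]
  rintro _ h ⟨y, hy, rfl⟩
  rw [hg hy] at h
  exact key y hy h

theorem deriv_leftInvOn_mul {f g : ℂ → ℂ} {U : Set ℂ} (hU : IsOpen U)
    (hd : DifferentiableOn ℂ f U) (hg : LeftInvOn g f U) {z : ℂ} (hz : z ∈ U) :
    deriv g (f z) * deriv f z = 1 := by
  have h1 := (differentiableAt_leftInvOn hU hd hg hz).hasDerivAt.comp z
    (hd.differentiableAt (hU.mem_nhds hz)).hasDerivAt
  have h2 : HasDerivAt (g ∘ f) 1 z := (hasDerivAt_id z).congr_of_eventuallyEq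
    (by filter_upwards [hU.mem_nhds hz] with w hw using hg hw)
  exact h1.unique h2

theorem deriv_ne_zero_of_injOn {f : ℂ → ℂ} {U : Set ℂ} (hU : IsOpen U)
    (hd : DifferentiableOn ℂ f U) (hi : InjOn f U) {z : ℂ} (hz : z ∈ U) : deriv f z ≠ 0 :=
  right_ne_zero_of_mul_eq_one
    (deriv_leftInvOn_mul hU hd (hi.leftInvOn_invFunOn) hz)

theorem IsConformalMap.deriv_ne_zero {φ : ℂ → ℂ} {U V : Set ℂ} (h : IsConformalMap φ U V)
    (hU : IsOpen U) {z : ℂ} (hz : z ∈ U) : deriv φ z ≠ 0 :=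
  deriv_ne_zero_of_injOn hU h.1 h.2.injOn hz

theorem IsConformalMap.differentiableAt {φ : ℂ → ℂ} {U V : Set ℂ} (h : IsConformalMap φ U V)
    (hU : IsOpen U) {z : ℂ} (hz : z ∈ U) : DifferentiableAt ℂ φ z :=
  h.1.differentiableAt (hU.mem_nhds hz)

theorem IsConformalMap.exists_inverse {φ : ℂ → ℂ} {U V : Set ℂ} (h : IsConformalMap φ U V)
    (hU : IsOpen U) : ∃ g : ℂ → ℂ, IsConformalMap g V U ∧ LeftInvOn g φ U ∧ LeftInvOn φ g V := by
  have hr := h.2.surjOn.rightInvOn_invFunOn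
  refine ⟨Function.invFunOn φ U, ⟨?_, ?_⟩, h.2.injOn.leftInvOn_invFunOn, hr⟩
  · intro w hw
    obtain ⟨z, hz, rfl⟩ := h.2.surjOn hw
    exact (differentiableAt_leftInvOn hU h.1 h.2.injOn.leftInvOn_invFunOn hz).differentiableWithinAt
  · exact InvOn.bijOn ⟨hr, h.2.injOn.leftInvOn_invFunOn⟩
      h.2.surjOn.mapsTo_invFunOn h.2.mapsTo

theorem IsConformalMap.comp {φ ψ : ℂ → ℂ} {U V W : Set ℂ} (h2 : IsConformalMap ψ V W)
    (h1 : IsConformalMap φ U V) : IsConformalMap (ψ ∘ φ) U W :=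
  ⟨h2.1.comp h1.1 h1.2.mapsTo, h2.2.comp h1.2⟩

/-! ### Disc automorphisms -/

/-- The automorphism of the unit disc sending `c` to `0`. -/
def discAut (c z : ℂ) : ℂ := (z - c) / (1 - conj c * z)

theorem one_sub_conj_mul_ne_zero {c z : ℂ} (hc : ‖c‖ < 1) (hz : ‖z‖ ≤ 1) :
    1 - conj c * z ≠ 0 := by
  intro h
  have h1 : conj c * z = 1 := (sub_eq_zero.1 h).symm
  have h2 : ‖c‖ * ‖z‖ = 1 := by rw [← norm_conj c, ← norm_mul, h1, norm_one]
  nlinarith [norm_nonneg c, norm_nonneg z]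

theorem normSq_discAut_identity (c z : ℂ) :
    ‖1 - conj c * z‖ ^ 2 - ‖z - c‖ ^ 2 = (1 - ‖c‖ ^ 2) * (1 - ‖z‖ ^ 2) := by
  simp only [← normSq_eq_norm_sq, normSq_apply]
  simp
  ring

theorem norm_discAut_lt_one {c z : ℂ} (hc : ‖c‖ < 1) (hz : ‖z‖ < 1) : ‖discAut c z‖ < 1 := by
  have h1 := norm_pos_iff.2 (one_sub_conj_mul_ne_zero hc hz.le)
  rw [discAut, norm_div, div_lt_one h1]
  have := normSq_discAut_identity c z
  have h2 : 0 < (1 - ‖c‖ ^ 2) * (1 - ‖z‖ ^ 2) := by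
    apply mul_pos <;> nlinarith [norm_nonneg c, norm_nonneg z]
  exact lt_of_pow_lt_pow_left₀ 2 h1.le (by linarith)

theorem one_sub_sq_norm_discAut {c z : ℂ} (hc : ‖c‖ < 1) (hz : ‖z‖ < 1) :
    1 - ‖discAut c z‖ ^ 2 = (1 - ‖c‖ ^ 2) * (1 - ‖z‖ ^ 2) / ‖1 - conj c * z‖ ^ 2 := by
  have h1 := norm_ne_zero_iff.2 (one_sub_conj_mul_ne_zero hc hz.le)
  rw [discAut, norm_div, ← normSq_discAut_identity, div_pow, sub_div, div_self (pow_ne_zero 2 h1)]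

theorem hasDerivAt_discAut {c z : ℂ} (h : 1 - conj c * z ≠ 0) :
    HasDerivAt (discAut c) ((1 - conj c * c) / (1 - conj c * z) ^ 2) z := by
  have h1 : HasDerivAt (fun z => z - c) 1 z := (hasDerivAt_id z).sub_const c
  have h2 : HasDerivAt (fun z => 1 - conj c * z) (-(conj c)) z := by
    simpa using ((hasDerivAt_id z).const_mul (conj c)).const_sub 1
  refine (h1.div h2 h).congr_deriv ?_
  congr 1
  ring

theorem discAut_neg_discAut {c z : ℂ} (hc : ‖c‖ < 1) (hz : ‖z‖ < 1) :
    discAut (-c) (discAut c z) = z := by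
  have h1 := one_sub_conj_mul_ne_zero hc hz.le
  have h2 := one_sub_conj_mul_ne_zero hc hc.le
  have h3 : 1 - conj (-c) * ((z - c) / (1 - conj c * z)) ≠ 0 := by
    have := one_sub_conj_mul_ne_zero (c := -c) (by simpa using hc) (norm_discAut_lt_one hc hz).le
    exact this
  unfold discAut
  rw [div_eq_iff h3]
  simp only [map_neg]
  generalize conj c = d at *
  have e : (1 - -d * ((z - c) / (1 - d * z))) * (1 - d * z) = 1 - d * z + d * (z - c) := by
    rw [sub_mul, mul_assoc, div_mul_cancel₀ _ h1]; ring
  refine mul_right_cancel₀ h1 ?_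
  rw [mul_assoc, e, sub_neg_eq_add, add_mul, div_mul_cancel₀ _ h1]
  ring

theorem discAut_self (c : ℂ) : discAut c c = 0 := by simp [discAut]

theorem isConformalMap_discAut {c : ℂ} (hc : ‖c‖ < 1) :
    IsConformalMap (discAut c) unitDisc unitDisc := by
  have hm : ∀ c : ℂ, ‖c‖ < 1 → MapsTo (discAut c) unitDisc unitDisc := by
    intro c hc z hz
    simp only [unitDisc, mem_ball_zero_iff] at hz ⊢
    exact norm_discAut_lt_one hc hz
  have hl : ∀ c : ℂ, ‖c‖ < 1 → LeftInvOn (discAut (-c)) (discAut c) unitDisc := by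
    intro c hc z hz
    simp only [unitDisc, mem_ball_zero_iff] at hz
    exact discAut_neg_discAut hc hz
  refine ⟨fun z hz => ?_, ?_⟩
  · simp only [unitDisc, mem_ball_zero_iff] at hz
    exact (hasDerivAt_discAut
      (one_sub_conj_mul_ne_zero hc hz.le)).differentiableAt.differentiableWithinAt
  · have h2 := hl (-c) (by simpa using hc)
    rw [neg_neg] at h2
    exact InvOn.bijOn ⟨hl c hc, h2⟩ (hm c hc) (hm (-c) (by simpa using hc))

/-! ### Schwarz-Pick -/

/-- The pseudo-hyperbolic distance in the unit disc. -/
def pseudoHyp (a b : ℂ) : ℝ := ‖discAut b a‖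

theorem pseudoHyp_comm (a b : ℂ) : pseudoHyp a b = pseudoHyp b a := by
  simp only [pseudoHyp, discAut, norm_div]
  rw [norm_sub_rev]
  congr 1
  rw [← norm_conj]
  simp [mul_comm]

/-- The Schwarz lemma, after automorphisms that move b and ψ b to 0. -/
theorem schwarz_pick_le {ψ : ℂ → ℂ} (h : IsConformalMap ψ unitDisc unitDisc) {a b : ℂ}
    (ha : a ∈ unitDisc) (hb : b ∈ unitDisc) :
    pseudoHyp (ψ a) (ψ b) ≤ pseudoHyp a b := by
  have hb' : ‖b‖ < 1 := by simpa [unitDisc] using hb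
  have hψb : ‖ψ b‖ < 1 := by simpa [unitDisc] using h.2.mapsTo hb
  have hnb : ‖-b‖ < 1 := by simpa using hb'
  have hg := (isConformalMap_discAut hψb).comp (h.comp (isConformalMap_discAut hnb))
  have h0 : (discAut (ψ b) ∘ ψ ∘ discAut (-b)) 0 = 0 := by
    simp [discAut]
  have hz := (isConformalMap_discAut hb').2.mapsTo ha
  have := norm_le_norm_of_mapsTo_ball hg.1
    (fun z hz => ball_subset_closedBall (hg.2.mapsTo hz)) h0 (by simpa [unitDisc] using hz)
  simpa [pseudoHyp, discAut_neg_discAut hb' (by simpa [unitDisc] using ha : ‖a‖ < 1)] using this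

theorem pseudoHyp_conformal {ψ : ℂ → ℂ} (h : IsConformalMap ψ unitDisc unitDisc) {a b : ℂ}
    (ha : a ∈ unitDisc) (hb : b ∈ unitDisc) :
    pseudoHyp (ψ a) (ψ b) = pseudoHyp a b := by
  refine le_antisymm (schwarz_pick_le h ha hb) ?_
  obtain ⟨g, hg, h1, h2⟩ := h.exists_inverse isOpen_ball
  have := schwarz_pick_le hg (h.2.mapsTo ha) (h.2.mapsTo hb)
  rwa [h1 ha, h1 hb] at this

/-- Infinitesimal form of the invariance of `pseudoHyp`: divide by |z - a| and let z tend to a. -/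
theorem norm_deriv_conformal {ψ : ℂ → ℂ} (h : IsConformalMap ψ unitDisc unitDisc) {a : ℂ}
    (ha : a ∈ unitDisc) :
    ‖deriv ψ a‖ * (1 - ‖a‖ ^ 2) = 1 - ‖ψ a‖ ^ 2 := by
  have ha' : ‖a‖ < 1 := by simpa [unitDisc] using ha
  have hψa : ‖ψ a‖ < 1 := by simpa [unitDisc] using h.2.mapsTo ha
  have hd := (h.differentiableAt isOpen_ball ha).hasDerivAt
  have hs := hd.tendsto_slope
  have e1 : Tendsto (fun z => ‖ψ z - ψ a‖ / ‖z - a‖) (𝓝[≠] a) (𝓝 ‖deriv ψ a‖) := by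
    refine hs.norm.congr fun z => ?_
    rw [slope_def_field, norm_div]
  have e2 : Tendsto (fun z => ‖1 - conj (ψ a) * ψ z‖ / ‖1 - conj a * z‖) (𝓝[≠] a)
      (𝓝 (‖1 - conj (ψ a) * ψ a‖ / ‖1 - conj a * a‖)) := by
    apply Tendsto.mono_left _ nhdsWithin_le_nhds
    apply Tendsto.div
    · exact ((hd.continuousAt.tendsto.const_mul _).const_sub 1).norm
    · exact ((tendsto_id.const_mul _).const_sub 1).norm
    · exact norm_ne_zero_iff.2 (one_sub_conj_mul_ne_zero ha' ha'.le)
  have e3 : (fun z => ‖ψ z - ψ a‖ / ‖z - a‖) =ᶠ[𝓝[≠] a]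
      (fun z => ‖1 - conj (ψ a) * ψ z‖ / ‖1 - conj a * z‖) := by
    filter_upwards [(isOpen_ball.eventually_mem ha).filter_mono
      nhdsWithin_le_nhds, self_mem_nhdsWithin] with z hz hne
    have h1 := pseudoHyp_conformal h hz ha
    have hz' : ‖z‖ < 1 := by simpa [unitDisc] using hz
    have hψz : ‖ψ z‖ < 1 := by simpa [unitDisc] using h.2.mapsTo hz
    simp only [pseudoHyp, discAut, norm_div] at h1
    have n1 := norm_ne_zero_iff.2 (one_sub_conj_mul_ne_zero ha' hz'.le)
    have n2 := norm_ne_zero_iff.2 (one_sub_conj_mul_ne_zero hψa hψz.le)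
    have n3 : ‖z - a‖ ≠ 0 := norm_ne_zero_iff.2 (sub_ne_zero.2 hne)
    rw [div_eq_div_iff n2 n1] at h1
    rw [div_eq_div_iff n3 n1, h1, mul_comm]
  have e4 := tendsto_nhds_unique (e1.congr' e3) e2
  have e5 : ∀ c : ℂ, ‖c‖ < 1 → ‖1 - conj c * c‖ = 1 - ‖c‖ ^ 2 := by
    intro c hc
    rw [mul_comm, mul_conj, normSq_eq_norm_sq, ← ofReal_one, ← ofReal_sub, norm_real,
      Real.norm_of_nonneg]
    nlinarith [norm_nonneg c]
  rw [e4, e5 _ ha', e5 _ hψa, div_mul_cancel₀]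
  nlinarith [norm_nonneg a]

end

section

open Metric Set Complex ComplexConjugate

/-! ### Square roots on simply connected domains -/

theorem hasDerivAt_of_sq_eq {f g : ℂ → ℂ} {z g' : ℂ} (hf : ContinuousAt f z)
    (hg : HasDerivAt g g' z) (hfg : ∀ᶠ w in 𝓝 z, f w ^ 2 = g w) (h0 : f z ≠ 0) :
    HasDerivAt f (g' / (2 * f z)) z := by
  rw [hasDerivAt_iff_tendsto_slope]
  have h1 : Tendsto (fun w => f w + f z) (𝓝[≠] z) (𝓝 (2 * f z)) := by
    rw [two_mul]; exact (hf.tendsto.mono_left nhdsWithin_le_nhds).add_const _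
  have h3 : 2 * f z ≠ 0 := mul_ne_zero two_ne_zero h0
  have h2 := (hasDerivAt_iff_tendsto_slope.1 hg).div h1 h3
  refine h2.congr' ?_
  filter_upwards [hfg.filter_mono nhdsWithin_le_nhds, h1.eventually_ne h3]
    with w hw hne
  simp only [Pi.div_apply, slope_def_field]
  rw [← hw, ← hfg.self_of_nhds, div_right_comm]
  congr 1
  rw [div_eq_iff hne]; ring

theorem exists_differentiableOn_sq_eq {U : Set ℂ} (hUo : IsOpen U) (hUc : IsSimplyConnected U)
    {g : ℂ → ℂ} (hg : DifferentiableOn ℂ g U) (h0 : ∀ z ∈ U, g z ≠ 0) :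
    ∃ f : ℂ → ℂ, DifferentiableOn ℂ f U ∧ ∀ z ∈ U, f z ^ 2 = g z := by
  obtain ⟨f, hc, hf⟩ := exists_continuousOn_pow_eq hUc hUo hg.continuousOn
    (by rintro ⟨z, hz, h⟩; exact h0 z hz h) two_ne_zero
  refine ⟨f, fun z hz => ?_, fun z _ => hf z⟩
  refine (hasDerivAt_of_sq_eq (hc.continuousAt (hUo.mem_nhds hz))
    (hg.differentiableAt (hUo.mem_nhds hz)).hasDerivAt (.of_forall hf)
    ?_).differentiableAt.differentiableWithinAt
  intro h
  exact h0 z hz (by rw [← hf z, h]; simp)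

/-! ### The Riemann mapping theorem -/

/-- The normalized univalent maps of `U` into the unit disc. -/
def univalentFamily (U : Set ℂ) (z₀ : ℂ) : Set (ℂ → ℂ) :=
  {f | DifferentiableOn ℂ f U ∧ InjOn f U ∧ MapsTo f U unitDisc ∧ f z₀ = 0}

theorem discAut_comp_mem_univalentFamily {U : Set ℂ} {z₀ : ℂ} {f : ℂ → ℂ} (hz₀ : z₀ ∈ U)
    (hd : DifferentiableOn ℂ f U) (hi : InjOn f U) (hm : MapsTo f U unitDisc) :
    discAut (f z₀) ∘ f ∈ univalentFamily U z₀ := by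
  have h := isConformalMap_discAut (c := f z₀) (by simpa [unitDisc] using hm hz₀)
  exact ⟨h.1.comp hd hm, h.2.injOn.comp hi hm, h.2.mapsTo.comp hm, by simp [discAut]⟩

/-- For c outside U, a branch h of √(z - c) is injective and never takes two opposite values. As
h(U) contains a ball around h z₀, h stays away from -h z₀, and a multiple of 1 / (h + h z₀) maps
into the disc. -/
theorem univalentFamily_nonempty {U : Set ℂ} (hUo : IsOpen U) (hUc : IsSimplyConnected U)
    (hU : U ≠ univ) {z₀ : ℂ} (hz₀ : z₀ ∈ U) : (univalentFamily U z₀).Nonempty := by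
  obtain ⟨c, hc⟩ := (ne_univ_iff_exists_notMem U).1 hU
  have hd : DifferentiableOn ℂ (fun z => z - c) U := (differentiable_id.sub_const c).differentiableOn
  obtain ⟨h, hh, hsq⟩ := exists_differentiableOn_sq_eq hUo hUc hd
    (fun z hz h => hc (by rwa [← sub_eq_zero.1 h]))
  have hi : InjOn h U := by
    intro x hx y hy hxy
    have h1 := hsq x hx
    rw [hxy, hsq y hy] at h1
    exact (sub_left_injective h1).symm
  obtain ⟨ε, he, hb⟩ := Metric.isOpen_iff.1 (isOpen_image_of_injOn hUo hh hi) (h z₀)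
    (mem_image_of_mem h hz₀)
  have key : ∀ z ∈ U, ε ≤ ‖h z + h z₀‖ := by
    intro z hz
    by_contra! hlt
    obtain ⟨y, hy, hyz⟩ := hb (show -h z ∈ ball (h z₀) ε by
      rw [mem_ball, dist_eq_norm, ← norm_neg]; simpa [add_comm] using hlt)
    have h1 : y = z := by
      have := hsq y hy
      rw [hyz, neg_sq, hsq z hz] at this
      exact (sub_left_injective this).symm
    rw [h1] at hyz
    have h2 : h z = 0 := by linear_combination hyz / 2
    have h3 := hsq z hz
    rw [h2] at h3
    exact hc (by rw [← sub_eq_zero.1 (h3.symm.trans (by simp))]; exact hz)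
  have hne : ∀ z ∈ U, h z + h z₀ ≠ 0 := fun z hz => norm_pos_iff.1 (he.trans_le (key z hz))
  have he2 : (ε / 2 : ℂ) ≠ 0 := by simpa using he.ne'
  refine ⟨_, discAut_comp_mem_univalentFamily (f := fun z => (ε / 2 : ℂ) / (h z + h z₀)) hz₀
    ?_ ?_ ?_⟩
  · exact (differentiableOn_const _).div (hh.add_const _) hne
  · intro x hx y hy hxy
    apply hi hx hy
    simp only [div_eq_mul_inv] at hxy
    exact add_right_cancel (inv_injective (mul_left_cancel₀ he2 hxy))
  · intro z hz
    have := key z hz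
    simp only [unitDisc, mem_ball_zero_iff, norm_div]
    rw [div_lt_one (norm_pos_iff.2 (hne z hz))]
    simp [abs_of_pos he]
    linarith

/-- Equicontinuity of the family; the numerator 2 is the diameter of the disc. -/
theorem univalentFamily_lipschitz {U : Set ℂ} {z₀ : ℂ} {f : ℂ → ℂ} (hf : f ∈ univalentFamily U z₀)
    {z : ℂ} {R : ℝ} (hR : ball z R ⊆ U) {w : ℂ} (hw : w ∈ ball z R) :
    dist (f w) (f z) ≤ 2 / R * dist w z := by
  have hRp : 0 < R := dist_nonneg.trans_lt hw
  refine dist_le_div_mul_dist_of_mapsTo_ball (hf.1.mono hR) (fun x hx => ?_) hw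
  have h1 := hf.2.2.1 (hR hx)
  have h2 := hf.2.2.1 (hR (mem_ball_self hRp))
  simp only [unitDisc, mem_ball_zero_iff] at h1 h2
  rw [mem_closedBall, dist_eq_norm]
  linarith [norm_sub_le (f x) (f z)]

theorem norm_deriv_le_of_univalentFamily {U : Set ℂ} {z₀ : ℂ} {f : ℂ → ℂ}
    (hf : f ∈ univalentFamily U z₀) {R : ℝ} (hRp : 0 < R) (hR : ball z₀ R ⊆ U) :
    ‖deriv f z₀‖ ≤ 1 / R := by
  refine norm_deriv_le_div_of_mapsTo_ball (hf.1.mono hR) (fun x hx => ?_) hRp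
  rw [hf.2.2.2]
  exact ball_subset_closedBall (hf.2.2.1 (hR hx))

/-- Hurwitz: a nonconstant locally uniform limit of injective holomorphic functions is
injective. -/
theorem injOn_of_tendstoLocallyUniformlyOn {ι : Type*} {l : Filter ι} [l.NeBot] {F : ι → ℂ → ℂ}
    {f : ℂ → ℂ} {U : Set ℂ} (hU : IsOpen U) (hUc : IsPreconnected U)
    (hF : TendstoLocallyUniformlyOn F f l U) (hd : ∀ i, DifferentiableOn ℂ (F i) U)
    (hi : ∀ i, InjOn (F i) U) (hne : ∃ z ∈ U, deriv f z ≠ 0) : InjOn f U := by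
  have hf : DifferentiableOn ℂ f U := hF.differentiableOn (.of_forall hd) hU
  intro z₁ h₁ z₂ h₂ heq
  by_contra hz
  have hfa : AnalyticOnNhd ℂ (fun z => f z - f z₂) U :=
    ((hf.sub_const (f z₂)).analyticOnNhd hU)
  have hev : ∀ᶠ w in 𝓝[≠] z₂, f w - f z₂ ≠ 0 := by
    refine (hfa z₂ h₂).eventually_eq_zero_or_eventually_ne_zero.resolve_left fun h => ?_
    have h3 := hfa.eqOn_zero_of_preconnected_of_eventuallyEq_zero hUc h₂ h
    obtain ⟨z, hzU, hz'⟩ := hne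
    apply hz'
    have : f =ᶠ[𝓝 z] fun _ => f z₂ := by
      filter_upwards [hU.mem_nhds hzU] with w hw
      exact sub_eq_zero.1 (h3 hw)
    rw [this.deriv_eq]; simp
  obtain ⟨r, hr, hb⟩ : ∃ r > 0, closedBall z₂ r ⊆ U ∩ {z₁}ᶜ ∩ {w | w ≠ z₂ → f w - f z₂ ≠ 0} :=
    Metric.nhds_basis_closedBall.mem_iff.1 (inter_mem (inter_mem (hU.mem_nhds h₂)
      (isOpen_compl_singleton.mem_nhds (Ne.symm hz))) (eventually_nhdsWithin_iff.1 hev))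
  have hsub : closedBall z₂ r ⊆ U := fun w hw => (hb hw).1.1
  have hcs : IsCompact (sphere z₂ r) := isCompact_sphere z₂ r
  have hsn : (sphere z₂ r).Nonempty := NormedSpace.sphere_nonempty.2 hr.le
  obtain ⟨x, hx, hmin⟩ := hcs.exists_isMinOn (f := fun w => ‖f w - f z₂‖) hsn
    ((hf.continuousOn.mono (sphere_subset_closedBall.trans hsub)).sub continuousOn_const).norm
  -- The minimum of |f - f z₂| on a circle around z₂ that encloses no other zero of it and leaves z₁
  -- outside.
  set ε : ℝ := ‖f x - f z₂‖ with hε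
  have hεp : 0 < ε := by
    rw [hε, norm_pos_iff]
    exact (hb (sphere_subset_closedBall hx)).2 (by rintro rfl; simp at hx; exact hr.ne hx)
  have hun : TendstoUniformlyOn F f l (closedBall z₂ r) :=
    (tendstoLocallyUniformlyOn_iff_forall_isCompact hU).1 hF _ hsub (isCompact_closedBall z₂ r)
  have ev1 := Metric.tendstoUniformlyOn_iff.1 hun (ε / 8) (by positivity)
  have ev2 : ∀ᶠ i in l, dist (F i z₁) (f z₁) < ε / 8 :=
    (hF.tendsto_at h₁).eventually (ball_mem_nhds _ (by positivity))
  obtain ⟨i, h3, h4⟩ := (ev1.and ev2).exists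
  -- Quantitative open mapping: F i oscillates by at least ε/2 on the circle, so the image of the
  -- closed disc contains the ball of radius ε/4 around F i z₂. Both F i z₁ and F i z₂ are within
  -- ε/8 of f z₁ = f z₂.
  have hmem : F i z₁ ∈ F i '' closedBall z₂ r := by
    refine DiffContOnCl.ball_subset_image_closedBall (ε := ε / 2)
      ((hd i).diffContOnCl_ball hsub) hr (fun z hz => ?_) ?_ ?_
    · have e1 := h3 z (sphere_subset_closedBall hz)
      have e2 := h3 z₂ (mem_closedBall_self hr.le)
      have e3 : ε ≤ ‖f z - f z₂‖ := hmin hz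
      rw [dist_eq_norm] at e1 e2
      have e4 : f z - f z₂ = (f z - F i z) + (F i z - F i z₂) - (f z₂ - F i z₂) := by ring
      rw [e4] at e3
      have := norm_sub_le ((f z - F i z) + (F i z - F i z₂)) (f z₂ - F i z₂)
      have := norm_add_le (f z - F i z) (F i z - F i z₂)
      linarith
    · intro h
      refine not_eventually_const_of_injOn hU (hi i) h₂ ?_
      simpa using h
    · have e2 := h3 z₂ (mem_closedBall_self hr.le)
      rw [heq] at h4
      rw [mem_ball]
      linarith [dist_triangle (F i z₁) (f z₂) (F i z₂)]
  obtain ⟨y, hy, hyz⟩ := hmem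
  have := hi i (hsub hy) h₁ hyz
  exact (hb hy).1.2 this

/-- Montel's theorem without extracting subsequences: pointwise limits along an ultrafilter exist by
compactness of the closed disc, and the uniform Lipschitz bounds make the convergence locally
uniform. -/
theorem exists_tendstoLocallyUniformlyOn_of_univalentFamily {U : Set ℂ} (hU : IsOpen U) {z₀ : ℂ}
    {F : ℕ → ℂ → ℂ} (hF : ∀ n, F n ∈ univalentFamily U z₀) :
    ∃ f : ℂ → ℂ, TendstoLocallyUniformlyOn F f (hyperfilter ℕ) U ∧
      MapsTo f U (closedBall 0 1) ∧ (z₀ ∈ U → f z₀ = 0) := by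
  have hlim : ∀ z : ℂ, ∃ y : ℂ, z ∈ U → y ∈ closedBall (0 : ℂ) 1 ∧
      Tendsto (fun n => F n z) (hyperfilter ℕ) (𝓝 y) := by
    intro z
    by_cases hz : z ∈ U
    · obtain ⟨y, hy, h⟩ := (isCompact_closedBall (0 : ℂ) 1).ultrafilter_le_nhds
        ((hyperfilter ℕ).map fun n => F n z) (by
          rw [le_principal_iff]
          exact Eventually.of_forall (f := (hyperfilter ℕ : Filter ℕ))
            fun n => ball_subset_closedBall ((hF n).2.2.1 hz))
      exact ⟨y, fun _ => ⟨hy, h⟩⟩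
    · exact ⟨0, fun h => absurd h hz⟩
  choose f hf using hlim
  refine ⟨f, ?_, fun z hz => (hf z hz).1, fun hz => ?_⟩
  · rw [Metric.tendstoLocallyUniformlyOn_iff]
    intro ε hε z hz
    obtain ⟨R, hR, hRU⟩ := Metric.isOpen_iff.1 hU z hz
    have hfl : ∀ w ∈ ball z R, dist (f w) (f z) ≤ 2 / R * dist w z := fun w hw =>
      le_of_tendsto ((hf w (hRU hw)).2.dist (hf z hz).2)
        (.of_forall fun n => univalentFamily_lipschitz (hF n) hRU hw)
    refine ⟨ball z (min R (ε * R / 8)), mem_nhdsWithin_of_mem_nhds (ball_mem_nhds _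
      (lt_min hR (by positivity))), ?_⟩
    filter_upwards [(hf z hz).2.eventually (ball_mem_nhds _ (show 0 < ε / 4 by positivity))]
      with n hn w hw
    have hwR : w ∈ ball z R := ball_subset_ball (min_le_left _ _) hw
    have h1 := hfl w hwR
    have h2 := univalentFamily_lipschitz (hF n) hRU hwR
    have h3 : 2 / R * dist w z ≤ ε / 4 := by
      have : dist w z ≤ ε * R / 8 := (mem_ball.1 hw).le.trans (min_le_right _ _)
      calc 2 / R * dist w z ≤ 2 / R * (ε * R / 8) := by gcongr
        _ = ε / 4 := by field_simp; norm_num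
    rw [dist_comm] at hn
    rw [dist_comm] at h2
    linarith [dist_triangle (f w) (f z) (F n w), dist_triangle (f z) (F n z) (F n w)]
  · refine tendsto_nhds_unique (hf z₀ hz).2 ?_
    simp only [(hF _).2.2.2]
    exact tendsto_const_nhds

/-- Koebe's square root trick: move an omitted value c to 0, take a square root h, and recentre.
With t = |h z₀| = √|c| < 1, the derivative at z₀ is multiplied in modulus by (1 + t²) / (2t) > 1. -/
theorem exists_larger_deriv_of_not_surjOn {U : Set ℂ} (hUo : IsOpen U) (hUc : IsSimplyConnected U)
    {z₀ : ℂ} (hz₀ : z₀ ∈ U) {f : ℂ → ℂ} (hf : f ∈ univalentFamily U z₀)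
    (hs : ¬ SurjOn f U unitDisc) :
    ∃ g ∈ univalentFamily U z₀, ‖deriv f z₀‖ < ‖deriv g z₀‖ := by
  obtain ⟨c, hc, hcf⟩ := not_subset.1 hs
  have hc' : ‖c‖ < 1 := by simpa [unitDisc] using hc
  have hA := isConformalMap_discAut hc'
  have hne : ∀ z ∈ U, (discAut c ∘ f) z ≠ 0 := by
    intro z hz h
    have h1 : discAut c (f z) = discAut c c := by rw [discAut_self]; exact h
    exact hcf ⟨z, hz, hA.2.injOn (hf.2.2.1 hz) hc h1⟩
  obtain ⟨h, hh, hsq⟩ := exists_differentiableOn_sq_eq hUo hUc (hA.1.comp hf.1 hf.2.2.1) hne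
  have hm : MapsTo h U unitDisc := by
    intro z hz
    have h1 := hA.2.mapsTo (hf.2.2.1 hz)
    have h2 := hsq z hz
    simp only [unitDisc, mem_ball_zero_iff, Function.comp_apply] at h1 h2 ⊢
    rw [← h2, norm_pow] at h1
    by_contra! h3
    nlinarith [one_le_pow₀ h3 (n := 2)]
  have hi : InjOn h U := by
    intro x hx y hy hxy
    have h1 := hsq x hx
    rw [hxy, hsq y hy] at h1
    exact (hA.2.injOn.comp hf.2.1 hf.2.2.1 hy hx h1).symm
  refine ⟨_, discAut_comp_mem_univalentFamily hz₀ hh hi hm, ?_⟩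
  have hcn : c ≠ 0 := by
    rintro rfl
    exact hcf ⟨z₀, hz₀, hf.2.2.2⟩
  have hfd := (hf.1.differentiableAt (hUo.mem_nhds hz₀)).hasDerivAt
  have hhd := (hh.differentiableAt (hUo.mem_nhds hz₀)).hasDerivAt
  have d1 : HasDerivAt (discAut c ∘ f) ((1 - conj c * c) * deriv f z₀) z₀ := by
    have := (hasDerivAt_discAut (c := c) (z := f z₀) (by simp [hf.2.2.2])).comp z₀ hfd
    simpa [hf.2.2.2] using this
  have d2 : HasDerivAt (discAut c ∘ f) (2 * h z₀ * deriv h z₀) z₀ := by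
    have := (hhd.pow 2).congr_of_eventuallyEq (f₁ := discAut c ∘ f)
      (by filter_upwards [hUo.mem_nhds hz₀] with w hw using (hsq w hw).symm)
    simpa using this
  have e1 := d1.unique d2
  have hh0 : h z₀ ^ 2 = -c := by rw [hsq z₀ hz₀]; simp [discAut, hf.2.2.2]
  set t : ℝ := ‖h z₀‖ with ht
  have ht2 : ‖c‖ = t ^ 2 := by rw [ht, ← norm_pow, hh0, norm_neg]
  have ht1 : t < 1 := by simpa [unitDisc] using hm hz₀
  have ht0 : 0 < t := by
    rw [ht, norm_pos_iff]; intro h5; rw [h5] at hh0; simp at hh0; exact hcn hh0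
  have nrm : ∀ c : ℂ, ‖c‖ < 1 → ‖1 - conj c * c‖ = 1 - ‖c‖ ^ 2 := by
    intro c hc
    rw [mul_comm, mul_conj, normSq_eq_norm_sq, ← ofReal_one, ← ofReal_sub, norm_real,
      Real.norm_of_nonneg]
    nlinarith [norm_nonneg c]
  have e2 : (1 - t ^ 4) * ‖deriv f z₀‖ = 2 * t * ‖deriv h z₀‖ := by
    have := congrArg norm e1
    rw [norm_mul, norm_mul, norm_mul, nrm c hc', ht2] at this
    simpa [← ht, ← pow_mul] using this
  have d3 := ((hasDerivAt_discAut (c := h z₀) (z := h z₀)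
    (one_sub_conj_mul_ne_zero ht1 ht1.le)).comp z₀ hhd).deriv
  rw [d3, norm_mul, norm_div, norm_pow, nrm _ ht1, ← ht]
  have h4 : 0 < 1 - t ^ 2 := by nlinarith
  have hf0 : 0 < ‖deriv f z₀‖ := norm_pos_iff.2 (deriv_ne_zero_of_injOn hUo hf.1 hf.2.1 hz₀)
  have e3 : ‖deriv h z₀‖ = (1 - t ^ 4) * ‖deriv f z₀‖ / (2 * t) := by
    rw [e2]; field_simp
  have e4 : (1 - t ^ 2) / (1 - t ^ 2) ^ 2 * ‖deriv h z₀‖ = (1 + t ^ 2) / (2 * t) * ‖deriv f z₀‖ := by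
    rw [e3]; field_simp; ring
  rw [e4]
  have e5 : 1 < (1 + t ^ 2) / (2 * t) := by
    rw [one_lt_div (by positivity)]; nlinarith [sq_pos_of_pos (sub_pos.2 ht1)]
  nlinarith

/-- A map of maximal |f'(z₀)| in the normalized family exists by compactness, is injective by
Hurwitz, and is onto because otherwise the square root trick would improve it. -/
theorem exists_conformalMap_unitDisc {U : Set ℂ} (hUo : IsOpen U) (hUc : IsSimplyConnected U)
    (hU : U ≠ univ) : ∃ φ, IsConformalMap φ U unitDisc := by
  obtain ⟨z₀, hz₀⟩ := hUc.nonempty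
  obtain ⟨R, hR, hRU⟩ := Metric.isOpen_iff.1 hUo z₀ hz₀
  set S : Set ℝ := (fun f => ‖deriv f z₀‖) '' univalentFamily U z₀ with hS
  have hSn : S.Nonempty := (univalentFamily_nonempty hUo hUc hU hz₀).image _
  have hSb : BddAbove S := by
    refine ⟨1 / R, ?_⟩
    rintro _ ⟨f, hf, rfl⟩
    exact norm_deriv_le_of_univalentFamily hf hR hRU
  obtain ⟨u, -, hu, huS⟩ := exists_seq_tendsto_sSup hSn hSb
  choose F hF hFu using huS
  obtain ⟨f, hlim, hmaps, hf0⟩ := exists_tendstoLocallyUniformlyOn_of_univalentFamily hUo hF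
  have hd : DifferentiableOn ℂ f U := hlim.differentiableOn (.of_forall fun n => (hF n).1) hUo
  have hder : ‖deriv f z₀‖ = sSup S := by
    have h1 := ((hlim.deriv (.of_forall fun n => (hF n).1) hUo).tendsto_at hz₀).norm
    -- The ultrafilter refines `atTop`, so a maximizing sequence still converges to the supremum
    -- along it.
    have h2 : Tendsto u (hyperfilter ℕ) (𝓝 (sSup S)) :=
      hu.mono_left (Nat.hyperfilter_le_atTop)
    refine tendsto_nhds_unique h1 (h2.congr fun n => ?_)
    rw [← hFu]; rfl
  have hne : deriv f z₀ ≠ 0 := by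
    rw [← norm_pos_iff, hder]
    obtain ⟨g, hg⟩ := univalentFamily_nonempty hUo hUc hU hz₀
    exact (norm_pos_iff.2 (deriv_ne_zero_of_injOn hUo hg.1 hg.2.1 hz₀)).trans_le
      (le_csSup hSb (mem_image_of_mem _ hg))
  have hi := injOn_of_tendstoLocallyUniformlyOn hUo hUc.isPathConnected.isConnected.isPreconnected
    hlim (fun n => (hF n).1) (fun n => (hF n).2.1) ⟨z₀, hz₀, hne⟩
  have hm : MapsTo f U unitDisc := by
    have h1 : f '' U ⊆ interior (closedBall (0 : ℂ) 1) :=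
      interior_maximal hmaps.image_subset (isOpen_image_of_injOn hUo hd hi)
    rw [interior_closedBall _ one_ne_zero] at h1
    exact mapsTo_iff_image_subset.2 h1
  have hmem : f ∈ univalentFamily U z₀ := ⟨hd, hi, hm, hf0 hz₀⟩
  refine ⟨f, hd, hm, hi, ?_⟩
  by_contra hs
  obtain ⟨g, hg, hlt⟩ := exists_larger_deriv_of_not_surjOn hUo hUc hz₀ hmem hs
  rw [hder] at hlt
  exact absurd (le_csSup hSb (mem_image_of_mem _ hg)) (not_le.2 hlt)

theorem PlanarDomain.exists_conformalMap (Ω : PlanarDomain) :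
    ∃ φ, IsConformalMap φ Ω.carrier unitDisc :=
  exists_conformalMap_unitDisc Ω.isOpen Ω.simplyConnected Ω.ne_univ

end

section

open Metric Set Complex ComplexConjugate MeasureTheory

/-! ### A weak area theorem -/

/-- Expand the square and use |h - b|² ≥ 0. On a circle |z| is constant, and with b = h(0) the
remaining real part is that of a holomorphic function vanishing at 0; its mean is 0. This replaces
Fourier expansions. -/
theorem normSq_sub_inv_sq_ge (h b z : ℂ) (hz : z ≠ 0) :
    ‖b‖ ^ 2 + (‖z‖ ^ 4)⁻¹ + (-2 * ((‖z‖ ^ 4)⁻¹ : ℝ) * z ^ 2 * h + 2 * conj b * (h - b)).re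
      ≤ ‖h - 1 / z ^ 2‖ ^ 2 := by
  have e1 : conj (1 / z ^ 2) = (((‖z‖ ^ 4)⁻¹ : ℝ) : ℂ) * z ^ 2 := by
    have h1 : conj z * z = ((‖z‖ ^ 2 : ℝ) : ℂ) := by
      rw [mul_comm, mul_conj, normSq_eq_norm_sq]
    have h2 : conj z ≠ 0 := by simpa using hz
    have h3 : ((‖z‖ ^ 4 : ℝ) : ℂ) = (conj z * z) ^ 2 := by rw [h1, ← ofReal_pow, ← pow_mul]
    rw [ofReal_inv, h3]
    simp only [map_div₀, map_one, map_pow]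
    field_simp
  have e2 : ‖h - 1 / z ^ 2‖ ^ 2 = ‖h‖ ^ 2 + (‖z‖ ^ 4)⁻¹ - 2 * (h * conj (1 / z ^ 2)).re := by
    rw [← normSq_eq_norm_sq, normSq_sub, normSq_eq_norm_sq, normSq_eq_norm_sq]
    congr 2
    rw [norm_div, norm_one, norm_pow]
    rw [div_pow, one_pow, ← pow_mul, one_div]
  have e3 : 0 ≤ ‖h - b‖ ^ 2 := sq_nonneg _
  have e4 : ‖h - b‖ ^ 2 = ‖h‖ ^ 2 + ‖b‖ ^ 2 - 2 * (h * conj b).re := by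
    rw [← normSq_eq_norm_sq, normSq_sub, normSq_eq_norm_sq, normSq_eq_norm_sq]
  have e5 : (2 * conj b * (h - b)).re = 2 * (h * conj b).re - 2 * ‖b‖ ^ 2 := by
    rw [← normSq_eq_norm_sq, normSq_apply]; simp; ring
  have e6 : (-2 * ((‖z‖ ^ 4)⁻¹ : ℝ) * z ^ 2 * h).re = - 2 * (h * conj (1 / z ^ 2)).re := by
    rw [e1]
    have : (-2 * ((‖z‖ ^ 4)⁻¹ : ℝ) * z ^ 2 * h) =
      ((-2 : ℝ) : ℂ) * (h * ((((‖z‖ ^ 4)⁻¹ : ℝ) : ℂ) * z ^ 2)) := by push_cast; ring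
    rw [this, re_ofReal_mul]
  rw [add_re, e5, e6, e2]
  linarith

theorem circle_integral_normSq_ge {h : ℂ → ℂ} (hh : DifferentiableOn ℂ h unitDisc) {ρ : ℝ}
    (h0 : 0 < ρ) (h1 : ρ < 1) :
    2 * Real.pi * (‖h 0‖ ^ 2 + (ρ ^ 4)⁻¹) ≤
      ∫ θ in (-Real.pi)..Real.pi, ‖h (circleMap 0 ρ θ) - 1 / circleMap 0 ρ θ ^ 2‖ ^ 2 := by
  set Q : ℂ → ℂ := fun z => -2 * ((ρ ^ 4)⁻¹ : ℝ) * z ^ 2 * h z + 2 * conj (h 0) * (h z - h 0)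
    with hQ
  have hsub : closedBall (0 : ℂ) ρ ⊆ unitDisc := closedBall_subset_ball h1
  have hQd : DifferentiableOn ℂ Q unitDisc := by
    have : DifferentiableOn ℂ (fun z : ℂ => -2 * (((ρ ^ 4)⁻¹ : ℝ) : ℂ) * z ^ 2) unitDisc := by
      fun_prop
    exact (this.mul hh).add ((hh.sub_const _).const_mul _)
  have hcm : ∀ θ, circleMap 0 ρ θ ∈ closedBall (0 : ℂ) ρ := fun θ =>
    circleMap_mem_closedBall 0 h0.le θ
  have hcont : ∀ f : ℂ → ℂ, ContinuousOn f unitDisc → Continuous fun θ => f (circleMap 0 ρ θ) :=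
    fun f hf => hf.comp_continuous (continuous_circleMap 0 ρ) fun θ => hsub (hcm θ)
  have hmean : ∫ θ in (-Real.pi)..Real.pi, Q (circleMap 0 ρ θ) = 0 := by
    have h2 := DiffContOnCl.circleAverage (f := Q) (c := 0) (R := ρ)
      (by rw [abs_of_pos h0]; exact hQd.diffContOnCl_ball hsub)
    rw [Real.circleAverage_def] at h2
    have h3 : Q 0 = 0 := by simp [hQ]
    rw [h3, smul_eq_zero] at h2
    have h4 := h2.resolve_left (by positivity)
    have hp : Function.Periodic (fun θ => Q (circleMap 0 ρ θ)) (2 * Real.pi) :=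
      (periodic_circleMap 0 ρ).comp Q
    have h5 := hp.intervalIntegral_add_eq (-Real.pi) 0
    rw [zero_add, h4] at h5
    rwa [show -Real.pi + 2 * Real.pi = Real.pi by ring] at h5
  have hre : ∫ θ in (-Real.pi)..Real.pi, (Q (circleMap 0 ρ θ)).re = 0 := by
    have := intervalIntegral.intervalIntegral_re (μ := volume) (a := -Real.pi) (b := Real.pi)
      (f := fun θ => Q (circleMap 0 ρ θ)) ((hcont Q hQd.continuousOn).intervalIntegrable _ _)
    simpa [hmean] using this
  have hint : IntervalIntegrable (fun θ => (Q (circleMap 0 ρ θ)).re) volume (-Real.pi) Real.pi :=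
    (continuous_re.comp (hcont Q hQd.continuousOn)).intervalIntegrable _ _
  have hne : ∀ θ, circleMap 0 ρ θ ≠ 0 := fun θ => circleMap_ne_center h0.ne'
  calc 2 * Real.pi * (‖h 0‖ ^ 2 + (ρ ^ 4)⁻¹)
      = ∫ θ in (-Real.pi)..Real.pi, (‖h 0‖ ^ 2 + (ρ ^ 4)⁻¹ + (Q (circleMap 0 ρ θ)).re) := by
        rw [intervalIntegral.integral_add (by simp) hint, hre]
        simp; ring
    _ ≤ _ := by
        apply intervalIntegral.integral_mono_on (by linarith [Real.pi_pos])
        · exact IntervalIntegrable.add (by simp) hint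
        · apply Continuous.intervalIntegrable
          exact (((hcont h hh.continuousOn).sub (continuous_const.div
            ((continuous_circleMap 0 ρ).pow 2) fun θ => pow_ne_zero 2 (hne θ))).norm).pow 2
        · intro θ _
          have h2 := normSq_sub_inv_sq_ge (h (circleMap 0 ρ θ)) (h 0) _ (hne θ)
          rw [norm_circleMap_zero, abs_of_pos h0] at h2
          exact h2

theorem det_restrictScalars_toSpanSingleton (c : ℂ) :
    ((ContinuousLinearMap.toSpanSingleton ℂ c).restrictScalars ℝ).det = ‖c‖ ^ 2 := by
  simp [ContinuousLinearMap.det, LinearMap.det_restrictScalars, Algebra.norm_complex_eq,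
    normSq_eq_norm_sq]

/-- The area is the integral of the Jacobian |H' - z⁻²|². In polar coordinates each circle of radius
ρ contributes at least 2π (|H'(0)|² ρ + ρ⁻³), which is integrated over (ε, r). -/
theorem volume_image_annulus_ge {H : ℂ → ℂ} (hH : DifferentiableOn ℂ H unitDisc) {ε r : ℝ}
    (hε : 0 < ε) (hεr : ε ≤ r) (hr : r < 1) {A : Set ℂ} (hA : A = {z | ε < ‖z‖ ∧ ‖z‖ < r})
    (hi : InjOn (fun z => 1 / z + H z) A) :
    ENNReal.ofReal (Real.pi * ((ε ^ 2)⁻¹ - (r ^ 2)⁻¹) +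
      Real.pi * ‖deriv H 0‖ ^ 2 * (r ^ 2 - ε ^ 2)) ≤ volume ((fun z => 1 / z + H z) '' A) := by
  have hAo : IsOpen A := by
    rw [hA]; exact (isOpen_lt continuous_const continuous_norm).inter
      (isOpen_lt continuous_norm continuous_const)
  have hAm : MeasurableSet A := hAo.measurableSet
  have hh : DifferentiableOn ℂ (deriv H) unitDisc := hH.deriv isOpen_ball
  have hder : ∀ z ∈ A, HasFDerivWithinAt (fun z => 1 / z + H z)
      ((ContinuousLinearMap.toSpanSingleton ℂ (deriv H z - 1 / z ^ 2)).restrictScalars ℝ) A z := by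
    intro z hz
    rw [hA] at hz
    have hz0 : z ≠ 0 := norm_pos_iff.1 (hε.trans hz.1)
    have hzd : z ∈ unitDisc := by simpa [unitDisc] using hz.2.trans hr
    have h1 : HasDerivAt (fun z => 1 / z + H z) (deriv H z - 1 / z ^ 2) z := by
      have := (hasDerivAt_inv hz0).add (hH.differentiableAt (isOpen_ball.mem_nhds hzd)).hasDerivAt
      convert! this using 1
      · ext w; simp
      · rw [one_div]; ring
    exact (h1.hasFDerivAt.restrictScalars ℝ).hasFDerivWithinAt
  set N : ℂ → ENNReal := fun z => ENNReal.ofReal (‖deriv H z - 1 / z ^ 2‖ ^ 2) with hN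
  have hNm : Measurable N := by
    have : Measurable (deriv H) := measurable_deriv H
    fun_prop
  have e1 : volume ((fun z => 1 / z + H z) '' A) = ∫⁻ z in A, N z := by
    have := lintegral_image_eq_lintegral_abs_det_fderiv_mul volume hAm hder hi (fun _ => 1)
    rw [setLIntegral_one] at this
    rw [this]
    refine setLIntegral_congr_fun hAm fun z hz => ?_
    simp only [det_restrictScalars_toSpanSingleton, mul_one, hN]
    rw [abs_of_nonneg (sq_nonneg _)]
  have hIm : Measurable (A.indicator N) := hNm.indicator hAm
  have hps : ∀ p : ℝ × ℝ, Complex.polarCoord.symm p = circleMap 0 p.1 p.2 := by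
    intro p
    rw [Complex.polarCoord_symm_apply, circleMap_zero, exp_mul_I]
    simp
  have e2 : ∫⁻ z in A, N z = ∫⁻ ρ in Ioi (0 : ℝ), ∫⁻ θ in Ioo (-Real.pi) Real.pi,
      ENNReal.ofReal ρ * A.indicator N (circleMap 0 ρ θ) := by
    rw [← lintegral_indicator hAm, ← Complex.lintegral_comp_polarCoord_symm, polarCoord_target,
      Measure.volume_eq_prod, setLIntegral_prod]
    · simp only [hps, smul_eq_mul]
    · simp only [hps, smul_eq_mul]
      apply Measurable.aemeasurable
      apply Measurable.mul
      · fun_prop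
      · apply hIm.comp
        apply Continuous.measurable
        simp only [circleMap]
        fun_prop
  have e3 : ∀ ρ ∈ Ioo ε r, ENNReal.ofReal (2 * Real.pi * (‖deriv H 0‖ ^ 2 * ρ + (ρ ^ 3)⁻¹)) ≤
      ∫⁻ θ in Ioo (-Real.pi) Real.pi, ENNReal.ofReal ρ * A.indicator N (circleMap 0 ρ θ) := by
    intro ρ hρ
    have hρ0 : 0 < ρ := hε.trans hρ.1
    have hmem : ∀ θ, circleMap 0 ρ θ ∈ A := by
      intro θ; rw [hA, mem_ofPred_eq, norm_circleMap_zero, abs_of_pos hρ0]; exact hρ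
    have hcont : Continuous fun θ =>
        ‖deriv H (circleMap 0 ρ θ) - 1 / circleMap 0 ρ θ ^ 2‖ ^ 2 := by
      refine ((Continuous.sub ?_ (continuous_const.div
            ((continuous_circleMap 0 ρ).pow 2) fun θ =>
            pow_ne_zero 2 (circleMap_ne_center hρ0.ne'))).norm).pow 2
      refine hh.continuousOn.comp_continuous (continuous_circleMap 0 ρ) fun θ => ?_
      simp only [unitDisc, mem_ball_zero_iff, norm_circleMap_zero, abs_of_pos hρ0]
      exact hρ.2.trans hr
    have h2 := circle_integral_normSq_ge hh hρ0 (hρ.2.trans hr)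
    simp only [indicator_of_mem (hmem _), hN]
    rw [lintegral_const_mul' _ _ ENNReal.ofReal_ne_top, ← ofReal_integral_eq_lintegral_ofReal,
      ← ENNReal.ofReal_mul hρ0.le]
    · apply ENNReal.ofReal_le_ofReal
      rw [intervalIntegral.integral_of_le (by linarith [Real.pi_pos]),
        integral_Ioc_eq_integral_Ioo] at h2
      refine le_trans (le_of_eq ?_) (mul_le_mul_of_nonneg_left h2 hρ0.le)
      field_simp
    · exact (hcont.integrableOn_Icc).mono_set Ioo_subset_Icc_self
    · exact .of_forall fun θ => by positivity
  rw [e1, e2]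
  have hFc : ContinuousOn (fun ρ : ℝ => 2 * Real.pi * (‖deriv H 0‖ ^ 2 * ρ + (ρ ^ 3)⁻¹))
      (Icc ε r) := by
    apply ContinuousOn.mul continuousOn_const
    apply ContinuousOn.add (by fun_prop)
    exact ContinuousOn.inv₀ (by fun_prop) fun x hx => pow_ne_zero 3 (hε.trans_le hx.1).ne'
  calc _ = ENNReal.ofReal (∫ ρ in ε..r, 2 * Real.pi * (‖deriv H 0‖ ^ 2 * ρ + (ρ ^ 3)⁻¹)) := by
        congr 1
        rw [intervalIntegral.integral_eq_sub_of_hasDerivAt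
          (f := fun ρ => Real.pi * (‖deriv H 0‖ ^ 2 * ρ ^ 2 - (ρ ^ 2)⁻¹))]
        · ring
        · intro x hx
          rw [uIcc_of_le hεr] at hx
          have hx0 : x ≠ 0 := (hε.trans_le hx.1).ne'
          have h1 := ((hasDerivAt_pow 2 x).fun_inv (pow_ne_zero 2 hx0))
          have h2 := (((hasDerivAt_pow 2 x).const_mul (‖deriv H 0‖ ^ 2)).fun_sub h1).const_mul
            Real.pi
          refine h2.congr_deriv ?_
          simp only [Nat.cast_ofNat]
          field_simp
          ring
        · apply ContinuousOn.intervalIntegrable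
          rwa [uIcc_of_le hεr]
    _ = ∫⁻ ρ in Ioo ε r, ENNReal.ofReal (2 * Real.pi * (‖deriv H 0‖ ^ 2 * ρ + (ρ ^ 3)⁻¹)) := by
        rw [intervalIntegral.integral_of_le hεr, integral_Ioc_eq_integral_Ioo,
          ofReal_integral_eq_lintegral_ofReal]
        · exact (hFc.integrableOn_Icc).mono_set Ioo_subset_Icc_self
        · refine (ae_restrict_iff' measurableSet_Ioo).2 (.of_forall fun x hx => ?_)
          have : 0 < x := hε.trans hx.1
          simp only [Pi.zero_apply]
          have := Real.pi_pos
          positivity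
    _ ≤ ∫⁻ ρ in Ioo ε r, ∫⁻ θ in Ioo (-Real.pi) Real.pi,
          ENNReal.ofReal ρ * A.indicator N (circleMap 0 ρ θ) :=
        setLIntegral_mono' measurableSet_Ioo e3
    _ ≤ _ := lintegral_mono_set fun x hx => hε.trans hx.1

end

section

open Metric Set Complex ComplexConjugate MeasureTheory

/-- A weak form of the area theorem. -/
theorem norm_deriv_le_of_injOn_inv_add {H : ℂ → ℂ} (hH : DifferentiableOn ℂ H unitDisc)
    (h0 : H 0 = 0) (hi : InjOn (fun z => 1 / z + H z) (unitDisc \ {0})) :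
    ‖deriv H 0‖ ≤ 20 := by
  set b : ℝ := ‖deriv H 0‖ with hb
  have hb0 : 0 ≤ b := norm_nonneg _
  have hn0 : unitDisc ∈ 𝓝 (0 : ℂ) := ball_mem_nhds _ one_pos
  have hkd : DifferentiableOn ℂ (dslope H 0) unitDisc := (differentiableOn_dslope hn0).2 hH
  have hHk : ∀ z, H z = z * dslope H 0 z := by
    intro z
    have := sub_smul_dslope H 0 z
    simp only [sub_zero, h0, smul_eq_mul] at this
    exact this.symm
  obtain ⟨δ, hδ, hδk⟩ : ∃ δ > 0, ∀ z ∈ ball (0 : ℂ) δ, ‖dslope H 0 z‖ < b + 1 := by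
    have : ∀ᶠ z in 𝓝 (0 : ℂ), ‖dslope H 0 z‖ < b + 1 := by
      refine ((hkd.continuousOn.continuousAt hn0).norm.tendsto).eventually (gt_mem_nhds ?_)
      rw [dslope_same]; linarith
    exact Metric.eventually_nhds_iff_ball.1 this
  obtain ⟨C, hC⟩ := (isCompact_closedBall (0 : ℂ) (1 / 2)).exists_bound_of_continuousOn
    (hH.continuousOn.mono (closedBall_subset_ball (by norm_num)))
  have hC0 : 0 ≤ C := (norm_nonneg _).trans (hC 0 (by simp))
  -- For |z| < η one has |H z| ≤ (b + 1)|z|, and the bound 1/x + (b + 1)x at x = |z| is at most its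
  -- value at ε.
  set η : ℝ := min (min δ 1) (1 / (b + 1)) with hη
  have hη0 : 0 < η := lt_min (lt_min hδ one_pos) (by positivity)
  have hη1 : η ≤ 1 := (min_le_left _ _).trans (min_le_right _ _)
  have hηδ : η ≤ δ := (min_le_left _ _).trans (min_le_left _ _)
  have hηb : η * (b + 1) ≤ 1 := by
    have : η ≤ 1 / (b + 1) := min_le_right _ _
    rwa [le_div_iff₀ (by positivity)] at this
  -- The last term makes 1/ε dominate the map on η ≤ |z| < 1/2, so the whole annulus is sent into
  -- the disc of radius M.
  set ε : ℝ := min (min (1 / 4) (1 / (b + 1))) (1 / (1 / η + C)) with hε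
  have hε0 : 0 < ε := lt_min (lt_min (by norm_num) (by positivity)) (by positivity)
  have hε4 : ε ≤ 1 / 4 := (min_le_left _ _).trans (min_le_left _ _)
  have hεb : (b + 1) * ε ≤ 1 := by
    have : ε ≤ 1 / (b + 1) := (min_le_left _ _).trans (min_le_right _ _)
    rw [le_div_iff₀ (by positivity)] at this; linarith
  have hεC : 1 / η + C ≤ 1 / ε := by
    have : ε ≤ 1 / (1 / η + C) := min_le_right _ _
    rwa [le_one_div hε0 (by positivity)] at this
  set M : ℝ := 1 / ε + (b + 1) * ε with hM
  have hM0 : 0 < M := by positivity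
  have hsub : (fun z => 1 / z + H z) '' {z | ε < ‖z‖ ∧ ‖z‖ < 1 / 2} ⊆ closedBall 0 M := by
    rintro _ ⟨z, ⟨hz1, hz2⟩, rfl⟩
    rw [mem_closedBall_zero_iff]
    have hz0 : 0 < ‖z‖ := hε0.trans hz1
    refine (norm_add_le _ _).trans ?_
    rw [norm_div, norm_one]
    rcases lt_or_ge ‖z‖ η with h | h
    · have h1 : ‖H z‖ ≤ ‖z‖ * (b + 1) := by
        rw [hHk, norm_mul]
        have := hδk z (by simpa using h.trans_le hηδ)
        gcongr
      have h2 : 1 / ‖z‖ + ‖z‖ * (b + 1) ≤ 1 / ε + (b + 1) * ε := by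
        have h3 : 1 / ε + (b + 1) * ε - (1 / ‖z‖ + ‖z‖ * (b + 1)) =
          (‖z‖ - ε) * (1 - ε * (‖z‖ * (b + 1))) / (ε * ‖z‖) := by
          field_simp; ring
        have h4 : ε * (‖z‖ * (b + 1)) ≤ 1 := by
          have : ‖z‖ * (b + 1) ≤ 1 := (mul_le_mul_of_nonneg_right h.le (by positivity)).trans hηb
          nlinarith
        have h5 : 0 ≤ (‖z‖ - ε) * (1 - ε * (‖z‖ * (b + 1))) / (ε * ‖z‖) :=
          div_nonneg (mul_nonneg (by linarith) (by linarith)) (by positivity)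
        linarith
      linarith
    · have h1 : ‖H z‖ ≤ C := hC z (by simpa using hz2.le)
      have h2 : 1 / ‖z‖ ≤ 1 / η := one_div_le_one_div_of_le hη0 h
      have : 0 ≤ (b + 1) * ε := by positivity
      linarith
  have hvol := (volume_image_annulus_ge hH hε0 (r := 1 / 2) (by linarith) (by norm_num) rfl
    (hi.mono (by
      rintro z ⟨hz1, hz2⟩
      refine ⟨by simp only [unitDisc, mem_ball_zero_iff]; linarith, ?_⟩
      rintro rfl
      simp at hz1; linarith))).trans (measure_mono hsub)
  rw [volume_closedBall, ← ENNReal.ofReal_pow hM0.le, ← ENNReal.ofReal_coe_nnreal,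
    ← ENNReal.ofReal_mul (by positivity), ENNReal.ofReal_le_ofReal_iff (by positivity)] at hvol
  simp only [NNReal.coe_real_pi] at hvol
  have hpi := Real.pi_pos
  -- Comparison of areas. The divergent ε⁻² cancels against the one in M², leaving b²/8 ≤ 2b + 7,
  -- which fails for b > 20.
  have h1 : ((ε ^ 2)⁻¹ - ((1 / 2 : ℝ) ^ 2)⁻¹) + b ^ 2 * ((1 / 2) ^ 2 - ε ^ 2) ≤ M ^ 2 := by
    refine le_of_mul_le_mul_left ?_ hpi
    linarith
  have h2 : M ^ 2 = (ε ^ 2)⁻¹ + 2 * (b + 1) + ((b + 1) * ε) ^ 2 := by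
    rw [hM]; field_simp; ring
  have h3 : ((b + 1) * ε) ^ 2 ≤ 1 := by
    rw [sq_le_one_iff₀ (by positivity)]; exact hεb
  have h4 : b ^ 2 * (1 / 8) ≤ b ^ 2 * ((1 / 2) ^ 2 - ε ^ 2) := by
    apply mul_le_mul_of_nonneg_left _ (sq_nonneg b); nlinarith
  rw [h2] at h1
  norm_num at h1
  by_contra! h5
  nlinarith

/-! ### Second coefficient and distortion of univalent functions -/

theorem isSimplyConnected_ball (z : ℂ) {r : ℝ} (hr : 0 < r) : IsSimplyConnected (ball z r) := by
  have := (convex_ball z r).contractibleSpace ⟨z, mem_ball_self hr⟩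
  exact SimplyConnectedSpace.ofContractible _

/-- A non-sharp form of Bieberbach's estimate of the second coefficient. -/
theorem norm_deriv_deriv_le_of_injOn {f : ℂ → ℂ} (hf : DifferentiableOn ℂ f unitDisc)
    (hi : InjOn f unitDisc) : ‖deriv (deriv f) 0‖ ≤ 80 * ‖deriv f 0‖ := by
  have hn0 : unitDisc ∈ 𝓝 (0 : ℂ) := ball_mem_nhds _ one_pos
  have h0m : (0 : ℂ) ∈ unitDisc := mem_ball_self one_pos
  have hc : deriv f 0 ≠ 0 := deriv_ne_zero_of_injOn isOpen_ball hf hi h0m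
  have hpd : DifferentiableOn ℂ (dslope f 0) unitDisc := (differentiableOn_dslope hn0).2 hf
  have hfp : ∀ z, f z - f 0 = z * dslope f 0 z := by
    intro z
    have := sub_smul_dslope f 0 z
    simp only [sub_zero, smul_eq_mul] at this
    exact this.symm
  have hp0 : ∀ z ∈ unitDisc, dslope f 0 z ≠ 0 := by
    intro z hz h
    have h1 := hfp z
    rw [h, mul_zero] at h1
    have h2 : z = 0 := hi hz h0m (sub_eq_zero.1 h1)
    rw [h2, dslope_same] at h
    exact hc h
  obtain ⟨s, hs, hsq⟩ := exists_differentiableOn_sq_eq isOpen_ball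
    (isSimplyConnected_ball 0 one_pos) hpd hp0
  have hs0 : ∀ z ∈ unitDisc, s z ≠ 0 := by
    intro z hz h
    have := hsq z hz
    rw [h] at this
    exact hp0 z hz (by rw [← this]; simp)
  -- second derivative in terms of the square root
  have hd2 : deriv (deriv f) 0 = 4 * s 0 * deriv s 0 := by
    have hsd := (hs.differentiableAt hn0).hasDerivAt
    have hfe : ∀ z ∈ unitDisc, HasDerivAt f (s z ^ 2 + z * (2 * s z * deriv s z)) z := by
      intro z hz
      have h1 := (hs.differentiableAt (isOpen_ball.mem_nhds hz)).hasDerivAt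
      have h2 := ((hasDerivAt_id z).mul (h1.pow 2)).add_const (f 0)
      refine (h2.congr_of_eventuallyEq ?_).congr_deriv ?_
      · filter_upwards [isOpen_ball.mem_nhds hz] with w hw
        have := hfp w
        rw [← hsq w hw] at this
        simp; rw [← this]; ring
      · simp
    have h3 : deriv f =ᶠ[𝓝 0] fun z => s z ^ 2 + z * (2 * s z * deriv s z) := by
      filter_upwards [hn0] with z hz using (hfe z hz).deriv
    rw [h3.deriv_eq]
    have hsd2 := ((hs.deriv isOpen_ball).differentiableAt hn0).hasDerivAt
    have h4 := ((hsd.pow 2).add ((hasDerivAt_id (0 : ℂ)).mul ((hsd.const_mul 2).mul hsd2)))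
    have h5 : deriv (fun z => s z ^ 2 + z * (2 * s z * deriv s z)) 0 = _ := h4.deriv
    rw [h5]
    simp
    ring
  have hd1 : deriv f 0 = s 0 ^ 2 := by rw [hsq 0 h0m, dslope_same]
  -- the odd square root transform and its reciprocal
  have hsqm : ∀ z ∈ unitDisc, z ^ 2 ∈ unitDisc := by
    intro z hz
    simp only [unitDisc, mem_ball_zero_iff, norm_pow] at hz ⊢
    exact pow_lt_one₀ (norm_nonneg _) hz two_ne_zero
  set t : ℂ → ℂ := fun z => s 0 / s z with ht
  have htd : DifferentiableOn ℂ t unitDisc := (differentiableOn_const _).div hs hs0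
  have hkd : DifferentiableOn ℂ (dslope t 0) unitDisc := (differentiableOn_dslope hn0).2 htd
  set H : ℂ → ℂ := fun z => z * dslope t 0 (z ^ 2) with hH
  have hHd : DifferentiableOn ℂ H unitDisc :=
    differentiableOn_id.mul (hkd.comp (by fun_prop) hsqm)
  have hG : ∀ z ∈ unitDisc \ {0}, 1 / z + H z = s 0 / (z * s (z ^ 2)) := by
    rintro z ⟨hz, hz0⟩
    have hz0 : z ≠ 0 := hz0
    have h1 := sub_smul_dslope t 0 (z ^ 2)
    have h2 : t 0 = 1 := by simp only [ht]; exact div_self (hs0 0 h0m)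
    rw [sub_zero, smul_eq_mul, h2] at h1
    have h3 : H z = (t (z ^ 2) - 1) / z := by
      rw [← h1, hH]; field_simp
    rw [h3, ht]
    have := hs0 _ (hsqm z hz)
    field_simp
    ring
  -- Equal values give x s(x²) = y s(y²). Squaring, f(x²) = f(y²), so x² = y², and then the factors
  -- s cancel.
  have hinj : InjOn (fun z => 1 / z + H z) (unitDisc \ {0}) := by
    intro x hx y hy hxy
    simp only [hG x hx, hG y hy] at hxy
    have hx0 : x ≠ 0 := hx.2
    have hy0 : y ≠ 0 := hy.2
    have h1 : x * s (x ^ 2) = y * s (y ^ 2) := by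
      have e1 := mul_ne_zero hx0 (hs0 _ (hsqm x hx.1))
      have e2 := mul_ne_zero hy0 (hs0 _ (hsqm y hy.1))
      rw [div_eq_div_iff e1 e2] at hxy
      exact (mul_left_cancel₀ (hs0 0 h0m) hxy).symm
    have h2 : x ^ 2 = y ^ 2 := by
      apply hi (hsqm x hx.1) (hsqm y hy.1)
      have e : ∀ z ∈ unitDisc, f (z ^ 2) = (z * s (z ^ 2)) ^ 2 + f 0 := by
        intro z hz
        rw [mul_pow, hsq _ (hsqm z hz), ← hfp]; ring
      rw [e x hx.1, e y hy.1, h1]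
    rw [h2] at h1
    exact mul_right_cancel₀ (hs0 _ (hsqm y hy.1)) h1
  have hb := norm_deriv_le_of_injOn_inv_add hHd (by simp [hH]) hinj
  -- Since f''(0) / f'(0) = 4 s'(0) / s(0), the area bound 20 becomes 80.
  have hdH : deriv H 0 = - deriv s 0 / s 0 := by
    have h1 : HasDerivAt (fun z : ℂ => dslope t 0 (z ^ 2)) (deriv (dslope t 0) 0 * 0) 0 := by
      have h2 : HasDerivAt (dslope t 0) (deriv (dslope t 0) 0) ((0 : ℂ) ^ 2) := by
        simpa using (hkd.differentiableAt hn0).hasDerivAt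
      exact (h2.comp (0 : ℂ) (hasDerivAt_pow 2 (0 : ℂ))).congr_deriv (by simp)
    have h3 := ((hasDerivAt_id (0 : ℂ)).mul h1).deriv
    have h4 : deriv H 0 = dslope t 0 0 := by
      have h5 : deriv H 0 = _ := h3
      rw [h5]; simp
    rw [h4, dslope_same]
    have hsd := (hs.differentiableAt hn0).hasDerivAt
    have h6 : deriv t 0 = _ := ((hasDerivAt_const (0 : ℂ) (s 0)).div hsd (hs0 0 h0m)).deriv
    rw [h6]
    have := hs0 0 h0m
    field_simp
    ring
  rw [hdH, norm_div, norm_neg, div_le_iff₀ (norm_pos_iff.2 (hs0 0 h0m))] at hb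
  rw [hd2, hd1, norm_mul, norm_mul, norm_pow]
  simp only [Complex.norm_ofNat]
  nlinarith [norm_nonneg (s 0)]

/-- The bound at the centre, applied to w ↦ f(z + w/2); the rescaling doubles the constant. -/
theorem norm_deriv_deriv_le_of_norm_le {f : ℂ → ℂ} (hf : DifferentiableOn ℂ f unitDisc)
    (hi : InjOn f unitDisc) {z : ℂ} (hz : ‖z‖ ≤ 1 / 2) :
    ‖deriv (deriv f) z‖ ≤ 160 * ‖deriv f z‖ := by
  have hm : MapsTo (fun w : ℂ => z + w / 2) unitDisc unitDisc := by
    intro w hw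
    simp only [unitDisc, mem_ball_zero_iff] at hw ⊢
    have h1 : ‖w / 2‖ = ‖w‖ / 2 := by simp
    linarith [norm_add_le z (w / 2)]
  have hl : ∀ w : ℂ, HasDerivAt (fun w : ℂ => z + w / 2) (1 / 2) w := fun w =>
    ((hasDerivAt_id w).div_const 2).const_add z
  have h1 : DifferentiableOn ℂ (fun w : ℂ => f (z + w / 2)) unitDisc :=
    hf.comp (fun w _ => (hl w).differentiableAt.differentiableWithinAt) hm
  have h2 : InjOn (fun w : ℂ => f (z + w / 2)) unitDisc :=
    hi.comp (fun x _ y _ hxy => by simpa using hxy) hm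
  have hd : ∀ w ∈ unitDisc, deriv (fun w : ℂ => f (z + w / 2)) w = deriv f (z + w / 2) * (1 / 2) :=
    fun w hw => ((hf.differentiableAt (isOpen_ball.mem_nhds (hm hw))).hasDerivAt.comp w
      (hl w)).deriv
  have h0m : (0 : ℂ) ∈ unitDisc := mem_ball_self one_pos
  have hdd : deriv (deriv (fun w : ℂ => f (z + w / 2))) 0 = deriv (deriv f) z * (1 / 4) := by
    have h3 : deriv (fun w : ℂ => f (z + w / 2)) =ᶠ[𝓝 0]
        fun w => deriv f (z + w / 2) * (1 / 2) := by
      filter_upwards [isOpen_ball.mem_nhds h0m] with w hw using hd w hw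
    rw [h3.deriv_eq]
    have h4 := (((hf.deriv isOpen_ball).differentiableAt
      (isOpen_ball.mem_nhds (hm h0m))).hasDerivAt.comp 0 (hl 0)).mul_const (1 / 2)
    have h5 : deriv (fun w => deriv f (z + w / 2) * (1 / 2)) 0 = _ := h4.deriv
    rw [h5]
    simp only [zero_div, add_zero]; ring
  have h6 := norm_deriv_deriv_le_of_injOn h1 h2
  rw [hdd, hd 0 h0m] at h6
  simp only [zero_div, add_zero, norm_mul] at h6
  norm_num at h6
  linarith

/-- Grönwall along the segment from 0 to z for y = f'/f'(0) - 1, which satisfies |y'| ≤ 160 |z| (|y|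
+ 1) and y = 0 at the start. The bound is the same for every univalent f, as the bulk limit
requires. -/
theorem norm_deriv_div_sub_one_le {f : ℂ → ℂ} (hf : DifferentiableOn ℂ f unitDisc)
    (hi : InjOn f unitDisc) {z : ℂ} (hz : ‖z‖ ≤ 1 / 2) :
    ‖deriv f z / deriv f 0 - 1‖ ≤ Real.exp (160 * ‖z‖) - 1 := by
  rcases eq_or_ne z 0 with rfl | hz0
  · have := deriv_ne_zero_of_injOn isOpen_ball hf hi (mem_ball_self one_pos)
    simp [div_self this]
  have hc : deriv f 0 ≠ 0 := deriv_ne_zero_of_injOn isOpen_ball hf hi (mem_ball_self one_pos)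
  have hm : ∀ t ∈ Icc (0 : ℝ) 1, ‖(t : ℂ) * z‖ ≤ 1 / 2 := by
    intro t ht
    rw [norm_mul, norm_real, Real.norm_of_nonneg ht.1]
    nlinarith [norm_nonneg z, ht.1, ht.2]
  have hmd : ∀ t ∈ Icc (0 : ℝ) 1, (t : ℂ) * z ∈ unitDisc := by
    intro t ht
    have := hm t ht
    simp only [unitDisc, mem_ball_zero_iff]; linarith
  have hder : ∀ t ∈ Icc (0 : ℝ) 1, HasDerivAt (fun t : ℝ => deriv f (t * z) / deriv f 0 - 1)
      (deriv (deriv f) (t * z) * z / deriv f 0) t := by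
    intro t ht
    have h1 : HasDerivAt (fun t : ℝ => (t : ℂ) * z) z t := by
      simpa using (HasDerivAt.ofReal_comp (hasDerivAt_id t)).mul_const z
    have h2 := ((hf.deriv isOpen_ball).differentiableAt
      (isOpen_ball.mem_nhds (hmd t ht))).hasDerivAt
    exact ((h2.comp t h1).div_const _).sub_const 1
  have hK : 160 * ‖z‖ ≠ 0 := mul_ne_zero (by norm_num) (norm_ne_zero_iff.2 hz0)
  have := norm_le_gronwallBound_of_norm_deriv_right_le (δ := 0) (K := 160 * ‖z‖)
    (ε := 160 * ‖z‖) (a := 0) (b := 1)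
    (fun t ht => (hder t ht).continuousAt.continuousWithinAt)
    (fun t ht => (hder t (Ico_subset_Icc_self ht)).hasDerivWithinAt) (by simp [div_self hc])
    (fun t ht => ?_) 1 (by simp)
  · rw [gronwallBound_of_K_ne_0 hK] at this
    simpa [div_self hK] using this
  · have h1 := norm_deriv_deriv_le_of_norm_le hf hi (hm t (Ico_subset_Icc_self ht))
    have h2 : ‖deriv f (t * z) / deriv f 0‖ ≤ ‖deriv f (t * z) / deriv f 0 - 1‖ + 1 := by
      have := norm_add_le (deriv f (t * z) / deriv f 0 - 1) 1
      simpa using this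
    calc ‖deriv (deriv f) (t * z) * z / deriv f 0‖
        = ‖deriv (deriv f) (t * z)‖ * ‖z‖ / ‖deriv f 0‖ := by rw [norm_div, norm_mul]
      _ ≤ 160 * ‖deriv f (t * z)‖ * ‖z‖ / ‖deriv f 0‖ := by gcongr
      _ = 160 * ‖z‖ * ‖deriv f (t * z) / deriv f 0‖ := by rw [norm_div]; ring
      _ ≤ 160 * ‖z‖ * (‖deriv f (t * z) / deriv f 0 - 1‖ + 1) := by gcongr
      _ = _ := by ring

/-- Mean value inequality for f / f'(0) - id. -/
theorem norm_sub_div_sub_one_le {f : ℂ → ℂ} (hf : DifferentiableOn ℂ f unitDisc)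
    (hi : InjOn f unitDisc) {z : ℂ} (hz : ‖z‖ ≤ 1 / 2) (hz0 : z ≠ 0) :
    ‖(f z - f 0) / (z * deriv f 0) - 1‖ ≤ Real.exp (160 * ‖z‖) - 1 := by
  have hc : deriv f 0 ≠ 0 := deriv_ne_zero_of_injOn isOpen_ball hf hi (mem_ball_self one_pos)
  have hd : ∀ w ∈ closedBall (0 : ℂ) ‖z‖,
      HasDerivAt (fun w => f w / deriv f 0 - w) (deriv f w / deriv f 0 - 1) w := by
    intro w hw
    have hw' : w ∈ unitDisc := by
      rw [mem_closedBall_zero_iff] at hw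
      simp only [unitDisc, mem_ball_zero_iff]; linarith
    exact ((hf.differentiableAt (isOpen_ball.mem_nhds hw')).hasDerivAt.div_const _).sub
      (hasDerivAt_id w)
  have h1 := Convex.norm_image_sub_le_of_norm_deriv_le (C := Real.exp (160 * ‖z‖) - 1)
    (fun w hw => (hd w hw).differentiableAt) (fun w hw => ?_) (convex_closedBall (0 : ℂ) ‖z‖)
    (mem_closedBall_self (norm_nonneg z)) (mem_closedBall_zero_iff.2 le_rfl)
  · have e : (f z - f 0) / (z * deriv f 0) - 1 =
        (f z / deriv f 0 - z - (f 0 / deriv f 0 - 0)) / z := by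
      field_simp; ring
    rw [e, norm_div, div_le_iff₀ (norm_pos_iff.2 hz0)]
    simpa using h1
  · rw [(hd w hw).deriv]
    rw [mem_closedBall_zero_iff] at hw
    refine (norm_deriv_div_sub_one_le hf hi (hw.trans hz)).trans ?_
    gcongr

end

section

open Metric Set Complex ComplexConjugate

/-! ### Spin sums -/

/-- The numerical value `±1` of a spin. -/
def spin (b : Bool) : ℝ := if b then 1 else -1

@[simp] theorem spin_true : spin true = 1 := rfl
@[simp] theorem spin_false : spin false = -1 := by simp [spin]
@[simp] theorem spin_not (b : Bool) : spin (!b) = -spin b := by cases b <;> simp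
variable {n : ℕ}

/-- The weight `∏_{k < m} r_{km} ^ {μ_k μ_m / 2}` of a spin configuration, written with
`L k m = log r_{km}`. -/
def spinWeight (L : Fin n → Fin n → ℝ) (μ : Fin n → Bool) : ℝ :=
  Real.exp (1 / 4 * ∑ k, ∑ m, spin (μ k) * spin (μ m) * L k m)

theorem spinWeight_pos (L : Fin n → Fin n → ℝ) (μ : Fin n → Bool) : 0 < spinWeight L μ :=
  Real.exp_pos _

/-- The partition function `∑_μ ∏_{k < m} r_{km} ^ {μ_k μ_m / 2}`. -/
def spinPartition (L : Fin n → Fin n → ℝ) : ℝ := ∑ μ, spinWeight L μ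

theorem spinPartition_pos (L : Fin n → Fin n → ℝ) : 0 < spinPartition L :=
  Finset.sum_pos (fun μ _ => spinWeight_pos L μ) Finset.univ_nonempty

/-- Flip the spins in `K`. -/
def flipOn (K : Finset (Fin n)) (μ : Fin n → Bool) : Fin n → Bool :=
  fun k => if k ∈ K then !μ k else μ k

theorem flipOn_involutive (K : Finset (Fin n)) : Function.Involutive (flipOn K) := by
  intro μ
  ext k
  by_cases h : k ∈ K <;> simp [flipOn, h]

theorem flipOn_apply_mem {K : Finset (Fin n)} {k : Fin n} (h : k ∈ K) (μ : Fin n → Bool) :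
    flipOn K μ k = !μ k := by simp [flipOn, h]

theorem flipOn_apply_notMem {K : Finset (Fin n)} {k : Fin n} (h : k ∉ K) (μ : Fin n → Bool) :
    flipOn K μ k = μ k := by simp [flipOn, h]

/-- Only pairs with one index in K and one outside change sign. Each occurs twice in the double sum,
so the factor 1/4 becomes 1/2, and the change of sign makes it -1. -/
theorem spinWeight_flipOn {L : Fin n → Fin n → ℝ} (hL : ∀ k m, L k m = L m k)
    (K : Finset (Fin n)) (μ : Fin n → Bool) :
    spinWeight L (flipOn K μ) =
      spinWeight L μ * ∏ k ∈ K, Real.exp (-(spin (μ k) * ∑ m ∈ Kᶜ, spin (μ m) * L k m)) := by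
  rw [spinWeight, spinWeight, ← Real.exp_sum, ← Real.exp_add]
  congr 1
  have split : ∀ ν : Fin n → Bool, ∑ k, ∑ m, spin (ν k) * spin (ν m) * L k m =
      ((∑ k ∈ K, ∑ m ∈ K, spin (ν k) * spin (ν m) * L k m) +
        (∑ k ∈ Kᶜ, ∑ m ∈ Kᶜ, spin (ν k) * spin (ν m) * L k m)) +
        2 * ∑ k ∈ K, spin (ν k) * ∑ m ∈ Kᶜ, spin (ν m) * L k m := by
    intro ν
    rw [← Finset.sum_add_sum_compl K]
    simp_rw [← Finset.sum_add_sum_compl K (fun m => spin (ν _) * spin (ν m) * L _ m)]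
    rw [Finset.sum_add_distrib, Finset.sum_add_distrib]
    have h1 : ∑ k ∈ Kᶜ, ∑ m ∈ K, spin (ν k) * spin (ν m) * L k m =
        ∑ k ∈ K, ∑ m ∈ Kᶜ, spin (ν k) * spin (ν m) * L k m := by
      rw [Finset.sum_comm]
      refine Finset.sum_congr rfl fun k _ => Finset.sum_congr rfl fun m _ => ?_
      rw [hL]; ring
    have h2 : ∑ k ∈ K, spin (ν k) * ∑ m ∈ Kᶜ, spin (ν m) * L k m =
        ∑ k ∈ K, ∑ m ∈ Kᶜ, spin (ν k) * spin (ν m) * L k m := by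
      refine Finset.sum_congr rfl fun k _ => ?_
      rw [Finset.mul_sum]
      exact Finset.sum_congr rfl fun m _ => by ring
    rw [h1, h2]; ring
  have e1 : ∑ k ∈ K, ∑ m ∈ K, spin (flipOn K μ k) * spin (flipOn K μ m) * L k m =
      ∑ k ∈ K, ∑ m ∈ K, spin (μ k) * spin (μ m) * L k m :=
    Finset.sum_congr rfl fun k hk => Finset.sum_congr rfl fun m hm => by
      rw [flipOn_apply_mem hk, flipOn_apply_mem hm, spin_not, spin_not]; ring
  have e2 : ∑ k ∈ Kᶜ, ∑ m ∈ Kᶜ, spin (flipOn K μ k) * spin (flipOn K μ m) * L k m =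
      ∑ k ∈ Kᶜ, ∑ m ∈ Kᶜ, spin (μ k) * spin (μ m) * L k m :=
    Finset.sum_congr rfl fun k hk => Finset.sum_congr rfl fun m hm => by
      rw [flipOn_apply_notMem (Finset.mem_compl.1 hk), flipOn_apply_notMem (Finset.mem_compl.1 hm)]
  have e3 : ∑ k ∈ K, spin (flipOn K μ k) * ∑ m ∈ Kᶜ, spin (flipOn K μ m) * L k m =
      -∑ k ∈ K, spin (μ k) * ∑ m ∈ Kᶜ, spin (μ m) * L k m := by
    rw [← Finset.sum_neg_distrib]
    refine Finset.sum_congr rfl fun k hk => ?_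
    rw [flipOn_apply_mem hk, spin_not, neg_mul]
    congr 2
    exact Finset.sum_congr rfl fun m hm => by rw [flipOn_apply_notMem (Finset.mem_compl.1 hm)]
  rw [split, split μ, e1, e2, e3, Finset.sum_neg_distrib]
  ring

/-- A spin sum is sent to its complex conjugate by the flip of the spins of `K`. -/
theorem conj_spinSum {K : Finset (Fin n)} {W : (Fin n → Bool) → ℝ} {t : Fin n → ℝ}
    {v p q : Fin n → ℂ}
    (hW : ∀ μ, W (flipOn K μ) = W μ * ∏ k ∈ K, (if μ k then t k else (t k)⁻¹))
    (hp : ∀ k ∈ K, conj (p k) = t k * v k * q k) (hq : ∀ k ∈ K, conj (q k) = (t k)⁻¹ * v k * p k) :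
    conj (∑ μ, (W μ : ℂ) * ∏ k ∈ K, (if μ k then p k else q k)) =
      (∏ k ∈ K, v k) * ∑ μ, (W μ : ℂ) * ∏ k ∈ K, (if μ k then p k else q k) := by
  rw [map_sum, Finset.mul_sum]
  -- Conjugation exchanges the two factors at each k in K at the cost of t_k or its inverse, exactly
  -- what the flip does to the weight.
  refine Fintype.sum_equiv (flipOn_involutive K).toPerm _ _ fun μ => ?_
  rw [Function.Involutive.coe_toPerm, hW, map_mul, conj_ofReal, map_prod]
  rw [ofReal_mul, ofReal_prod, ← mul_assoc, mul_left_comm, mul_assoc]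
  congr 1
  rw [← Finset.prod_mul_distrib, ← Finset.prod_mul_distrib]
  refine Finset.prod_congr rfl fun k hk => ?_
  rw [flipOn_apply_mem hk]
  cases h : μ k
  · simp only [Bool.false_eq_true, if_false, Bool.not_false, if_true, hq k hk]; ring
  · simp only [Bool.false_eq_true, if_false, Bool.not_true, if_true, hp k hk]; ring

/-- The sum of the weights of the configurations with a fixed spin. -/
def halfPartition (L : Fin n → Fin n → ℝ) (j : Fin n) : ℝ :=
  ∑ μ, if μ j then spinWeight L μ else 0

theorem halfPartition_pos (L : Fin n → Fin n → ℝ) (j : Fin n) : 0 < halfPartition L j := by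
  refine Finset.sum_pos' (fun μ _ => ?_) ⟨fun _ => true, Finset.mem_univ _, ?_⟩
  · split_ifs
    · exact (spinWeight_pos L μ).le
    · exact le_rfl
  · simpa using spinWeight_pos L _

/-- The correlation of two spins. -/
def spinCorr (L : Fin n → Fin n → ℝ) (j k : Fin n) : ℝ :=
  (∑ μ, spinWeight L μ * (spin (μ j) * spin (μ k))) / spinPartition L

/-- The global flip preserves the weights and exchanges μ_j = + with μ_j = -. -/
theorem sum_spinWeight_eq_two_mul {L : Fin n → Fin n → ℝ} (hL : ∀ k m, L k m = L m k) (j : Fin n)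
    {g : (Fin n → Bool) → ℝ} (hg : ∀ μ, g (flipOn Finset.univ μ) = g μ) :
    ∑ μ, spinWeight L μ * g μ = 2 * ∑ μ, if μ j then spinWeight L μ * g μ else 0 := by
  have h1 : ∑ μ, (if μ j then spinWeight L μ * g μ else 0) =
      ∑ μ, (if μ j then 0 else spinWeight L μ * g μ) := by
    refine Fintype.sum_equiv (flipOn_involutive Finset.univ).toPerm _ _ fun μ => ?_
    rw [Function.Involutive.coe_toPerm, hg, spinWeight_flipOn hL,
      flipOn_apply_mem (Finset.mem_univ _)]
    cases h : μ j <;> simp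
  rw [two_mul]
  nth_rewrite 2 [h1]
  rw [← Finset.sum_add_distrib]
  refine Finset.sum_congr rfl fun μ _ => ?_
  split_ifs <;> simp

theorem spinPartition_eq_two_mul {L : Fin n → Fin n → ℝ} (hL : ∀ k m, L k m = L m k) (j : Fin n) :
    spinPartition L = 2 * halfPartition L j := by
  simpa [spinPartition, halfPartition] using
    sum_spinWeight_eq_two_mul hL j (g := fun _ => 1) (fun _ => rfl)

theorem spinCorr_eq {L : Fin n → Fin n → ℝ} (hL : ∀ k m, L k m = L m k) (j k : Fin n) :
    spinCorr L j k = (∑ μ, if μ j then spinWeight L μ * spin (μ k) else 0) / halfPartition L j := by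
  rw [spinCorr, spinPartition_eq_two_mul hL j,
    sum_spinWeight_eq_two_mul hL j (g := fun μ => spin (μ j) * spin (μ k)),
    mul_div_mul_left _ _ two_ne_zero]
  · congr 1
    refine Finset.sum_congr rfl fun μ _ => ?_
    cases h : μ j <;> simp
  · intro μ
    simp [flipOn]

end

section

open Metric Set Complex ComplexConjugate

variable {n : ℕ}

/-! ### The explicit solution in the unit disc -/

/-- The logarithms of the pseudo-hyperbolic distances between the points. -/
def logHyp (a : Fin n → ℂ) (k m : Fin n) : ℝ := Real.log (pseudoHyp (a k) (a m))

theorem logHyp_comm (a : Fin n → ℂ) (k m : Fin n) : logHyp a k m = logHyp a m k := by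
  rw [logHyp, logHyp, pseudoHyp_comm]

/-- Square roots of the values at the source of the Blaschke factors. -/
def blaschkeRoot (a : Fin n → ℂ) (j k : Fin n) : ℂ := discAut (a k) (a j) ^ (1 / 2 : ℂ)

theorem cpow_half_sq (z : ℂ) : (z ^ (1 / 2 : ℂ)) ^ 2 = z := by
  rw [one_div]; exact_mod_cast cpow_nat_inv_pow z two_ne_zero

theorem blaschkeRoot_sq (a : Fin n → ℂ) (j k : Fin n) :
    blaschkeRoot a j k ^ 2 = discAut (a k) (a j) := cpow_half_sq _

/-- The factors of the terms of the spin sum of the explicit solution. -/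
def discFactor (a : Fin n → ℂ) (j k : Fin n) (b : Bool) (z : ℂ) : ℂ :=
  if b then (z - a k) / blaschkeRoot a j k else (1 - conj (a k) * z) * blaschkeRoot a j k

/-- Fixing the spin at the source leaves the coupling to it as an external field on the other spins;
flipping these produces the factors r_jk needed to conjugate the square roots of the Blaschke
factors. -/
def discSum (a : Fin n → ℂ) (j : Fin n) (z : ℂ) : ℂ :=
  ∑ μ : Fin n → Bool, ((if μ j then spinWeight (logHyp a) μ else 0 : ℝ) : ℂ) *
    ∏ k ∈ Finset.univ.erase j, discFactor a j k (μ k) z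

/-- A square root of `∏ (1 - conj a_k z)`. -/
def discRoot (a : Fin n → ℂ) (z : ℂ) : ℂ := ∏ k, (1 - conj (a k) * z) ^ (1 / 2 : ℂ)

/-- Chosen to make the limit at the source ±1; the square root compensates the factor k = j of
`discRoot`. -/
def discConst (a : Fin n → ℂ) (j : Fin n) : ℝ :=
  Real.sqrt (1 - ‖a j‖ ^ 2) / halfPartition (logHyp a) j

/-- The product of the explicit solution with `√∏ (z - a_k)`. -/
def discMain (a : Fin n → ℂ) (j : Fin n) (z : ℂ) : ℂ :=
  discConst a j * discSum a j z / discRoot a z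

theorem discRoot_sq (a : Fin n → ℂ) (z : ℂ) :
    discRoot a z ^ 2 = ∏ k, (1 - conj (a k) * z) := by
  rw [discRoot, ← Finset.prod_pow]
  exact Finset.prod_congr rfl fun k _ => cpow_half_sq _

theorem one_sub_conj_mul_mem_slitPlane {c z : ℂ} (hc : ‖c‖ < 1) (hz : ‖z‖ ≤ 1) :
    1 - conj c * z ∈ slitPlane := by
  left
  have h1 : (conj c * z).re < 1 := by
    refine (re_le_norm _).trans_lt ?_
    rw [norm_mul, norm_conj]
    nlinarith [norm_nonneg c, norm_nonneg z]
  simpa using h1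

theorem discRoot_ne_zero {a : Fin n → ℂ} (ha : ∀ k, ‖a k‖ < 1) {z : ℂ} (hz : ‖z‖ ≤ 1) :
    discRoot a z ≠ 0 := by
  have h1 : discRoot a z ^ 2 ≠ 0 := by
    rw [discRoot_sq]
    exact Finset.prod_ne_zero_iff.2 fun k _ => one_sub_conj_mul_ne_zero (ha k) hz
  intro h
  simp [h] at h1

theorem differentiable_discFactor (a : Fin n → ℂ) (j k : Fin n) (b : Bool) :
    Differentiable ℂ (discFactor a j k b) := by
  unfold discFactor
  cases b
  · simp only [Bool.false_eq_true, if_false]; fun_prop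
  · simp only [if_true]; fun_prop

theorem differentiable_discSum (a : Fin n → ℂ) (j : Fin n) : Differentiable ℂ (discSum a j) := by
  unfold discSum
  refine Differentiable.fun_sum fun μ _ => Differentiable.const_mul ?_ _
  exact Differentiable.fun_finsetProd fun k _ => differentiable_discFactor a j k _

theorem differentiableAt_discRoot {a : Fin n → ℂ} (ha : ∀ k, ‖a k‖ < 1) {z : ℂ} (hz : ‖z‖ ≤ 1) :
    DifferentiableAt ℂ (discRoot a) z := by
  unfold discRoot
  refine DifferentiableAt.fun_finsetProd fun k _ => ?_
  exact DifferentiableAt.cpow (by fun_prop) (by fun_prop) (one_sub_conj_mul_mem_slitPlane (ha k) hz)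

theorem differentiableAt_discMain {a : Fin n → ℂ} (ha : ∀ k, ‖a k‖ < 1) (j : Fin n) {z : ℂ}
    (hz : ‖z‖ ≤ 1) : DifferentiableAt ℂ (discMain a j) z :=
  (((differentiable_discSum a j) z).const_mul _).div (differentiableAt_discRoot ha hz)
    (discRoot_ne_zero ha hz)

theorem discMain_sq (a : Fin n → ℂ) (j : Fin n) (z : ℂ) :
    discMain a j z ^ 2 =
      discConst a j ^ 2 * discSum a j z ^ 2 / ∏ k, (1 - conj (a k) * z) := by
  rw [discMain, div_pow, discRoot_sq, mul_pow]

theorem discAut_ne_zero_of_ne {a : Fin n → ℂ} (ha : ∀ k, ‖a k‖ < 1)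
    (hinj : Function.Injective a) {k m : Fin n} (h : k ≠ m) : discAut (a k) (a m) ≠ 0 :=
  div_ne_zero (sub_ne_zero.2 (hinj.ne h.symm)) (one_sub_conj_mul_ne_zero (ha k) (ha m).le)

theorem blaschkeRoot_ne_zero {a : Fin n → ℂ} (ha : ∀ k, ‖a k‖ < 1)
    (hinj : Function.Injective a) {j k : Fin n} (h : k ≠ j) : blaschkeRoot a j k ≠ 0 := by
  intro h0
  have := blaschkeRoot_sq a j k
  rw [h0] at this
  exact discAut_ne_zero_of_ne ha hinj h (by rw [← this]; simp)

theorem pseudoHyp_pos {a : Fin n → ℂ} (ha : ∀ k, ‖a k‖ < 1)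
    (hinj : Function.Injective a) {k m : Fin n} (h : k ≠ m) : 0 < pseudoHyp (a k) (a m) :=
  norm_pos_iff.2 (discAut_ne_zero_of_ne ha hinj h.symm)

theorem conj_blaschkeRoot_mul (a : Fin n → ℂ) (j k : Fin n) :
    conj (blaschkeRoot a j k) * blaschkeRoot a j k = (pseudoHyp (a j) (a k) : ℝ) := by
  rw [mul_comm, mul_conj, normSq_eq_norm_sq, ← norm_pow, blaschkeRoot_sq, pseudoHyp]

theorem conj_blaschkeRoot {a : Fin n → ℂ} (ha : ∀ k, ‖a k‖ < 1)
    (hinj : Function.Injective a) {j k : Fin n} (h : k ≠ j) :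
    conj (blaschkeRoot a j k) = (pseudoHyp (a j) (a k) : ℝ) / blaschkeRoot a j k := by
  rw [eq_div_iff (blaschkeRoot_ne_zero ha hinj h), conj_blaschkeRoot_mul]

/-- On the unit circle the square of the solution times the normal is nonnegative. -/
theorem discMain_sq_mul_of_norm_eq_one {a : Fin n → ℂ} (ha : ∀ k, ‖a k‖ < 1)
    (hinj : Function.Injective a) (j : Fin n) {z : ℂ} (hz : ‖z‖ = 1) :
    ∃ x : ℝ, 0 ≤ x ∧ discMain a j z ^ 2 * z = x * coverPoly a z := by
  have hzz : z * conj z = 1 := by rw [mul_conj, normSq_eq_norm_sq, hz]; simp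
  have hz0 : conj z ≠ 0 := right_ne_zero_of_mul_eq_one hzz
  have hcf : ∀ k, (1 - conj (a k) * z) * conj z = conj (z - a k) := by
    intro k
    rw [sub_mul, mul_assoc, hzz, map_sub]; ring
  -- On the circle conj(z - a_k) = conj z (1 - conj a_k z), so conjugation exchanges the two kinds
  -- of factors. The flip of all spins but μ_j applies with t_k = 1 / r_jk.
  have hconj : conj (discSum a j z) =
      (∏ k ∈ Finset.univ.erase j, conj z) * discSum a j z := by
    unfold discSum discFactor
    refine conj_spinSum (t := fun k => (pseudoHyp (a j) (a k))⁻¹) ?_ ?_ ?_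
    · intro μ
      have hj : flipOn (Finset.univ.erase j) μ j = μ j := flipOn_apply_notMem (by simp) μ
      rw [hj]
      split_ifs with h
      · rw [spinWeight_flipOn (logHyp_comm a)]
        congr 1
        refine Finset.prod_congr rfl fun k hk => ?_
        have hkj : k ≠ j := Finset.ne_of_mem_erase hk
        have hc : (Finset.univ.erase j)ᶜ = {j} := by ext; simp
        have hr := pseudoHyp_pos ha hinj hkj.symm
        rw [hc, Finset.sum_singleton, h, logHyp_comm, logHyp, spin_true, one_mul]
        cases μ k
        · simp [Real.exp_log hr]
        · simp [Real.exp_neg, Real.exp_log hr]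
      · simp
    · intro k hk
      have hkj : k ≠ j := Finset.ne_of_mem_erase hk
      have hr : ((pseudoHyp (a j) (a k) : ℝ) : ℂ) ≠ 0 :=
        ofReal_ne_zero.2 (pseudoHyp_pos ha hinj hkj.symm).ne'
      have hb := blaschkeRoot_ne_zero ha hinj hkj
      rw [map_div₀, conj_blaschkeRoot ha hinj hkj, ← hcf, ofReal_inv]
      field_simp
    · intro k hk
      have hkj : k ≠ j := Finset.ne_of_mem_erase hk
      have hb := blaschkeRoot_ne_zero ha hinj hkj
      rw [map_mul, conj_blaschkeRoot ha hinj hkj]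
      simp only [inv_inv]
      have : conj (1 - conj (a k) * z) = conj z * (z - a k) := by
        rw [mul_sub, mul_comm (conj z) z, hzz]; simp; ring
      rw [this]
      field_simp
  have hcov : coverPoly a z ≠ 0 := by
    refine Finset.prod_ne_zero_iff.2 fun k _ => sub_ne_zero.2 ?_
    rintro rfl
    exact (ha k).ne hz
  have hden : (∏ k, (1 - conj (a k) * z)) * ∏ _k : Fin n, conj z = conj (coverPoly a z) := by
    rw [← Finset.prod_mul_distrib, coverPoly, map_prod]
    exact Finset.prod_congr rfl fun k _ => hcf k
  have hprod : ∏ _k : Fin n, conj z = conj z * ∏ k ∈ Finset.univ.erase j, conj z :=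
    (Finset.mul_prod_erase Finset.univ (fun _ => conj z) (Finset.mem_univ j)).symm
  have hd0 : ∏ k, (1 - conj (a k) * z) ≠ 0 :=
    Finset.prod_ne_zero_iff.2 fun k _ => one_sub_conj_mul_ne_zero (ha k) hz.le
  refine ⟨discConst a j ^ 2 * ‖discSum a j z‖ ^ 2 / ‖coverPoly a z‖ ^ 2, by positivity, ?_⟩
  have hN : ((‖discSum a j z‖ ^ 2 : ℝ) : ℂ) = discSum a j z * conj (discSum a j z) := by
    rw [mul_conj, normSq_eq_norm_sq]
  have hC : ((‖coverPoly a z‖ ^ 2 : ℝ) : ℂ) = coverPoly a z * conj (coverPoly a z) := by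
    rw [mul_conj, normSq_eq_norm_sq]
  have hp0 : (∏ k ∈ Finset.univ.erase j, conj z) ≠ 0 := Finset.prod_ne_zero_iff.2 fun _ _ => hz0
  rw [discMain_sq, ofReal_div, ofReal_mul, hN, hC, hconj, ← hden, hprod]
  push_cast
  generalize ∏ k ∈ Finset.univ.erase j, conj z = p at *
  generalize ∏ k, (1 - conj (a k) * z) = q at *
  field_simp
  linear_combination (discConst a j : ℂ) ^ 2 * discSum a j z ^ 2 * hzz

/-- The root is that of the Blaschke factor at the source itself, so the two choices of spin
coincide there and the spin sum factorizes. -/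
theorem discFactor_source {a : Fin n → ℂ} (ha : ∀ k, ‖a k‖ < 1) (hinj : Function.Injective a)
    {j k : Fin n} (hk : k ≠ j) (b : Bool) :
    discFactor a j k b (a j) = (1 - conj (a k) * a j) * blaschkeRoot a j k := by
  unfold discFactor
  split_ifs
  · rw [div_eq_iff (blaschkeRoot_ne_zero ha hinj hk), mul_assoc, ← sq, blaschkeRoot_sq, discAut,
      mul_div_cancel₀]
    exact one_sub_conj_mul_ne_zero (ha k) (ha j).le
  · rfl

theorem discSum_source {a : Fin n → ℂ} (ha : ∀ k, ‖a k‖ < 1) (hinj : Function.Injective a)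
    (j : Fin n) : discSum a j (a j) = halfPartition (logHyp a) j *
      ∏ k ∈ Finset.univ.erase j, (1 - conj (a k) * a j) * blaschkeRoot a j k := by
  rw [discSum, halfPartition, ofReal_sum, Finset.sum_mul]
  refine Finset.sum_congr rfl fun μ _ => ?_
  congr 1
  exact Finset.prod_congr rfl fun k hk => discFactor_source ha hinj (Finset.ne_of_mem_erase hk) _

/-- The square of the solution at the source. -/
theorem discMain_sq_source {a : Fin n → ℂ} (ha : ∀ k, ‖a k‖ < 1) (hinj : Function.Injective a)
    (j : Fin n) :
    discMain a j (a j) ^ 2 = ∏ k ∈ Finset.univ.erase j, (a j - a k) := by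
  have h1 : (∏ k ∈ Finset.univ.erase j, (1 - conj (a k) * a j) * blaschkeRoot a j k) ^ 2 =
      (∏ k ∈ Finset.univ.erase j, (1 - conj (a k) * a j)) *
        ∏ k ∈ Finset.univ.erase j, (a j - a k) := by
    rw [← Finset.prod_pow, ← Finset.prod_mul_distrib]
    refine Finset.prod_congr rfl fun k _ => ?_
    rw [mul_pow, blaschkeRoot_sq, discAut]
    have := one_sub_conj_mul_ne_zero (ha k) (ha j).le
    field_simp
  have h2 : ∏ k, (1 - conj (a k) * a j) =
      (1 - conj (a j) * a j) * ∏ k ∈ Finset.univ.erase j, (1 - conj (a k) * a j) :=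
    (Finset.mul_prod_erase Finset.univ _ (Finset.mem_univ j)).symm
  have h3 : (∏ k ∈ Finset.univ.erase j, (1 - conj (a k) * a j)) ≠ 0 :=
    Finset.prod_ne_zero_iff.2 fun k _ => one_sub_conj_mul_ne_zero (ha k) (ha j).le
  have h4 : (1 - conj (a j) * a j) ≠ 0 := one_sub_conj_mul_ne_zero (ha j) (ha j).le
  have h5 : (halfPartition (logHyp a) j : ℂ) ≠ 0 := ofReal_ne_zero.2 (halfPartition_pos _ _).ne'
  have h6 : (discConst a j : ℂ) ^ 2 * (halfPartition (logHyp a) j : ℂ) ^ 2 =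
      1 - conj (a j) * a j := by
    have h7 : 0 ≤ 1 - ‖a j‖ ^ 2 := by nlinarith [ha j, norm_nonneg (a j)]
    rw [discConst, ofReal_div, div_pow, div_mul_cancel₀ _ (pow_ne_zero 2 h5), ← ofReal_pow,
      Real.sq_sqrt h7, mul_comm, mul_conj, normSq_eq_norm_sq]
    push_cast; rfl
  rw [discMain_sq, discSum_source ha hinj, mul_pow, h1, h2, ← mul_assoc, h6,
    mul_div_mul_left _ _ h4, mul_div_cancel_left₀ _ h3]

/-- The square of the solution at the other branching points. -/
theorem discMain_sq_other {a : Fin n → ℂ} (ha : ∀ k, ‖a k‖ < 1) (hinj : Function.Injective a)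
    {i j : Fin n} (hij : i ≠ j) :
    ∃ x : ℝ, 0 ≤ x ∧ discMain a j (a i) ^ 2 = -x * ∏ k ∈ Finset.univ.erase i, (a i - a k) := by
  set K : Finset (Fin n) := (Finset.univ.erase j).erase i with hK
  have hKi : ∀ {k}, k ∈ K → k ≠ i := fun hk => Finset.ne_of_mem_erase hk
  have hKj : ∀ {k}, k ∈ K → k ≠ j := fun hk =>
    Finset.ne_of_mem_erase (Finset.mem_of_mem_erase hk)
  -- Terms with μ_i = + contain the factor z - a_i and vanish at a_i. Those left have μ_j = + and
  -- μ_i = -.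
  set W : (Fin n → Bool) → ℝ := fun μ =>
    if μ j then (if μ i then 0 else spinWeight (logHyp a) μ) else 0 with hW
  set p : Fin n → ℂ := fun k => (a i - a k) / blaschkeRoot a j k with hp
  set q : Fin n → ℂ := fun k => (1 - conj (a k) * a i) * blaschkeRoot a j k with hq
  set Y : ℂ := ∑ μ, (W μ : ℂ) * ∏ k ∈ K, (if μ k then p k else q k) with hY
  set r : Fin n → Fin n → ℝ := fun k m => pseudoHyp (a k) (a m) with hr
  have hr0 : ∀ {k m}, k ≠ m → 0 < r k m := fun h => pseudoHyp_pos ha hinj h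
  have hD : ∀ k m, 1 - conj (a k) * a m ≠ 0 := fun k m => one_sub_conj_mul_ne_zero (ha k) (ha m).le
  have hDc : ∀ k m, conj (1 - conj (a k) * a m) ≠ 0 := fun k m => (map_ne_zero _).2 (hD k m)
  have hS : discSum a j (a i) = (1 - conj (a i) * a i) * blaschkeRoot a j i * Y := by
    rw [discSum, hY, Finset.mul_sum]
    refine Finset.sum_congr rfl fun μ _ => ?_
    have h1 : i ∈ Finset.univ.erase j := Finset.mem_erase.2 ⟨hij, Finset.mem_univ i⟩
    rw [← Finset.mul_prod_erase _ _ h1]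
    simp only [hW, hp, hq, discFactor, ← hK]
    cases μ i
    · simp only [Bool.false_eq_true, if_false]
      ring
    · simp
  -- The flip of the spins other than μ_i, μ_j; as these two are opposite, the weight changes by
  -- quotients r_ik / r_jk.
  have hconj : conj Y = (∏ k ∈ K, conj (1 - conj (a k) * a i) * r i k / (a i - a k)) * Y := by
    refine conj_spinSum (t := fun k => r i k / r j k) ?_ ?_ ?_
    · intro μ
      have hj : flipOn K μ j = μ j := flipOn_apply_notMem (by simp [hK]) μ
      have hi : flipOn K μ i = μ i := flipOn_apply_notMem (by simp [hK]) μ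
      simp only [hW, hi, hj]
      cases h1 : μ j <;> cases h2 : μ i <;> simp
      rw [spinWeight_flipOn (logHyp_comm a)]
      congr 1
      refine Finset.prod_congr rfl fun k hk => ?_
      have hc : Kᶜ = {i, j} := by
        ext k
        simp only [hK, Finset.mem_compl, Finset.mem_erase, Finset.mem_univ, and_true,
          Finset.mem_insert, Finset.mem_singleton]
        tauto
      rw [hc, Finset.sum_pair hij, h1, h2, logHyp_comm, logHyp_comm a k j, logHyp, logHyp,
        spin_true, spin_false]
      have e1 := hr0 (hKi hk).symm
      have e2 := hr0 (hKj hk).symm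
      simp only [hr] at e1 e2 ⊢
      cases μ k
      · simp [Real.exp_add, Real.exp_neg, Real.exp_log e1, Real.exp_log e2, div_eq_mul_inv,
          mul_comm]
      · simp [Real.exp_add, Real.exp_neg, Real.exp_log e1, Real.exp_log e2, div_eq_mul_inv,
          mul_comm]
    · intro k hk
      have e2 : ((r j k : ℝ) : ℂ) ≠ 0 := ofReal_ne_zero.2 (hr0 (hKj hk).symm).ne'
      have hb := blaschkeRoot_ne_zero ha hinj (hKj hk)
      have hs : a i - a k ≠ 0 := sub_ne_zero.2 (hinj.ne (hKi hk).symm)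
      have e3 : ((r i k : ℝ) : ℂ) ^ 2 * ((1 - conj (a k) * a i) * conj (1 - conj (a k) * a i)) =
          (a i - a k) * conj (a i - a k) := by
        rw [mul_conj, mul_conj, normSq_eq_norm_sq, normSq_eq_norm_sq]
        simp only [hr, pseudoHyp, discAut, norm_div]
        rw [← ofReal_pow, ← ofReal_mul, div_pow, div_mul_cancel₀]
        exact pow_ne_zero 2 (norm_ne_zero_iff.2 (hD k i))
      simp only [hp, hq]
      rw [map_div₀, conj_blaschkeRoot ha hinj (hKj hk), ofReal_div]
      change conj (a i - a k) / ((r j k : ℝ) / _) = _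
      have hd := hD k i
      generalize 1 - conj (a k) * a i = d at *
      generalize conj d = d' at *
      generalize conj (a i - a k) = c at *
      field_simp
      linear_combination -e3
    · intro k hk
      have e1 : ((r i k : ℝ) : ℂ) ≠ 0 := ofReal_ne_zero.2 (hr0 (hKi hk).symm).ne'
      have hb := blaschkeRoot_ne_zero ha hinj (hKj hk)
      have hs : a i - a k ≠ 0 := sub_ne_zero.2 (hinj.ne (hKi hk).symm)
      simp only [hp, hq, inv_div]
      rw [map_mul, conj_blaschkeRoot ha hinj (hKj hk), ofReal_div]
      change _ * (((r j k : ℝ) : ℂ) / _) = _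
      field_simp
  have hY2 : Y ^ 2 * ∏ k ∈ K, conj (1 - conj (a k) * a i) * (r i k : ℂ) =
      ((‖Y‖ ^ 2 : ℝ) : ℂ) * ∏ k ∈ K, (a i - a k) := by
    have h1 : ((‖Y‖ ^ 2 : ℝ) : ℂ) = Y * conj Y := by rw [mul_conj, normSq_eq_norm_sq]
    have h2 : ∏ k ∈ K, (a i - a k) ≠ 0 :=
      Finset.prod_ne_zero_iff.2 fun k hk => sub_ne_zero.2 (hinj.ne (hKi hk).symm)
    rw [h1, hconj, Finset.prod_div_distrib]
    generalize ∏ k ∈ K, conj (1 - conj (a k) * a i) * (r i k : ℂ) = X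
    field_simp
  have hprodD : ∏ k, (1 - conj (a k) * a i) =
      (1 - conj (a i) * a i) * (1 - conj (a j) * a i) * ∏ k ∈ K, (1 - conj (a k) * a i) := by
    rw [← Finset.mul_prod_erase Finset.univ _ (Finset.mem_univ j),
      ← Finset.mul_prod_erase (Finset.univ.erase j) _
        (Finset.mem_erase.2 ⟨hij, Finset.mem_univ i⟩)]
    ring
  have hprodA : ∏ k ∈ Finset.univ.erase i, (a i - a k) =
      (a i - a j) * ∏ k ∈ K, (a i - a k) := by
    rw [hK, Finset.erase_right_comm]
    exact (Finset.mul_prod_erase _ (fun k => a i - a k)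
      (Finset.mem_erase.2 ⟨hij.symm, Finset.mem_univ j⟩)).symm
  -- The minus sign in the claim comes from the squared root, which contains a_j - a_i, against a_i
  -- - a_j in the product.
  refine ⟨discConst a j ^ 2 * (1 - ‖a i‖ ^ 2) * ‖Y‖ ^ 2 /
    (‖1 - conj (a j) * a i‖ ^ 2 * ∏ k ∈ K, (‖1 - conj (a k) * a i‖ ^ 2 * r i k)), ?_, ?_⟩
  · have : 0 ≤ 1 - ‖a i‖ ^ 2 := by nlinarith [ha i, norm_nonneg (a i)]
    have h2 : 0 ≤ ∏ k ∈ K, (‖1 - conj (a k) * a i‖ ^ 2 * r i k) :=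
      Finset.prod_nonneg fun k _ => mul_nonneg (sq_nonneg _) (norm_nonneg _)
    positivity
  · have hn : ∀ c : ℂ, ((‖c‖ ^ 2 : ℝ) : ℂ) = c * conj c := fun c => by
      rw [mul_conj, normSq_eq_norm_sq]
    have hq2 : ((∏ k ∈ K, (‖1 - conj (a k) * a i‖ ^ 2 * r i k) : ℝ) : ℂ) =
        (∏ k ∈ K, (1 - conj (a k) * a i)) *
          ∏ k ∈ K, conj (1 - conj (a k) * a i) * (r i k : ℂ) := by
      rw [ofReal_prod, ← Finset.prod_mul_distrib]
      refine Finset.prod_congr rfl fun k _ => ?_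
      rw [ofReal_mul, hn]; ring
    have hb2 := blaschkeRoot_sq a j i
    have h1 : ∏ k ∈ K, (1 - conj (a k) * a i) ≠ 0 := Finset.prod_ne_zero_iff.2 fun k _ => hD k i
    have h2 : ∏ k ∈ K, conj (1 - conj (a k) * a i) * (r i k : ℂ) ≠ 0 :=
      Finset.prod_ne_zero_iff.2 fun k hk => mul_ne_zero (hDc k i)
        (ofReal_ne_zero.2 (hr0 (hKi hk).symm).ne')
    have h3 : ((1 - ‖a i‖ ^ 2 : ℝ) : ℂ) = 1 - conj (a i) * a i := by
      rw [ofReal_sub, hn, mul_comm]; simp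
    have h4 : conj (1 - conj (a j) * a i) = 1 - conj (a i) * a j := by simp [mul_comm]
    rw [discMain_sq, hS, hprodD, hprodA, ofReal_div, ofReal_mul, ofReal_mul, ofReal_mul, h3, hq2,
      hn (1 - conj (a j) * a i), h4, ofReal_pow (discConst a j), mul_pow, mul_pow, hb2, discAut]
    have h5 := hD i j
    have h6 := hD i i
    have h7 := hD j i
    generalize ∏ k ∈ K, conj (1 - conj (a k) * a i) * (r i k : ℂ) = X at *
    generalize ∏ k ∈ K, (1 - conj (a k) * a i) = V at *
    generalize ((‖Y‖ ^ 2 : ℝ) : ℂ) = y at *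
    generalize ∏ k ∈ K, (a i - a k) = P at *
    have h8 : Y ^ 2 = y * P / X := by rw [eq_div_iff h2, hY2]
    rw [h8]
    generalize 1 - conj (a i) * a j = d1 at *
    generalize 1 - conj (a i) * a i = d2 at *
    generalize 1 - conj (a j) * a i = d3 at *
    field_simp
    ring

end

section

open Metric Set Complex ComplexConjugate

variable {n : ℕ}

/-! ### Local sheets of the double cover -/

theorem exists_analyticAt_sq_eq {g : ℂ → ℂ} {z : ℂ} (hg : AnalyticAt ℂ g z) (h0 : g z ≠ 0) :
    ∃ v : ℂ → ℂ, AnalyticAt ℂ v z ∧ ∀ᶠ t in 𝓝 z, v t ^ 2 = g t := by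
  obtain ⟨r, hr, hb⟩ := Metric.eventually_nhds_iff_ball.1
    (hg.eventually_analyticAt.and (hg.continuousAt.eventually_ne h0))
  obtain ⟨v, hv, hsq⟩ := exists_differentiableOn_sq_eq isOpen_ball (isSimplyConnected_ball z hr)
    (fun t ht => (hb t ht).1.differentiableAt.differentiableWithinAt) (fun t ht => (hb t ht).2)
  exact ⟨v, hv.analyticAt (ball_mem_nhds z hr), Metric.eventually_nhds_iff_ball.2 ⟨r, hr, hsq⟩⟩

theorem coverPoly_eq_mul_prod_erase (a : Fin n → ℂ) (i : Fin n) (z : ℂ) :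
    coverPoly a z = (z - a i) * ∏ k ∈ Finset.univ.erase i, (z - a k) :=
  (Finset.mul_prod_erase Finset.univ (fun k => z - a k) (Finset.mem_univ i)).symm

theorem coverPoly_ne_zero {a : Fin n → ℂ} {z : ℂ} (h : ∀ k, z ≠ a k) : coverPoly a z ≠ 0 :=
  Finset.prod_ne_zero_iff.2 fun k _ => sub_ne_zero.2 (h k)

theorem differentiable_coverPoly (a : Fin n → ℂ) : Differentiable ℂ (coverPoly a) := by
  unfold coverPoly
  exact Differentiable.fun_finsetProd fun k _ => by fun_prop

theorem prod_erase_sub_ne_zero {a : Fin n → ℂ} (hinj : Function.Injective a) (i : Fin n) :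
    ∏ k ∈ Finset.univ.erase i, (a i - a k) ≠ 0 :=
  Finset.prod_ne_zero_iff.2 fun _ hk =>
    sub_ne_zero.2 (hinj.ne (Finset.ne_of_mem_erase hk).symm)

/-- In `coverPoly` the factor z - a_i is ζ², and the product of the others does not vanish at a_i,
so it has an analytic root v. -/
theorem exists_localSheet {a : Fin n → ℂ} (hinj : Function.Injective a) (i : Fin n) :
    ∃ v : ℂ → ℂ, AnalyticAt ℂ v 0 ∧
      (∀ᶠ t in 𝓝 (0 : ℂ), v t ^ 2 = ∏ k ∈ Finset.univ.erase i, (a i + t - a k)) ∧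
      IsLocalSheet a i (fun ζ => ζ * v (ζ ^ 2)) := by
  have hg : AnalyticAt ℂ (fun t : ℂ => ∏ k ∈ Finset.univ.erase i, (a i + t - a k)) 0 := by
    apply Differentiable.analyticAt
    exact Differentiable.fun_finsetProd fun k _ => by fun_prop
  obtain ⟨v, hv, hsq⟩ := exists_analyticAt_sq_eq hg
    (by simpa using prod_erase_sub_ne_zero hinj i)
  have ht : Tendsto (fun ζ : ℂ => ζ ^ 2) (𝓝 0) (𝓝 0) := by
    have : ContinuousAt (fun ζ : ℂ => ζ ^ 2) 0 := by fun_prop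
    simpa [ContinuousAt] using this
  refine ⟨v, hv, hsq, ?_, ?_⟩
  · have h2 : AnalyticAt ℂ (fun ζ : ℂ => v (ζ ^ 2)) 0 :=
      AnalyticAt.fun_comp_of_eq hv (by fun_prop) (by simp)
    exact analyticAt_id.mul h2
  · filter_upwards [ht.eventually hsq] with ζ h
    rw [mul_pow, h, coverPoly_eq_mul_prod_erase a i]
    ring

theorem IsLocalSheet.neg {a : Fin n → ℂ} {i : Fin n} {w : ℂ → ℂ} (h : IsLocalSheet a i w) :
    IsLocalSheet a i (fun ζ => -w ζ) :=
  ⟨h.1.neg, by filter_upwards [h.2] with ζ hζ; rw [neg_sq, hζ]⟩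

/-! ### The boundary value problem in the unit disc -/

/-- The explicit solution of the boundary value problem in the unit disc. -/
def discSolution (a : Fin n → ℂ) (j : Fin n) (p : ℂ × ℂ) : ℂ := discMain a j p.1 / p.2

theorem doubleCover_snd_ne_zero {S : Set ℂ} {a : Fin n → ℂ} {p : ℂ × ℂ}
    (hp : p ∈ doubleCover S a) : p.2 ≠ 0 := by
  intro h
  have h2 := hp.2.2
  rw [h] at h2
  exact coverPoly_ne_zero hp.2.1 (h2.symm.trans (by simp))

theorem im_eq_zero_of_sq_nonneg {z : ℂ} {x : ℝ} (hx : 0 ≤ x) (h : z ^ 2 = x) : z.im = 0 := by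
  have h1 : z ^ 2 = ((Real.sqrt x : ℝ) : ℂ) ^ 2 := by
    rw [h, ← ofReal_pow, Real.sq_sqrt hx]
  rcases sq_eq_sq_iff_eq_or_eq_neg.1 h1 with h2 | h2 <;> simp [h2]

theorem exists_eq_mul_I_of_sq_nonpos {z : ℂ} {x : ℝ} (hx : 0 ≤ x) (h : z ^ 2 = -x) :
    ∃ β : ℝ, z = β * I := by
  have h1 : (z * I) ^ 2 = x := by rw [mul_pow, h, I_sq]; ring
  have h2 := im_eq_zero_of_sq_nonneg hx h1
  refine ⟨z.im, ?_⟩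
  have h3 : z.re = 0 := by simpa using h2
  apply Complex.ext <;> simp [h3]

theorem isHolomorphicSpinor_div {U : Set ℂ} {a : Fin n → ℂ} {M : ℂ → ℂ}
    (hM : DifferentiableOn ℂ M U) : IsHolomorphicSpinor U a (fun p => M p.1 / p.2) := by
  refine ⟨fun p _ => by simp [div_neg], fun V w hV hw hmem => ?_⟩
  exact (hM.mono fun z hz => (hmem z hz).1).div hw fun z hz => doubleCover_snd_ne_zero (hmem z hz)

theorem tendsto_mul_div_localSheet {a : Fin n → ℂ} {i : Fin n} {M v : ℂ → ℂ}
    (hM : ContinuousAt M (a i)) (hv : ContinuousAt v 0) (h0 : v 0 ≠ 0) :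
    Tendsto (fun ζ : ℂ => ζ * (M (a i + ζ ^ 2) / (ζ * v (ζ ^ 2)))) (𝓝[≠] 0)
      (𝓝 (M (a i) / v 0)) := by
  have ht : ContinuousAt (fun ζ : ℂ => M (a i + ζ ^ 2) / v (ζ ^ 2)) 0 := by
    apply ContinuousAt.div
    · exact ContinuousAt.comp_of_eq (f := fun ζ : ℂ => a i + ζ ^ 2) hM (by fun_prop) (by simp)
    · exact ContinuousAt.comp_of_eq (f := fun ζ : ℂ => ζ ^ 2) hv (by fun_prop) (by simp)
    · simpa using h0
  have ht2 := ht.tendsto.mono_left (nhdsWithin_le_nhds (s := {0}ᶜ))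
  simp only [ne_eq, OfNat.ofNat_ne_zero, not_false_eq_true, zero_pow, add_zero] at ht2
  refine ht2.congr' ?_
  filter_upwards [self_mem_nhdsWithin] with ζ hζ
  have : ζ ≠ 0 := hζ
  field_simp

theorem solvesBVP_discSolution {a : Fin n → ℂ} (ha : ∀ k, ‖a k‖ < 1)
    (hinj : Function.Injective a) (j : Fin n) :
    SolvesBVP unitDisc (fun z => z) a j (discSolution a j) := by
  have hcl : closure unitDisc = closedBall (0 : ℂ) 1 := closure_ball 0 one_ne_zero
  have hfr : frontier unitDisc = sphere (0 : ℂ) 1 := frontier_ball 0 one_ne_zero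
  have hlim : ∀ i, ∃ v : ℂ → ℂ, v 0 ^ 2 = ∏ k ∈ Finset.univ.erase i, (a i - a k) ∧
      IsLocalSheet a i (fun ζ => ζ * v (ζ ^ 2)) ∧
      Tendsto (fun ζ => ζ * discSolution a j (a i + ζ ^ 2, ζ * v (ζ ^ 2))) (𝓝[≠] 0)
        (𝓝 (discMain a j (a i) / v 0)) := by
    intro i
    obtain ⟨v, hv, hsq, hs⟩ := exists_localSheet hinj i
    have hv0 : v 0 ^ 2 = ∏ k ∈ Finset.univ.erase i, (a i - a k) := by
      simpa using hsq.self_of_nhds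
    refine ⟨v, hv0, hs, tendsto_mul_div_localSheet
      (differentiableAt_discMain ha j (ha i).le).continuousAt hv.continuousAt ?_⟩
    intro h
    rw [h] at hv0
    exact prod_erase_sub_ne_zero hinj i (hv0.symm.trans (by simp))
  refine ⟨isHolomorphicSpinor_div fun z hz => ?_, ?_, ?_, ?_, ?_⟩
  · exact (differentiableAt_discMain ha j
      (mem_ball_zero_iff.1 hz).le).differentiableWithinAt
  · rw [hcl]
    refine ContinuousOn.div (fun p hp => ?_) continuousOn_snd fun p hp => doubleCover_snd_ne_zero hp
    exact ((differentiableAt_discMain ha j (mem_closedBall_zero_iff.1 hp.1)).continuousAt.comp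
      continuousAt_fst).continuousWithinAt
  · intro p hp s hs
    rw [hfr] at hp
    have hp1 : ‖p.1‖ = 1 := mem_sphere_zero_iff_norm.1 hp.1
    obtain ⟨x, hx, h⟩ := discMain_sq_mul_of_norm_eq_one ha hinj j hp1
    refine im_eq_zero_of_sq_nonneg hx ?_
    rw [discSolution, mul_pow, hs, div_pow, hp.2.2, div_mul_eq_mul_div, h,
      mul_div_cancel_right₀ _ (coverPoly_ne_zero hp.2.1)]
  · intro i hij
    obtain ⟨v, hv0, hs, ht⟩ := hlim i
    obtain ⟨x, hx, h⟩ := discMain_sq_other ha hinj hij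
    obtain ⟨β, hβ⟩ := exists_eq_mul_I_of_sq_nonpos (z := discMain a j (a i) / v 0) hx (by
      rw [div_pow, hv0, h, mul_div_cancel_right₀ _ (prod_erase_sub_ne_zero hinj i)])
    exact ⟨_, β, hs, hβ ▸ ht⟩
  · obtain ⟨v, hv0, hs, ht⟩ := hlim j
    have h1 : (discMain a j (a j) / v 0) ^ 2 = 1 := by
      rw [div_pow, hv0, discMain_sq_source ha hinj, div_self (prod_erase_sub_ne_zero hinj j)]
    rcases sq_eq_sq_iff_eq_or_eq_neg.1 (h1.trans (one_pow 2).symm) with h2 | h2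
    · exact ⟨_, hs, h2 ▸ ht⟩
    · refine ⟨_, hs.neg, ?_⟩
      rw [h2] at ht
      simpa [discSolution, div_neg] using ht.neg

/-! ### The expansion at the source -/

/-- Four times the coefficient `𝒜` in the unit disc. -/
def discCoeff (a : Fin n → ℂ) (j : Fin n) : ℂ :=
  conj (a j) / (1 - conj (a j) * a j) + ∑ k ∈ Finset.univ.erase j, spinCorr (logHyp a) j k *
    (1 / (a j - a k) + conj (a k) / (1 - conj (a k) * a j))

/-- All products take the same value at the source, so the logarithmic derivative of the sum is the
weighted mean of theirs. Each is affine in the spins, and the mean of μ_k given μ_j = + is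
`spinCorr`. -/
theorem logDeriv_discSum {a : Fin n → ℂ} (ha : ∀ k, ‖a k‖ < 1) (hinj : Function.Injective a)
    (j : Fin n) : logDeriv (discSum a j) (a j) = ∑ k ∈ Finset.univ.erase j,
      (1 / 2 * (1 / (a j - a k) - conj (a k) / (1 - conj (a k) * a j)) +
        1 / 2 * spinCorr (logHyp a) j k *
          (1 / (a j - a k) + conj (a k) / (1 - conj (a k) * a j))) := by
  set K : Finset (Fin n) := Finset.univ.erase j with hK
  set T : ℂ := ∏ k ∈ K, (1 - conj (a k) * a j) * blaschkeRoot a j k with hT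
  have hKj : ∀ {k}, k ∈ K → k ≠ j := fun hk => Finset.ne_of_mem_erase hk
  have hD : ∀ k m, 1 - conj (a k) * a m ≠ 0 := fun k m => one_sub_conj_mul_ne_zero (ha k) (ha m).le
  have hT0 : T ≠ 0 := Finset.prod_ne_zero_iff.2 fun k hk =>
    mul_ne_zero (hD k j) (blaschkeRoot_ne_zero ha hinj (hKj hk))
  set α : Fin n → ℂ := fun k => 1 / (a j - a k) with hα
  set β : Fin n → ℂ := fun k => conj (a k) / (1 - conj (a k) * a j) with hβ
  set W : (Fin n → Bool) → ℝ := fun μ => if μ j then spinWeight (logHyp a) μ else 0 with hW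
  have hfac : ∀ k ∈ K, ∀ b, logDeriv (discFactor a j k b) (a j) =
      1 / 2 * (α k - β k) + 1 / 2 * spin b * (α k + β k) := by
    intro k hk b
    have hb := blaschkeRoot_ne_zero ha hinj (hKj hk)
    have hs : a j - a k ≠ 0 := sub_ne_zero.2 (hinj.ne (hKj hk).symm)
    have hd := hD k j
    cases b
    · have h1 : HasDerivAt (discFactor a j k false) (-conj (a k) * blaschkeRoot a j k) (a j) := by
        have := (((hasDerivAt_id (a j)).const_mul (conj (a k))).const_sub 1).mul_const
          (blaschkeRoot a j k)
        simpa [discFactor] using! this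
      rw [logDeriv_apply, h1.deriv]
      simp only [discFactor, hα, hβ, spin_false, Bool.false_eq_true, if_false]
      generalize 1 - conj (a k) * a j = d at *
      push_cast
      field_simp
      ring
    · have h1 : HasDerivAt (discFactor a j k true) (1 / blaschkeRoot a j k) (a j) := by
        have := ((hasDerivAt_id (a j)).sub_const (a k)).div_const (blaschkeRoot a j k)
        simpa [discFactor] using! this
      rw [logDeriv_apply, h1.deriv]
      simp only [discFactor, hα, hβ, spin_true, if_true]
      generalize 1 - conj (a k) * a j = d at *
      push_cast
      field_simp
      ring
  have hterm : ∀ μ : Fin n → Bool, HasDerivAt (fun z => ∏ k ∈ K, discFactor a j k (μ k) z)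
      (T * ∑ k ∈ K, (1 / 2 * (α k - β k) + 1 / 2 * spin (μ k) * (α k + β k))) (a j) := by
    intro μ
    have hval : ∏ k ∈ K, discFactor a j k (μ k) (a j) = T :=
      Finset.prod_congr rfl fun k hk => discFactor_source ha hinj (hKj hk) _
    have hdiff : DifferentiableAt ℂ (fun z => ∏ k ∈ K, discFactor a j k (μ k) z) (a j) :=
      DifferentiableAt.fun_finsetProd fun k _ => differentiable_discFactor a j k _ _
    have h1 := logDeriv_prod (s := K) (f := fun k => discFactor a j k (μ k)) (x := a j)
      (fun k hk => by
        rw [discFactor_source ha hinj (hKj hk)]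
        exact mul_ne_zero (hD k j) (blaschkeRoot_ne_zero ha hinj (hKj hk)))
      (fun k _ => differentiable_discFactor a j k _ _)
    rw [logDeriv_apply, hval, div_eq_iff hT0] at h1
    refine hdiff.hasDerivAt.congr_deriv ?_
    rw [h1, mul_comm]
    congr 1
    exact Finset.sum_congr rfl fun k hk => hfac k hk _
  have hder : HasDerivAt (discSum a j) (∑ μ, (W μ : ℂ) *
      (T * ∑ k ∈ K, (1 / 2 * (α k - β k) + 1 / 2 * spin (μ k) * (α k + β k)))) (a j) := by
    unfold discSum
    exact HasDerivAt.fun_sum fun μ _ => (hterm μ).const_mul _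
  have hhp : (halfPartition (logHyp a) j : ℂ) ≠ 0 := ofReal_ne_zero.2 (halfPartition_pos _ _).ne'
  rw [logDeriv_apply, hder.deriv, discSum_source ha hinj, div_eq_iff (mul_ne_zero hhp hT0)]
  have e1 : ∑ μ, (W μ : ℂ) * (T * ∑ k ∈ K, (1 / 2 * (α k - β k) +
      1 / 2 * spin (μ k) * (α k + β k))) = T * ∑ k ∈ K, ∑ μ, (W μ : ℂ) *
        (1 / 2 * (α k - β k) + 1 / 2 * spin (μ k) * (α k + β k)) := by
    rw [Finset.sum_comm, Finset.mul_sum]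
    refine Finset.sum_congr rfl fun μ _ => ?_
    rw [← Finset.mul_sum]; ring
  rw [e1, mul_comm (halfPartition _ _ : ℂ) T, mul_left_comm]
  congr 1
  rw [Finset.sum_mul]
  refine Finset.sum_congr rfl fun k _ => ?_
  have e2 : (halfPartition (logHyp a) j : ℂ) = ∑ μ, (W μ : ℂ) := by
    rw [halfPartition, ofReal_sum]
  have e3 : (spinCorr (logHyp a) j k : ℂ) * halfPartition (logHyp a) j =
      ∑ μ, (W μ : ℂ) * spin (μ k) := by
    rw [spinCorr_eq (logHyp_comm a), ofReal_div, div_mul_cancel₀ _ hhp, ofReal_sum]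
    refine Finset.sum_congr rfl fun μ _ => ?_
    rw [← ofReal_mul]
    congr 1
    simp only [hW]
    split_ifs <;> simp
  rw [add_mul, mul_right_comm (1 / 2 * (spinCorr (logHyp a) j k : ℂ)),
    mul_assoc (1 / 2 : ℂ) (spinCorr (logHyp a) j k : ℂ), e3, e2, Finset.mul_sum, Finset.mul_sum,
    Finset.sum_mul, ← Finset.sum_add_distrib]
  refine Finset.sum_congr rfl fun μ _ => ?_
  ring

/-- The square of the solution times `z - a_j`. -/
def sourceProd (a : Fin n → ℂ) (j : Fin n) (z : ℂ) : ℂ :=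
  discMain a j z ^ 2 / ∏ k ∈ Finset.univ.erase j, (z - a k)

theorem sourceProd_source {a : Fin n → ℂ} (ha : ∀ k, ‖a k‖ < 1) (hinj : Function.Injective a)
    (j : Fin n) : sourceProd a j (a j) = 1 := by
  rw [sourceProd, discMain_sq_source ha hinj, div_self (prod_erase_sub_ne_zero hinj j)]

/-- The spin-independent terms of the logarithmic derivative cancel against those of ∏ (z - a_k) and
∏ (1 - conj a_k z); only the factor k = j of the latter survives. -/
theorem hasDerivAt_sourceProd {a : Fin n → ℂ} (ha : ∀ k, ‖a k‖ < 1)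
    (hinj : Function.Injective a) (j : Fin n) :
    HasDerivAt (sourceProd a j) (discCoeff a j) (a j) := by
  have hP0 := prod_erase_sub_ne_zero hinj j
  have hKj : ∀ {k}, k ∈ Finset.univ.erase j → k ≠ j := fun hk => Finset.ne_of_mem_erase hk
  have hD : ∀ k m, 1 - conj (a k) * a m ≠ 0 := fun k m => one_sub_conj_mul_ne_zero (ha k) (ha m).le
  have hPd : Differentiable ℂ fun z => ∏ k ∈ Finset.univ.erase j, (z - a k) :=
    Differentiable.fun_finsetProd fun k _ => by fun_prop
  have hQd : Differentiable ℂ fun z => ∏ k, (1 - conj (a k) * z) :=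
    Differentiable.fun_finsetProd fun k _ => by fun_prop
  have hQ0 : ∏ k, (1 - conj (a k) * a j) ≠ 0 := Finset.prod_ne_zero_iff.2 fun k _ => hD k j
  have hS0 : discSum a j (a j) ≠ 0 := by
    rw [discSum_source ha hinj]
    exact mul_ne_zero (ofReal_ne_zero.2 (halfPartition_pos _ _).ne')
      (Finset.prod_ne_zero_iff.2 fun k hk =>
        mul_ne_zero (hD k j) (blaschkeRoot_ne_zero ha hinj (hKj hk)))
  have hSd := differentiable_discSum a j
  have hc0 : (discConst a j : ℂ) ^ 2 ≠ 0 := by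
    have h1 := sourceProd_source ha hinj j
    intro h
    rw [sourceProd, discMain_sq, h] at h1
    simp at h1
  have heq : sourceProd a j = fun z => discConst a j ^ 2 * (discSum a j z ^ 2 /
      ((∏ k, (1 - conj (a k) * z)) * ∏ k ∈ Finset.univ.erase j, (z - a k))) := by
    ext z
    rw [sourceProd, discMain_sq, div_div, mul_div_assoc]
  have hdiff : DifferentiableAt ℂ (sourceProd a j) (a j) := by
    rw [heq]
    exact (((hSd.pow 2) _).div ((hQd.mul hPd) _) (mul_ne_zero hQ0 hP0)).const_mul _
  have hld : logDeriv (sourceProd a j) (a j) = discCoeff a j := by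
    rw [heq, logDeriv_const_mul _ _ hc0, logDeriv_div (f := fun z => discSum a j z ^ 2)
        (g := fun z => (∏ k, (1 - conj (a k) * z)) * ∏ k ∈ Finset.univ.erase j, (z - a k)) (a j)
        (pow_ne_zero 2 hS0) (mul_ne_zero hQ0 hP0) ((hSd.pow 2) _) ((hQd.mul hPd) _),
      logDeriv_mul (f := fun z => ∏ k, (1 - conj (a k) * z))
        (g := fun z => ∏ k ∈ Finset.univ.erase j, (z - a k)) (a j) hQ0 hP0 (hQd _) (hPd _),
      logDeriv_fun_pow (hSd _), logDeriv_discSum ha hinj,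
      logDeriv_prod (f := fun k z => 1 - conj (a k) * z) (fun k _ => hD k j)
        (fun k _ => by fun_prop),
      logDeriv_prod (f := fun k z => z - a k)
        (fun k hk => sub_ne_zero.2 (hinj.ne (hKj hk).symm)) (fun k _ => by fun_prop)]
    have e1 : ∀ k, logDeriv (fun z => 1 - conj (a k) * z) (a j) =
        -(conj (a k) / (1 - conj (a k) * a j)) := by
      intro k
      have : HasDerivAt (fun z => 1 - conj (a k) * z) (-conj (a k)) (a j) := by
        simpa using ((hasDerivAt_id (a j)).const_mul (conj (a k))).const_sub 1
      rw [logDeriv_apply, this.deriv, neg_div]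
    have e2 : ∀ k, logDeriv (fun z => z - a k) (a j) = 1 / (a j - a k) := by
      intro k
      rw [logDeriv_apply, ((hasDerivAt_id' (a j)).sub_const (a k)).deriv]
    simp only [e1, e2]
    rw [← Finset.add_sum_erase _ _ (Finset.mem_univ j), discCoeff, Finset.mul_sum,
      Finset.sum_neg_distrib]
    have e3 : ∀ x y z w : ℂ, x - (-y + -z + w) = y + (x + z - w) := fun x y z w => by ring
    rw [e3, ← Finset.sum_add_distrib, ← Finset.sum_sub_distrib]
    congr 1
    refine Finset.sum_congr rfl fun k _ => ?_
    push_cast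
    ring
  refine hdiff.hasDerivAt.congr_deriv ?_
  rw [← hld, logDeriv_apply, sourceProd_source ha hinj, div_one]

end

section

open Metric Set Complex ComplexConjugate

variable {n : ℕ}

/-! ### Uniqueness in the boundary value problem -/

theorem inv_coverPoly_eq_sum {a : Fin n → ℂ} (hinj : Function.Injective a) [Nonempty (Fin n)]
    {z : ℂ} (hz : ∀ k, z ≠ a k) :
    (coverPoly a z)⁻¹ = ∑ i, (z - a i)⁻¹ * (∏ k ∈ Finset.univ.erase i, (a i - a k))⁻¹ := by
  have h1 := congrArg (Polynomial.eval z)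
    (Lagrange.sum_basis (s := Finset.univ) (v := a) hinj.injOn Finset.univ_nonempty)
  rw [Polynomial.eval_finsetSum, Polynomial.eval_one] at h1
  refine inv_eq_of_mul_eq_one_right ?_
  rw [← h1, Finset.mul_sum]
  refine Finset.sum_congr rfl fun i _ => ?_
  rw [Lagrange.eval_basis_not_at_node (Finset.mem_univ i) (hz i), Lagrange.eval_nodal,
    Lagrange.nodalWeight, Finset.prod_inv_distrib, coverPoly]
  ring

theorem eventually_eq_or_eq_neg_of_sq_eq {f g : ℂ → ℂ} (hf : AnalyticAt ℂ f 0)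
    (hg : AnalyticAt ℂ g 0) (h : ∀ᶠ ζ in 𝓝 (0 : ℂ), f ζ ^ 2 = g ζ ^ 2) :
    (∀ᶠ ζ in 𝓝 (0 : ℂ), f ζ = g ζ) ∨ ∀ᶠ ζ in 𝓝 (0 : ℂ), f ζ = -g ζ := by
  rcases (hf.sub hg).eventually_eq_zero_or_eventually_ne_zero with h1 | h1
  · left
    filter_upwards [h1] with ζ hζ
    exact sub_eq_zero.1 hζ
  · right
    have h2 : ∀ᶠ ζ in 𝓝[≠] (0 : ℂ), (f + g) ζ = 0 := by
      filter_upwards [h1, h.filter_mono nhdsWithin_le_nhds] with ζ hζ h3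
      have h4 : (f ζ - g ζ) * (f ζ + g ζ) = 0 := by linear_combination h3
      exact (mul_eq_zero.1 h4).resolve_left hζ
    filter_upwards [(hf.add hg).frequently_zero_iff_eventually_zero.1 h2.frequently] with ζ hζ
    exact eq_neg_of_add_eq_zero_left hζ

theorem IsLocalSheet.eventually_eq_or_eq_neg {a : Fin n → ℂ} {i : Fin n} {w w' : ℂ → ℂ}
    (h : IsLocalSheet a i w) (h' : IsLocalSheet a i w') :
    (∀ᶠ ζ in 𝓝 (0 : ℂ), w ζ = w' ζ) ∨ ∀ᶠ ζ in 𝓝 (0 : ℂ), w ζ = -w' ζ :=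
  eventually_eq_or_eq_neg_of_sq_eq h.1 h'.1 (by
    filter_upwards [h.2, h'.2] with ζ h1 h2
    rw [h1, h2])

theorem doubleCover_mono {S T : Set ℂ} (h : S ⊆ T) (a : Fin n → ℂ) :
    doubleCover S a ⊆ doubleCover T a := fun _ hp => ⟨h hp.1, hp.2⟩

theorem neg_mem_doubleCover {S : Set ℂ} {a : Fin n → ℂ} {p : ℂ × ℂ} (hp : p ∈ doubleCover S a) :
    (p.1, -p.2) ∈ doubleCover S a := ⟨hp.1, hp.2.1, by rw [neg_sq]; exact hp.2.2⟩

theorem tendsto_cpow_half_punctured (c : ℂ) :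
    Tendsto (fun z : ℂ => (z - c) ^ (1 / 2 : ℂ)) (𝓝[≠] c) (𝓝[≠] 0) := by
  refine tendsto_nhdsWithin_iff.2 ⟨?_, ?_⟩
  · rw [tendsto_zero_iff_norm_tendsto_zero]
    have h1 : ∀ z : ℂ, ‖(z - c) ^ (1 / 2 : ℂ)‖ = Real.sqrt ‖z - c‖ := by
      intro z
      rw [← Real.sqrt_sq (norm_nonneg ((z - c) ^ (1 / 2 : ℂ))), ← norm_pow, cpow_half_sq]
    simp only [h1]
    have h2 : ContinuousAt (fun z : ℂ => Real.sqrt ‖z - c‖) c := by fun_prop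
    simpa [ContinuousAt] using h2.tendsto.mono_left nhdsWithin_le_nhds
  · filter_upwards [self_mem_nhdsWithin] with z hz h
    have h2 := cpow_half_sq (z - c)
    rw [h] at h2
    exact hz (sub_eq_zero.1 (by simpa using h2.symm))

/-- The square of a spinor, as a function of the base point. -/
def spinorSq (a : Fin n → ℂ) (D : ℂ × ℂ → ℂ) (z : ℂ) : ℂ :=
  D (z, coverPoly a z ^ (1 / 2 : ℂ)) ^ 2

/-- The square is even in the second coordinate, so the cut of the principal root in `spinorSq` is
invisible; regularity is checked with a local branch. -/
theorem sq_eq_spinorSq {S : Set ℂ} {a : Fin n → ℂ} {D : ℂ × ℂ → ℂ}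
    (hodd : ∀ p ∈ doubleCover S a, D (p.1, -p.2) = -D p) {p : ℂ × ℂ}
    (hp : p ∈ doubleCover S a) : D p ^ 2 = spinorSq a D p.1 := by
  have h1 : p.2 ^ 2 = (coverPoly a p.1 ^ (1 / 2 : ℂ)) ^ 2 := by rw [cpow_half_sq]; exact hp.2.2
  rcases sq_eq_sq_iff_eq_or_eq_neg.1 h1 with h2 | h2
  · rw [spinorSq, ← h2]
  · have h3 : coverPoly a p.1 ^ (1 / 2 : ℂ) = -p.2 := by rw [h2, neg_neg]
    rw [spinorSq, h3, hodd p hp, neg_sq]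

theorem continuousWithinAt_spinorSq {S : Set ℂ} {a : Fin n → ℂ} {D : ℂ × ℂ → ℂ}
    (hodd : ∀ p ∈ doubleCover S a, D (p.1, -p.2) = -D p)
    (hcont : ContinuousOn D (doubleCover S a)) {z : ℂ} (hzS : z ∈ S) (hz : ∀ k, z ≠ a k) :
    ContinuousWithinAt (spinorSq a D) S z := by
  obtain ⟨v, hv, hsq⟩ := exists_analyticAt_sq_eq
    ((differentiable_coverPoly a).analyticAt z) (coverPoly_ne_zero hz)
  have hne : ∀ᶠ t in 𝓝 z, ∀ k, t ≠ a k :=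
    eventually_all.2 fun k => isOpen_ne.mem_nhds (hz k)
  have hmem : ∀ᶠ t in 𝓝[S] z, (t, v t) ∈ doubleCover S a := by
    filter_upwards [self_mem_nhdsWithin, hsq.filter_mono nhdsWithin_le_nhds,
      hne.filter_mono nhdsWithin_le_nhds] with t h1 h2 h3
    exact ⟨h1, h3, h2⟩
  have hz' : (z, v z) ∈ doubleCover S a := ⟨hzS, hz, hsq.self_of_nhds⟩
  have h1 : Tendsto (fun t => (t, v t)) (𝓝[S] z) (𝓝[doubleCover S a] (z, v z)) :=
    tendsto_nhdsWithin_iff.2 ⟨(continuousAt_id.prodMk hv.continuousAt).tendsto.mono_left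
      nhdsWithin_le_nhds, hmem⟩
  have h2 : Tendsto (fun t => D (t, v t) ^ 2) (𝓝[S] z) (𝓝 (D (z, v z) ^ 2)) :=
    ((hcont _ hz').tendsto.comp h1).pow 2
  rw [ContinuousWithinAt, ← sq_eq_spinorSq hodd hz']
  refine h2.congr' ?_
  filter_upwards [hmem] with t ht
  exact sq_eq_spinorSq hodd ht

theorem differentiableAt_spinorSq {S : Set ℂ} (hS : IsOpen S) {a : Fin n → ℂ} {D : ℂ × ℂ → ℂ}
    (hD : IsHolomorphicSpinor S a D) {z : ℂ} (hzS : z ∈ S) (hz : ∀ k, z ≠ a k) :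
    DifferentiableAt ℂ (spinorSq a D) z := by
  obtain ⟨v, hv, hsq⟩ := exists_analyticAt_sq_eq
    ((differentiable_coverPoly a).analyticAt z) (coverPoly_ne_zero hz)
  have hne : ∀ᶠ t in 𝓝 z, ∀ k, t ≠ a k :=
    eventually_all.2 fun k => isOpen_ne.mem_nhds (hz k)
  obtain ⟨r, hr, hb⟩ := Metric.eventually_nhds_iff_ball.1
    (((hv.eventually_analyticAt.and hsq).and hne).and (hS.mem_nhds hzS))
  have hmem : ∀ t ∈ ball z r, (t, v t) ∈ doubleCover S a := fun t ht =>
    ⟨(hb t ht).2, (hb t ht).1.2, (hb t ht).1.1.2⟩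
  have h1 := hD.2 (ball z r) v isOpen_ball
    (fun t ht => (hb t ht).1.1.1.differentiableAt.differentiableWithinAt) hmem
  have h2 := ((h1.differentiableAt (ball_mem_nhds z hr)).pow 2)
  refine h2.congr_of_eventuallyEq ?_
  filter_upwards [ball_mem_nhds z hr] with t ht
  exact (sq_eq_spinorSq hD.1 (hmem t ht)).symm

/-- The square of a spinor times the polynomial defining the double cover extends continuously
to the branching points. -/
theorem tendsto_coverPoly_mul_spinorSq {S : Set ℂ} {a : Fin n → ℂ} (hinj : Function.Injective a)
    {D : ℂ × ℂ → ℂ} (hodd : ∀ p ∈ doubleCover S a, D (p.1, -p.2) = -D p) {i : Fin n}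
    (hS : S ∈ 𝓝 (a i)) {w : ℂ → ℂ} (hw : IsLocalSheet a i w) {c : ℂ}
    (hlim : Tendsto (fun ζ => ζ * D (a i + ζ ^ 2, w ζ)) (𝓝[≠] 0) (𝓝 c)) :
    Tendsto (fun z => coverPoly a z * spinorSq a D z) (𝓝[≠] (a i))
      (𝓝 (c ^ 2 * ∏ k ∈ Finset.univ.erase i, (a i - a k))) := by
  have h1 := (hlim.comp (tendsto_cpow_half_punctured (a i))).pow 2
  have h2 : Tendsto (fun z => ∏ k ∈ Finset.univ.erase i, (z - a k)) (𝓝[≠] (a i))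
      (𝓝 (∏ k ∈ Finset.univ.erase i, (a i - a k))) := by
    have : Continuous (fun z : ℂ => ∏ k ∈ Finset.univ.erase i, (z - a k)) := by fun_prop
    exact this.continuousAt.tendsto.mono_left nhdsWithin_le_nhds
  refine (h1.mul h2).congr' ?_
  have h3 := (tendsto_cpow_half_punctured (a i)).eventually
    (hw.2.filter_mono nhdsWithin_le_nhds)
  have hne : ∀ᶠ t in 𝓝[≠] (a i), ∀ k, t ≠ a k := by
    refine eventually_all.2 fun k => ?_
    by_cases hk : k = i
    · subst hk; exact self_mem_nhdsWithin
    · exact nhdsWithin_le_nhds (isOpen_ne.mem_nhds (hinj.ne (Ne.symm hk)))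
  filter_upwards [h3, hne, nhdsWithin_le_nhds hS] with z hz hzne hzS
  have h4 : a i + ((z - a i) ^ (1 / 2 : ℂ)) ^ 2 = z := by rw [cpow_half_sq]; ring
  rw [h4] at hz
  have h5 := sq_eq_spinorSq hodd (p := (z, w ((z - a i) ^ (1 / 2 : ℂ)))) ⟨hzS, hzne, hz⟩
  simp only [Function.comp_apply]
  rw [h4, mul_pow, cpow_half_sq, h5, coverPoly_eq_mul_prod_erase a i]
  ring

/-- The homogeneous boundary value problem in the unit disc has no nonzero solution. -/
theorem spinor_eq_zero [Nonempty (Fin n)] {a : Fin n → ℂ} (ha : ∀ k, ‖a k‖ < 1)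
    (hinj : Function.Injective a) {D : ℂ × ℂ → ℂ} (hD : IsHolomorphicSpinor unitDisc a D)
    (hodd : ∀ p ∈ doubleCover (closedBall 0 1) a, D (p.1, -p.2) = -D p)
    (hcont : ContinuousOn D (doubleCover (closedBall 0 1) a))
    (hbd : ∀ p ∈ doubleCover (sphere 0 1) a, ∀ s : ℂ, s ^ 2 = p.1 → (D p * s).im = 0)
    (hlim : ∀ i, ∃ (w : ℂ → ℂ) (β : ℝ), IsLocalSheet a i w ∧
      Tendsto (fun ζ => ζ * D (a i + ζ ^ 2, w ζ)) (𝓝[≠] 0) (𝓝 (β * I)))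
    {p : ℂ × ℂ} (hp : p ∈ doubleCover unitDisc a) : D p = 0 := by
  choose w β hw hlim using hlim
  set κ : Fin n → ℂ := fun i => (β i * I) ^ 2 * ∏ k ∈ Finset.univ.erase i, (a i - a k) with hκ
  -- D² has at most simple poles at the a_i. Multiplied by the polynomial and given its limits κ
  -- there, it is continuous on the closed disc, and Cauchy's formula applies.
  set k : ℂ → ℂ := Function.extend a κ (fun z => coverPoly a z * spinorSq a D z) with hk
  have hka : ∀ i, k (a i) = κ i := fun i => hinj.extend_apply _ _ _
  have hkz : ∀ z, (∀ i, z ≠ a i) → k z = coverPoly a z * spinorSq a D z := fun z hz =>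
    Function.extend_apply' _ _ _ (by rintro ⟨i, rfl⟩; exact hz i rfl)
  have hne : ∀ z, (∀ i, z ≠ a i) → ∀ᶠ t in 𝓝 z, ∀ i, t ≠ a i := fun z hz =>
    eventually_all.2 fun i => isOpen_ne.mem_nhds (hz i)
  have hsph : ∀ z ∈ sphere (0 : ℂ) 1, ∀ i, z ≠ a i := by
    rintro z hz i rfl
    exact (ha i).ne (mem_sphere_zero_iff_norm.1 hz)
  have hkc : ContinuousOn k (closedBall 0 1) := by
    intro z hz
    by_cases h : ∃ i, z = a i
    · obtain ⟨i, rfl⟩ := h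
      refine ContinuousAt.continuousWithinAt ?_
      rw [continuousAt_iff_punctured_nhds, hka]
      refine (tendsto_coverPoly_mul_spinorSq hinj hodd
        (closedBall_mem_nhds_of_mem (mem_ball_zero_iff.2 (ha i))) (hw i) (hlim i)).congr' ?_
      have : ∀ᶠ t in 𝓝[≠] (a i), ∀ k, t ≠ a k := by
        refine eventually_all.2 fun k => ?_
        by_cases hk : k = i
        · subst hk; exact self_mem_nhdsWithin
        · exact nhdsWithin_le_nhds (isOpen_ne.mem_nhds (hinj.ne (Ne.symm hk)))
      filter_upwards [this] with t ht
      exact (hkz t ht).symm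
    · push Not at h
      have h1 : ContinuousWithinAt (fun z => coverPoly a z * spinorSq a D z) (closedBall 0 1) z :=
        (differentiable_coverPoly a z).continuousAt.continuousWithinAt.mul
          (continuousWithinAt_spinorSq hodd hcont hz h)
      refine h1.congr_of_eventuallyEq ?_ (hkz z h)
      filter_upwards [(hne z h).filter_mono nhdsWithin_le_nhds] with t ht
      exact hkz t ht
  have hkd : ∀ z ∈ ball (0 : ℂ) 1 \ range a, DifferentiableAt ℂ k z := by
    intro z hz
    have h : ∀ i, z ≠ a i := by rintro i rfl; exact hz.2 ⟨i, rfl⟩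
    refine ((differentiable_coverPoly a z).mul
      (differentiableAt_spinorSq isOpen_ball hD hz.1 h)).congr_of_eventuallyEq ?_
    filter_upwards [hne z h] with t ht
    exact hkz t ht
  have hcauchy : ∀ u ∈ ball (0 : ℂ) 1,
      (∮ z in C(0, 1), (z - u)⁻¹ * k z) = 2 * Real.pi * I * k u := fun u hu => by
    have := circleIntegral_sub_inv_smul_of_differentiable_on_off_countable
      (countable_range a) hu hkc hkd
    simpa only [smul_eq_mul] using this
  have hkci : ∀ u ∈ ball (0 : ℂ) 1, CircleIntegrable (fun z => (z - u)⁻¹ * k z) 0 1 := by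
    intro u hu
    refine ContinuousOn.circleIntegrable zero_le_one ?_
    refine ContinuousOn.mul (ContinuousOn.inv₀ (by fun_prop) ?_) (hkc.mono sphere_subset_closedBall)
    rintro z hz h
    rw [sub_eq_zero.1 h] at hz
    exact (mem_ball_zero_iff.1 hu).ne (mem_sphere_zero_iff_norm.1 hz)
  have hP0 := fun i => prod_erase_sub_ne_zero hinj i
  -- The residue theorem through partial fractions of 1 / `coverPoly`; the residue at a_i is (β_i
  -- I)² = -β_i².
  have hint : (∮ z in C(0, 1), spinorSq a D z) = -(2 * Real.pi * I * ∑ i, (β i : ℂ) ^ 2) := by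
    have e1 : (∮ z in C(0, 1), spinorSq a D z) = ∮ z in C(0, 1), ∑ i,
        (∏ k ∈ Finset.univ.erase i, (a i - a k))⁻¹ * ((z - a i)⁻¹ * k z) := by
      refine circleIntegral.integral_congr zero_le_one fun z hz => ?_
      have hz' := hsph z hz
      have h2 : spinorSq a D z = (coverPoly a z)⁻¹ * k z := by
        rw [hkz z hz', inv_mul_cancel_left₀ (coverPoly_ne_zero hz')]
      rw [h2, inv_coverPoly_eq_sum hinj hz', Finset.sum_mul]
      exact Finset.sum_congr rfl fun i _ => by ring
    rw [e1, circleIntegral.integral_fun_sum, Finset.mul_sum, ← Finset.sum_neg_distrib]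
    · refine Finset.sum_congr rfl fun i _ => ?_
      rw [circleIntegral.integral_const_mul, hcauchy _ (mem_ball_zero_iff.2 (ha i)), hka, hκ]
      have := hP0 i
      simp only [mul_pow, I_sq]
      field_simp
    · intro i _
      exact IntervalIntegrable.const_mul (hkci _ (mem_ball_zero_iff.2 (ha i))) _
  -- positivity on the circle
  have hpos : ∀ z ∈ sphere (0 : ℂ) 1, ∃ x : ℝ, 0 ≤ x ∧ spinorSq a D z * z = x := by
    intro z hz
    have hmem : (z, coverPoly a z ^ (1 / 2 : ℂ)) ∈ doubleCover (sphere 0 1) a :=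
      ⟨hz, hsph z hz, cpow_half_sq _⟩
    have h1 := hbd _ hmem (z ^ (1 / 2 : ℂ)) (cpow_half_sq z)
    set y := D (z, coverPoly a z ^ (1 / 2 : ℂ)) * z ^ (1 / 2 : ℂ) with hy
    refine ⟨y.re ^ 2, sq_nonneg _, ?_⟩
    have h2 : y = y.re := Complex.ext rfl (by simpa using h1)
    rw [ofReal_pow, ← h2, hy, mul_pow, cpow_half_sq, spinorSq]
  choose! x hx0 hx using hpos
  have hsc : ContinuousOn (spinorSq a D) (sphere 0 1) := fun z hz =>
    (continuousWithinAt_spinorSq hodd hcont (sphere_subset_closedBall hz) (hsph z hz)).mono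
      sphere_subset_closedBall
  have hxre : ∀ z ∈ sphere (0 : ℂ) 1, x z = (spinorSq a D z * z).re := fun z hz => by
    rw [hx z hz, ofReal_re]
  have hcm : ∀ θ, circleMap 0 1 θ ∈ sphere (0 : ℂ) 1 := fun θ =>
    circleMap_mem_sphere 0 zero_le_one θ
  have hxc : Continuous (fun θ => x (circleMap 0 1 θ)) := by
    have h1 : Continuous (fun θ => (spinorSq a D (circleMap 0 1 θ) * circleMap 0 1 θ).re) := by
      have := hsc.comp_continuous (continuous_circleMap 0 1) hcm
      exact continuous_re.comp (this.mul (continuous_circleMap 0 1))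
    exact h1.congr fun θ => (hxre _ (hcm θ)).symm
  have hsum : ∫ θ in (0 : ℝ)..2 * Real.pi, x (circleMap 0 1 θ) =
      -(2 * Real.pi * ∑ i, β i ^ 2) := by
    have e1 : (∮ z in C(0, 1), spinorSq a D z) =
        I * ((∫ θ in (0 : ℝ)..2 * Real.pi, x (circleMap 0 1 θ) : ℝ) : ℂ) := by
      rw [circleIntegral, ← intervalIntegral.integral_ofReal,
        ← intervalIntegral.integral_const_mul]
      refine intervalIntegral.integral_congr fun θ _ => ?_
      simp only [deriv_circleMap, smul_eq_mul, ← hx _ (hcm θ)]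
      ring
    rw [e1] at hint
    have h2 := mul_left_cancel₀ I_ne_zero (hint.trans (show _ =
      I * ((-(2 * Real.pi * ∑ i, β i ^ 2) : ℝ) : ℂ) by push_cast; ring))
    exact_mod_cast h2
  -- A continuous nonnegative function whose integral is nonpositive.
  have hzero : ∀ θ ∈ Icc 0 (2 * Real.pi), x (circleMap 0 1 θ) = 0 := by
    by_contra! hcon
    obtain ⟨θ, hθ, hne0⟩ := hcon
    have := intervalIntegral.integral_pos (f := fun θ => x (circleMap 0 1 θ)) Real.two_pi_pos
      hxc.continuousOn (fun θ _ => hx0 _ (hcm θ))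
      ⟨θ, hθ, (hx0 _ (hcm θ)).lt_of_ne' hne0⟩
    rw [hsum] at this
    have h3 : 0 ≤ ∑ i, β i ^ 2 := Finset.sum_nonneg fun i _ => sq_nonneg _
    have := Real.pi_pos
    nlinarith
  have hk0 : k p.1 = 0 := by
    have h1 := hcauchy p.1 hp.1
    have h2 : (∮ z in C(0, 1), (z - p.1)⁻¹ * k z) = 0 := by
      rw [circleIntegral]
      have : ∀ θ ∈ uIcc 0 (2 * Real.pi), deriv (circleMap 0 1) θ •
          ((circleMap 0 1 θ - p.1)⁻¹ * k (circleMap 0 1 θ)) = 0 := by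
        intro θ hθ
        rw [uIcc_of_le Real.two_pi_pos.le] at hθ
        have h3 := hx _ (hcm θ)
        rw [hzero θ hθ, ofReal_zero] at h3
        have h4 : circleMap 0 1 θ ≠ 0 := circleMap_ne_center one_ne_zero
        rw [hkz _ (hsph _ (hcm θ)), (mul_eq_zero.1 h3).resolve_right h4]
        simp
      rw [intervalIntegral.integral_congr this]
      simp
    rw [h2] at h1
    have h3 : (2 * Real.pi * I : ℂ) ≠ 0 := two_pi_I_ne_zero
    exact (mul_eq_zero.1 h1.symm).resolve_left h3
  rw [hkz _ hp.2.1, ← sq_eq_spinorSq hD.1 hp] at hk0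
  exact pow_eq_zero_iff two_ne_zero |>.1
    ((mul_eq_zero.1 hk0).resolve_left (coverPoly_ne_zero hp.2.1))

theorem IsHolomorphicSpinor.sub_const_mul {U : Set ℂ} {a : Fin n → ℂ} {F G : ℂ × ℂ → ℂ}
    (hF : IsHolomorphicSpinor U a F) (hG : IsHolomorphicSpinor U a G) (ε : ℂ) :
    IsHolomorphicSpinor U a (fun p => F p - ε * G p) := by
  refine ⟨fun p hp => ?_, fun V w hV hw hmem =>
    (hF.2 V w hV hw hmem).sub ((hG.2 V w hV hw hmem).const_mul ε)⟩
  simp only [hF.1 p hp, hG.1 p hp]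
  ring

/-- Spinors continuous up to the boundary change sign between the sheets on the boundary too. -/
theorem neg_of_continuousOn_closure {a : Fin n → ℂ} {G : ℂ × ℂ → ℂ}
    (hodd : ∀ p ∈ doubleCover unitDisc a, G (p.1, -p.2) = -G p)
    (hcont : ContinuousOn G (doubleCover (closedBall 0 1) a)) :
    ∀ p ∈ doubleCover (closedBall 0 1) a, G (p.1, -p.2) = -G p := by
  intro p hp
  obtain ⟨v, hv, hsq⟩ := exists_analyticAt_sq_eq
    ((differentiable_coverPoly a).analyticAt p.1) (coverPoly_ne_zero hp.2.1)
  have key : ∀ u : ℂ → ℂ, ContinuousAt u p.1 → (∀ᶠ t in 𝓝 p.1, u t ^ 2 = coverPoly a t) →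
      u p.1 = p.2 → G (p.1, -p.2) = -G p := by
    intro u hu hsq hup
    have hne : ∀ᶠ t in 𝓝 p.1, ∀ k, t ≠ a k :=
      eventually_all.2 fun k => isOpen_ne.mem_nhds (hp.2.1 k)
    have hnb : (𝓝[unitDisc] p.1).NeBot := by
      rw [← mem_closure_iff_nhdsWithin_neBot, unitDisc, closure_ball 0 one_ne_zero]
      exact hp.1
    have hmem : ∀ᶠ t in 𝓝[unitDisc] p.1, (t, u t) ∈ doubleCover unitDisc a := by
      filter_upwards [self_mem_nhdsWithin, hsq.filter_mono nhdsWithin_le_nhds,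
        hne.filter_mono nhdsWithin_le_nhds] with t h1 h2 h3
      exact ⟨h1, h3, h2⟩
    have hsub : doubleCover unitDisc a ⊆ doubleCover (closedBall 0 1) a :=
      doubleCover_mono ball_subset_closedBall a
    have t1 : Tendsto (fun t => G (t, u t)) (𝓝[unitDisc] p.1) (𝓝 (G p)) := by
      refine (hcont p hp).tendsto.comp (tendsto_nhdsWithin_iff.2 ⟨?_, hmem.mono fun _ h => hsub h⟩)
      have : ContinuousAt (fun t => (t, u t)) p.1 := continuousAt_id.prodMk hu
      have h2 := this.tendsto.mono_left (nhdsWithin_le_nhds (s := unitDisc))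
      rwa [hup] at h2
    have t2 : Tendsto (fun t => G (t, -u t)) (𝓝[unitDisc] p.1) (𝓝 (G (p.1, -p.2))) := by
      refine (hcont _ (neg_mem_doubleCover hp)).tendsto.comp (tendsto_nhdsWithin_iff.2
        ⟨?_, hmem.mono fun _ h => hsub (neg_mem_doubleCover h)⟩)
      have : ContinuousAt (fun t => (t, -u t)) p.1 := continuousAt_id.prodMk hu.neg
      have h2 := this.tendsto.mono_left (nhdsWithin_le_nhds (s := unitDisc))
      rwa [hup] at h2
    refine tendsto_nhds_unique t2 (t1.neg.congr' ?_)
    filter_upwards [hmem] with t ht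
    exact (hodd _ ht).symm
  have h1 : v p.1 ^ 2 = p.2 ^ 2 := by rw [hsq.self_of_nhds, hp.2.2]
  rcases sq_eq_sq_iff_eq_or_eq_neg.1 h1 with h2 | h2
  · exact key v hv.continuousAt hsq h2
  · exact key (fun t => -v t) hv.continuousAt.neg (hsq.mono fun t ht => by rw [neg_sq, ht])
      (by rw [h2, neg_neg])

/-- The two solutions may reach the limit 1 at the source on opposite sheets, hence the sign ε. In G
- ε · `discSolution` the source limits cancel, the other limits stay imaginary, and the homogeneous
problem applies. -/
theorem SolvesBVP.sq_eq {a : Fin n → ℂ} (ha : ∀ k, ‖a k‖ < 1) (hinj : Function.Injective a)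
    {j : Fin n} {G : ℂ × ℂ → ℂ} (hG : SolvesBVP unitDisc (fun z => z) a j G) {p : ℂ × ℂ}
    (hp : p ∈ doubleCover unitDisc a) :
    G p ^ 2 = discMain a j p.1 ^ 2 / coverPoly a p.1 := by
  have hcl : closure unitDisc = closedBall (0 : ℂ) 1 := closure_ball 0 one_ne_zero
  have hfr : frontier unitDisc = sphere (0 : ℂ) 1 := frontier_ball 0 one_ne_zero
  have : Nonempty (Fin n) := ⟨j⟩
  obtain ⟨g1, g2, g3, g4, wg, hwg, g5⟩ := hG
  obtain ⟨f1, f2, f3, f4, wf, hwf, f5⟩ := solvesBVP_discSolution ha hinj j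
  rw [hcl] at g2 f2
  rw [hfr] at g3 f3
  have hneg : ∀ z u, discSolution a j (z, -u) = -discSolution a j (z, u) := fun z u => by
    simp [discSolution, div_neg]
  -- transport of limits between sheets
  have htr : ∀ {i w w'} {c : ℂ}, IsLocalSheet a i w → IsLocalSheet a i w' →
      Tendsto (fun ζ => ζ * discSolution a j (a i + ζ ^ 2, w' ζ)) (𝓝[≠] 0) (𝓝 c) →
      ∃ ε : ℝ, (ε = 1 ∨ ε = -1) ∧
      Tendsto (fun ζ => ζ * discSolution a j (a i + ζ ^ 2, w ζ)) (𝓝[≠] 0) (𝓝 (ε * c)) := by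
    intro i w w' c hw hw' h
    rcases hw.eventually_eq_or_eq_neg hw' with h1 | h1
    · refine ⟨1, Or.inl rfl, ?_⟩
      rw [ofReal_one, one_mul]
      refine h.congr' ?_
      filter_upwards [h1.filter_mono nhdsWithin_le_nhds] with ζ hζ
      rw [hζ]
    · refine ⟨-1, Or.inr rfl, ?_⟩
      rw [ofReal_neg, ofReal_one, neg_one_mul]
      refine h.neg.congr' ?_
      filter_upwards [h1.filter_mono nhdsWithin_le_nhds] with ζ hζ
      rw [hζ, hneg]
      ring
  obtain ⟨ε, hε, h5⟩ := htr hwg hwf f5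
  have hε2 : ε * ε = 1 := by rcases hε with rfl | rfl <;> norm_num
  have hD0 : G p - ε * discSolution a j p = 0 := by
    refine spinor_eq_zero (D := fun p => G p - ε * discSolution a j p) ha hinj
      (g1.sub_const_mul f1 ε) ?_ (g2.sub (continuousOn_const.mul f2)) ?_ ?_ hp
    · intro q hq
      have := neg_of_continuousOn_closure g1.1 g2 q hq
      simp only [hneg, this]
      ring
    · intro q hq s hs
      have h1 := g3 q hq s hs
      have h2 := f3 q hq s hs
      have : (G q - ε * discSolution a j q) * s = G q * s - ε * (discSolution a j q * s) := by ring
      rw [this, sub_im, h1, im_ofReal_mul, h2]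
      simp
    · intro i
      by_cases hi : i = j
      · subst hi
        refine ⟨wg, 0, hwg, ?_⟩
        have := g5.sub (h5.const_mul (ε : ℂ))
        have e : (1 : ℂ) - ε * (ε * 1) = (0 : ℝ) * I := by
          rw [mul_one, ← ofReal_mul, hε2]; simp
        rw [e] at this
        exact this.congr fun ζ => by ring
      · obtain ⟨w1, β1, hw1, t1⟩ := g4 i hi
        obtain ⟨w2, β2, hw2, t2⟩ := f4 i hi
        obtain ⟨δ, -, t3⟩ := htr hw1 hw2 t2
        refine ⟨w1, β1 - ε * (δ * β2), hw1, ?_⟩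
        have := t1.sub (t3.const_mul (ε : ℂ))
        have e : (β1 * I - ε * (δ * (β2 * I)) : ℂ) = (β1 - ε * (δ * β2) : ℝ) * I := by
          push_cast; ring
        rw [e] at this
        exact this.congr fun ζ => by ring
  rw [sub_eq_zero.1 hD0, mul_pow, discSolution, div_pow, hp.2.2, sq (ε : ℂ), ← ofReal_mul, hε2]
  simp

end

section

open Metric Set Complex ComplexConjugate

variable {n : ℕ}

/-! ### The coefficient in a simply connected domain -/

/-- The coefficient `𝒜` in terms of a conformal map onto the unit disc. -/
def obsCoeff (φ : ℂ → ℂ) (a : Fin n → ℂ) (j : Fin n) : ℂ :=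
  (discCoeff (fun i => φ (a i)) j * deriv φ (a j) +
    deriv (deriv φ) (a j) / (2 * deriv φ (a j))) / 4

theorem deriv_dslope_self {φ : ℂ → ℂ} {c : ℂ} (h : AnalyticAt ℂ φ c) :
    AnalyticAt ℂ (dslope φ c) c ∧ 2 * deriv (dslope φ c) c = deriv (deriv φ) c := by
  have han : AnalyticAt ℂ (dslope φ c) c := by
    obtain ⟨r, hr, hb⟩ := Metric.eventually_nhds_iff_ball.1 h.eventually_analyticAt
    exact ((differentiableOn_dslope (ball_mem_nhds c hr)).2 fun z hz =>
      (hb z hz).differentiableAt.differentiableWithinAt).analyticAt (ball_mem_nhds c hr)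
  refine ⟨han, ?_⟩
  have hφ : φ = fun z => φ c + (z - c) * dslope φ c z := by
    ext z
    have := sub_smul_dslope φ c z
    rw [smul_eq_mul] at this
    rw [this]; ring
  have h1 : deriv φ =ᶠ[𝓝 c] fun z => dslope φ c z + (z - c) * deriv (dslope φ c) z := by
    filter_upwards [han.eventually_analyticAt] with z hz
    have h2 := (((hasDerivAt_id' z).sub_const c).mul hz.differentiableAt.hasDerivAt).const_add (φ c)
    have h3 : HasDerivAt φ (1 * dslope φ c z + (z - c) * deriv (dslope φ c) z) z :=
      h2.congr_of_eventuallyEq (Eventually.of_forall fun t => congrFun hφ t)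
    rw [h3.deriv, one_mul]
  rw [h1.deriv_eq]
  have h2 := han.differentiableAt.hasDerivAt.add (((hasDerivAt_id' c).sub_const c).mul
    han.deriv.differentiableAt.hasDerivAt)
  have h3 := h2.deriv
  rw [show (fun z => dslope φ c z + (z - c) * deriv (dslope φ c) z) =
    dslope φ c + (fun z => z - c) * deriv (dslope φ c) from rfl, h3]
  ring

/-- The square of the observable times `z - a_j`. -/
def obsProd (φ : ℂ → ℂ) (a : Fin n → ℂ) (j : Fin n) (z : ℂ) : ℂ :=
  sourceProd (fun i => φ (a i)) j (φ z) * (deriv φ z / dslope φ (a j) z)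

section

variable {Ω : PlanarDomain} {φ : ℂ → ℂ} {a : Fin n → ℂ}

theorem IsConformalMap.norm_lt_one (hφ : IsConformalMap φ Ω.carrier unitDisc)
    (ha : a ∈ configSet Ω n) (k : Fin n) : ‖φ (a k)‖ < 1 :=
  mem_ball_zero_iff.1 (hφ.2.mapsTo (ha.2 k))

theorem IsConformalMap.injective_comp {V : Set ℂ} (hφ : IsConformalMap φ Ω.carrier V)
    (ha : a ∈ configSet Ω n) : Function.Injective fun k => φ (a k) :=
  fun i k h => ha.1 (hφ.2.injOn (ha.2 i) (ha.2 k) h)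

theorem IsConformalMap.analyticAt {V : Set ℂ} (hφ : IsConformalMap φ Ω.carrier V) {z : ℂ}
    (hz : z ∈ Ω.carrier) : AnalyticAt ℂ φ z :=
  hφ.1.analyticAt (Ω.isOpen.mem_nhds hz)

theorem IsConformalMap.dslope_ne_zero {V : Set ℂ} (hφ : IsConformalMap φ Ω.carrier V) {c z : ℂ}
    (hc : c ∈ Ω.carrier) (hz : z ∈ Ω.carrier) : dslope φ c z ≠ 0 := by
  by_cases h : z = c
  · rw [h, dslope_same]
    exact hφ.deriv_ne_zero Ω.isOpen hc
  · rw [dslope_of_ne _ h, slope_def_field]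
    exact div_ne_zero (sub_ne_zero.2 fun h2 => h (hφ.2.injOn hz hc h2)) (sub_ne_zero.2 h)

theorem obsProd_source (hφ : IsConformalMap φ Ω.carrier unitDisc) (ha : a ∈ configSet Ω n)
    (j : Fin n) : obsProd φ a j (a j) = 1 := by
  rw [obsProd, sourceProd_source (hφ.norm_lt_one ha) (hφ.injective_comp ha), dslope_same,
    div_self (hφ.deriv_ne_zero Ω.isOpen (ha.2 j)), one_mul]

/-- The slope of φ has derivative φ''/2 at the source, so φ' over the slope contributes φ''/φ' -
φ''/(2φ') = φ''/(2φ'). -/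
theorem hasDerivAt_obsProd (hφ : IsConformalMap φ Ω.carrier unitDisc) (ha : a ∈ configSet Ω n)
    (j : Fin n) : HasDerivAt (obsProd φ a j) (4 * obsCoeff φ a j) (a j) := by
  have han := hφ.analyticAt (ha.2 j)
  have h0 := hφ.deriv_ne_zero Ω.isOpen (ha.2 j)
  obtain ⟨hd, hd2⟩ := deriv_dslope_self han
  have h1 : HasDerivAt (fun z => sourceProd (fun i => φ (a i)) j (φ z)) _ (a j) :=
    HasDerivAt.comp (a j) (hasDerivAt_sourceProd (hφ.norm_lt_one ha) (hφ.injective_comp ha) j)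
      han.differentiableAt.hasDerivAt
  have h2 := han.deriv.differentiableAt.hasDerivAt.div hd.differentiableAt.hasDerivAt
    (hφ.dslope_ne_zero (ha.2 j) (ha.2 j))
  refine (h1.mul h2).congr_deriv ?_
  simp only [Pi.div_apply, dslope_same]
  rw [sourceProd_source (hφ.norm_lt_one ha) (hφ.injective_comp ha), div_self h0, ← hd2, obsCoeff,
    ← hd2]
  field_simp
  ring

theorem eventually_mem_doubleCover (ha : a ∈ configSet Ω n) {j : Fin n} {w : ℂ → ℂ}
    (hw : IsLocalSheet a j w) :
    ∀ᶠ ζ in 𝓝[≠] (0 : ℂ), (a j + ζ ^ 2, w ζ) ∈ doubleCover Ω.carrier a := by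
  have ht : Tendsto (fun ζ : ℂ => a j + ζ ^ 2) (𝓝[≠] 0) (𝓝[≠] (a j)) := by
    refine tendsto_nhdsWithin_iff.2 ⟨?_, ?_⟩
    · have : ContinuousAt (fun ζ : ℂ => a j + ζ ^ 2) 0 := by fun_prop
      simpa [ContinuousAt] using this.tendsto.mono_left (nhdsWithin_le_nhds (s := {0}ᶜ))
    · filter_upwards [self_mem_nhdsWithin] with ζ hζ
      simpa using hζ
  have hne : ∀ᶠ t in 𝓝[≠] (a j), ∀ k, t ≠ a k := by
    refine eventually_all.2 fun k => ?_
    by_cases hk : k = j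
    · subst hk; exact self_mem_nhdsWithin
    · exact nhdsWithin_le_nhds (isOpen_ne.mem_nhds (ha.1.ne (Ne.symm hk)))
  filter_upwards [ht.eventually hne, ht.eventually (nhdsWithin_le_nhds
    (Ω.isOpen.mem_nhds (ha.2 j))), hw.2.filter_mono nhdsWithin_le_nhds] with ζ h1 h2 h3
  exact ⟨h2, h1, h3⟩

/-- The observable is determined up to sign. -/
theorem IsObservable.exists_sq_eq (ha : a ∈ configSet Ω n) {j : Fin n} {F : ℂ × ℂ → ℂ}
    (hF : IsObservable Ω a j F) : ∃ φ, IsConformalMap φ Ω.carrier unitDisc ∧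
      ∀ p ∈ doubleCover Ω.carrier a, F p ^ 2 * (p.1 - a j) = obsProd φ a j p.1 := by
  obtain ⟨φ, q, s, G, hφ, -, hs, -, hq, hG, hF⟩ := hF
  refine ⟨φ, hφ, fun p hp => ?_⟩
  have hb : ∀ k, φ p.1 ≠ φ (a k) := fun k h => hp.2.1 k (hφ.2.injOn hp.1 (ha.2 k) h)
  have hmem : (φ p.1, p.2 * q p.1) ∈ doubleCover unitDisc (fun i => φ (a i)) :=
    ⟨hφ.2.mapsTo hp.1, hb, by rw [mul_pow, hp.2.2, hq _ hp.1]⟩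
  rw [hF p hp, mul_pow, hG.sq_eq (hφ.norm_lt_one ha) (hφ.injective_comp ha) hmem, hs _ hp.1,
    obsProd, sourceProd, dslope_of_ne _ (hp.2.1 j), slope_def_field,
    coverPoly_eq_mul_prod_erase _ j]
  have h1 : φ p.1 - φ (a j) ≠ 0 := sub_ne_zero.2 (hb j)
  have h2 : ∏ k ∈ Finset.univ.erase j, (φ p.1 - φ (a k)) ≠ 0 :=
    Finset.prod_ne_zero_iff.2 fun k _ => sub_ne_zero.2 (hb k)
  have h3 : p.1 - a j ≠ 0 := sub_ne_zero.2 (hp.2.1 j)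
  field_simp

/-- Squaring the expansion gives F² ζ² = 1 + 4A ζ² + o(ζ²), whose difference quotient in ζ² is that
of `obsProd`. -/
theorem IsCoeffA.exists_eq_obsCoeff (ha : a ∈ configSet Ω n) {j : Fin n} {A : ℂ}
    (hA : IsCoeffA Ω a j A) :
    ∃ φ, IsConformalMap φ Ω.carrier unitDisc ∧ A = obsCoeff φ a j := by
  obtain ⟨F, hF, w, hw, hO⟩ := hA
  obtain ⟨φ, hφ, hsq⟩ := hF.exists_sq_eq ha
  refine ⟨φ, hφ, ?_⟩
  set E : ℂ → ℂ := fun ζ => F (a j + ζ ^ 2, w ζ) - (1 / ζ + 2 * A * ζ) with hE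
  have hid : Tendsto (fun ζ : ℂ => ζ) (𝓝[≠] 0) (𝓝 0) := tendsto_id.mono_left nhdsWithin_le_nhds
  have hE1 : Tendsto (fun ζ => E ζ / ζ) (𝓝[≠] 0) (𝓝 0) := by
    have h1 : (fun ζ : ℂ => ζ ^ 3) =o[𝓝[≠] 0] (fun ζ : ℂ => ζ ^ 1) :=
      (isLittleO_pow_pow (by norm_num)).mono nhdsWithin_le_nhds
    simpa using (hO.trans_isLittleO h1).tendsto_div_nhds_zero
  have hE0 : Tendsto E (𝓝[≠] 0) (𝓝 0) := by
    have h1 := hE1.mul hid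
    rw [zero_mul] at h1
    refine h1.congr' ?_
    filter_upwards [self_mem_nhdsWithin] with ζ hζ
    exact div_mul_cancel₀ _ hζ
  have ht : Tendsto (fun ζ : ℂ => a j + ζ ^ 2) (𝓝[≠] 0) (𝓝[≠] (a j)) := by
    refine tendsto_nhdsWithin_iff.2 ⟨?_, ?_⟩
    · simpa using (hid.pow 2).const_add (a j)
    · filter_upwards [self_mem_nhdsWithin] with ζ hζ
      simpa using hζ
  have hlim1 := (hasDerivAt_iff_tendsto_slope.1 (hasDerivAt_obsProd hφ ha j)).comp ht
  have hlim2 : Tendsto (fun ζ => 4 * A + 4 * A ^ 2 * ζ ^ 2 + 2 * (E ζ / ζ) * (1 + 2 * A * ζ ^ 2) +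
      E ζ ^ 2) (𝓝[≠] 0) (𝓝 (4 * A)) := by
    have h2 := (((hid.pow 2).const_mul (4 * A ^ 2)).const_add (4 * A)).add
      ((hE1.const_mul 2).mul (((hid.pow 2).const_mul (2 * A)).const_add 1))
    simpa using h2.add (hE0.pow 2)
  have h4 : (4 : ℂ) * obsCoeff φ a j = 4 * A := by
    refine tendsto_nhds_unique hlim1 (hlim2.congr' ?_)
    filter_upwards [eventually_mem_doubleCover ha hw, self_mem_nhdsWithin] with ζ h1 h2
    have h2 : ζ ≠ 0 := h2
    have h3 := hsq _ h1
    simp only [add_sub_cancel_left] at h3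
    rw [Function.comp_apply, slope_def_field, obsProd_source hφ ha, ← h3, add_sub_cancel_left]
    have h5 : F (a j + ζ ^ 2, w ζ) = E ζ + (1 / ζ + 2 * A * ζ) := by rw [hE]; ring
    rw [h5]
    field_simp
    ring
  linear_combination -h4 / 4

theorem isBigO_sub_sub_deriv_mul {e : ℂ → ℂ} (he : AnalyticAt ℂ e 0) :
    (fun t => e t - e 0 - deriv e 0 * t) =O[𝓝 0] fun t => t ^ 2 := by
  obtain ⟨hd, -⟩ := deriv_dslope_self he
  have h1 := (hd.differentiableAt.isBigO_sub).mul (isBigO_refl (fun t : ℂ => t) (𝓝 0))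
  refine (h1.congr' (Eventually.of_forall fun t => ?_) (Eventually.of_forall fun t => ?_))
  · have := sub_smul_dslope e 0 t
    simp only [smul_eq_mul, sub_zero] at this
    simp only [dslope_same]
    linear_combination this
  · simp only [sub_zero]; ring

theorem exists_isCoeffA (ha : a ∈ configSet Ω n) (j : Fin n) : ∃ A, IsCoeffA Ω a j A := by
  obtain ⟨φ, hφ⟩ := Ω.exists_conformalMap
  obtain ⟨s, hs, hs2⟩ := exists_differentiableOn_sq_eq Ω.isOpen Ω.simplyConnected
    (hφ.1.deriv Ω.isOpen) (fun z hz => hφ.deriv_ne_zero Ω.isOpen hz)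
  obtain ⟨q, hq, hq2⟩ := exists_differentiableOn_sq_eq Ω.isOpen Ω.simplyConnected
    (g := fun z => ∏ i, dslope φ (a i) z)
    (DifferentiableOn.fun_finsetProd fun i _ =>
      (differentiableOn_dslope (Ω.isOpen.mem_nhds (ha.2 i))).2 hφ.1)
    (fun z hz => Finset.prod_ne_zero_iff.2 fun i _ => hφ.dslope_ne_zero (ha.2 i) hz)
  set b : Fin n → ℂ := fun i => φ (a i) with hb
  have hb1 : ∀ k, ‖b k‖ < 1 := hφ.norm_lt_one ha
  have hbinj : Function.Injective b := hφ.injective_comp ha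
  set F : ℂ × ℂ → ℂ := fun p => discSolution b j (φ p.1, p.2 * q p.1) * s p.1 with hF
  have hobs : IsObservable Ω a j F := by
    refine ⟨φ, q, s, discSolution b j, hφ, hs, hs2, hq, fun z hz => ?_,
      solvesBVP_discSolution hb1 hbinj j, fun p _ => rfl⟩
    rw [hq2 z hz, coverPoly, coverPoly, ← Finset.prod_mul_distrib]
    refine Finset.prod_congr rfl fun i _ => ?_
    rw [← smul_eq_mul, sub_smul_dslope]
  obtain ⟨v, hv, hv2, hsheet⟩ := exists_localSheet ha.1 j
  have hv0 : v 0 ^ 2 = ∏ k ∈ Finset.univ.erase j, (a j - a k) := by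
    simpa using hv2.self_of_nhds
  have hP0 := prod_erase_sub_ne_zero ha.1 j
  have hv00 : v 0 ≠ 0 := by
    intro h; rw [h] at hv0; exact hP0 (hv0.symm.trans (by simp))
  have hq0 : q (a j) ≠ 0 := by
    intro h
    have h1 := hq2 _ (ha.2 j)
    rw [h] at h1
    exact Finset.prod_ne_zero_iff.2 (fun i _ => hφ.dslope_ne_zero (ha.2 i) (ha.2 j))
      (h1.symm.trans (by simp))
  -- This is ζ times the spinor, as an analytic function of t = ζ². Its value at 0 is ±1, to be
  -- fixed by the choice of sheet; its Taylor remainder O(t²), divided by ζ, is O(ζ³).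
  set e : ℂ → ℂ := fun t => discMain b j (φ (a j + t)) * s (a j + t) / (v t * q (a j + t)) with he
  have htr : ∀ {f : ℂ → ℂ}, AnalyticAt ℂ f (a j) → AnalyticAt ℂ (fun t => f (a j + t)) 0 :=
    fun hf => AnalyticAt.fun_comp_of_eq hf (by fun_prop) (by simp)
  have hM : AnalyticAt ℂ (discMain b j) (b j) := by
    have : DifferentiableOn ℂ (discMain b j) (ball 0 1) := fun z hz =>
      (differentiableAt_discMain hb1 j (mem_ball_zero_iff.1 hz).le).differentiableWithinAt
    exact this.analyticAt (isOpen_ball.mem_nhds (mem_ball_zero_iff.2 (hb1 j)))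
  have hean : AnalyticAt ℂ e 0 := by
    refine AnalyticAt.div (AnalyticAt.mul ?_ (htr (hs.analyticAt (Ω.isOpen.mem_nhds (ha.2 j)))))
      (hv.mul (htr (hq.analyticAt (Ω.isOpen.mem_nhds (ha.2 j))))) (by simpa using ⟨hv00, hq0⟩)
    exact htr (f := fun z => discMain b j (φ z)) (AnalyticAt.fun_comp (g := discMain b j) (f := φ) hM (hφ.analyticAt (ha.2 j)))
  have he0 : e 0 ^ 2 = 1 := by
    have h1 : q (a j) ^ 2 * v 0 ^ 2 =
        deriv φ (a j) * ∏ k ∈ Finset.univ.erase j, (b j - b k) := by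
      rw [hq2 _ (ha.2 j), hv0, ← Finset.mul_prod_erase _ _ (Finset.mem_univ j), dslope_same,
        mul_assoc, ← Finset.prod_mul_distrib]
      congr 1
      refine Finset.prod_congr rfl fun i _ => ?_
      rw [mul_comm, ← smul_eq_mul, sub_smul_dslope]
    have hd := hφ.deriv_ne_zero Ω.isOpen (ha.2 j)
    have hP := prod_erase_sub_ne_zero hbinj j
    simp only [he, add_zero]
    rw [div_pow, mul_pow, mul_pow, hs2 _ (ha.2 j), show φ (a j) = b j from rfl,
      discMain_sq_source hb1 hbinj, mul_comm (v 0 ^ 2), h1, mul_comm, div_self (mul_ne_zero hd hP)]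
  have hO : (fun ζ : ℂ => e (ζ ^ 2) - e 0 - deriv e 0 * ζ ^ 2) =O[𝓝[≠] 0] fun ζ => ζ ^ 4 := by
    have ht : Tendsto (fun ζ : ℂ => ζ ^ 2) (𝓝[≠] 0) (𝓝 0) := by
      have : ContinuousAt (fun ζ : ℂ => ζ ^ 2) 0 := by fun_prop
      simpa [ContinuousAt] using this.tendsto.mono_left (nhdsWithin_le_nhds (s := {0}ᶜ))
    have := (isBigO_sub_sub_deriv_mul hean).comp_tendsto ht
    refine this.congr (fun _ => rfl) fun ζ => ?_
    simp only [Function.comp_apply]; ring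
  have hfin : ∀ ε : ℂ, ε * e 0 = 1 → ∀ w, IsLocalSheet a j w →
      (∀ ζ, F (a j + ζ ^ 2, w ζ) = ε * (e (ζ ^ 2) / ζ)) → ∃ A, IsCoeffA Ω a j A := by
    intro ε hε w hw hFw
    refine ⟨ε * deriv e 0 / 2, F, hobs, w, hw, ?_⟩
    have h1 := (hO.const_mul_left ε).mul (isBigO_refl (fun ζ : ℂ => ζ⁻¹) (𝓝[≠] 0))
    refine h1.congr' ?_ ?_
    · filter_upwards [self_mem_nhdsWithin] with ζ hζ
      have hζ : ζ ≠ 0 := hζ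
      rw [hFw]
      field_simp
      linear_combination -hε
    · filter_upwards [self_mem_nhdsWithin] with ζ hζ
      have hζ : ζ ≠ 0 := hζ
      field_simp
  have hFv : ∀ ζ, F (a j + ζ ^ 2, ζ * v (ζ ^ 2)) = e (ζ ^ 2) / ζ := by
    intro ζ
    simp only [hF, he, discSolution]
    rw [div_mul_eq_mul_div, div_div]
    congr 1
    ring
  rcases sq_eq_sq_iff_eq_or_eq_neg.1 (he0.trans (one_pow 2).symm) with h | h
  · exact hfin 1 (by rw [h, one_mul]) _ hsheet fun ζ => by rw [hFv, one_mul]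
  · refine hfin (-1) (by rw [h]; ring) _ hsheet.neg fun ζ => ?_
    rw [← hFv]
    simp only [hF, discSolution, neg_mul, div_neg, one_mul]

end

end

section

open Metric Set Complex ComplexConjugate

variable {n : ℕ}

/-! ### The logarithm of the correlation function -/

/-- The real linear form `v ↦ ∑ Re (A_j v_j)`. -/
def reForm (A : Fin n → ℂ) : (Fin n → ℂ) →L[ℝ] ℝ :=
  ∑ j, reCLM ∘L (A j • ContinuousLinearMap.proj (R := ℝ) (φ := fun _ : Fin n => ℂ) j)

theorem reForm_apply (A v : Fin n → ℂ) : reForm A v = ∑ j, (A j * v j).re := by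
  simp [reForm]

theorem reForm_injective : Function.Injective (reForm (n := n)) := by
  intro A B h
  ext j
  have h1 : ∀ c : ℂ, (A j * c).re = (B j * c).re := by
    intro c
    have h2 := DFunLike.congr_fun h (Pi.single j c)
    rw [reForm_apply, reForm_apply, Finset.sum_eq_single j, Finset.sum_eq_single j] at h2
    · simpa using h2
    all_goals simp +contextual
  have h2 := h1 1
  have h3 := h1 I
  apply Complex.ext
  · simpa using h2
  · simpa using h3

theorem HasFDerivAt.log_norm {E : Type*} [NormedAddCommGroup E] [NormedSpace ℝ E] {f : E → ℂ}
    {f' : E →L[ℝ] ℂ} {x : E} (hf : HasFDerivAt f f' x) (h0 : f x ≠ 0) :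
    HasFDerivAt (fun y => Real.log ‖f y‖) (reCLM ∘L ((f x)⁻¹ • f')) x := by
  have hn : ‖f x‖ ^ 2 ≠ 0 := pow_ne_zero 2 (norm_ne_zero_iff.2 h0)
  have h1 := (hf.norm_sq.log hn).const_mul (1 / 2)
  have h2 : (fun y => Real.log ‖f y‖) = fun y => 1 / 2 * Real.log (‖f y‖ ^ 2) := by
    ext y
    rw [Real.log_pow]; push_cast; ring
  rw [h2]
  refine h1.congr_fderiv ?_
  ext v
  have h3 : (f x)⁻¹ = ((‖f x‖ ^ 2)⁻¹ : ℝ) * conj (f x) := by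
    rw [Complex.inv_def, normSq_eq_norm_sq, mul_comm]
  simp only [ContinuousLinearMap.comp_apply, smul_apply, smul_eq_mul, h3,
    reCLM_apply, mul_assoc, re_ofReal_mul]
  simp [innerSL_apply_apply, Complex.inner, mul_comm]
  ring

/-- The derivative of `log r_{km}` with respect to the point `b_k`. -/
def hypCoeff (b : Fin n → ℂ) (k m : Fin n) : ℂ :=
  1 / (b k - b m) + conj (b m) / (1 - conj (b m) * b k)

/-- The dependence on b_m is antiholomorphic and is rewritten by Re w = Re (conj w). The indices may
coincide, which covers log(1 - |b_j|²). -/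
theorem hasFDerivAt_log_norm_one_sub {b : Fin n → ℂ} (hb : ∀ k, ‖b k‖ < 1) (k m : Fin n) :
    ∃ ℓ : (Fin n → ℂ) →L[ℝ] ℝ,
      HasFDerivAt (fun b : Fin n → ℂ => Real.log ‖1 - conj (b m) * b k‖) ℓ b ∧
      ∀ u, ℓ u = -(conj (b m) / (1 - conj (b m) * b k) * u k).re -
        (conj (b k) / (1 - conj (b k) * b m) * u m).re := by
  have hp : ∀ i, HasFDerivAt (fun b : Fin n → ℂ => b i)
    (ContinuousLinearMap.proj (R := ℝ) (φ := fun _ : Fin n => ℂ) i) b := fun i =>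
      hasFDerivAt_apply i b
  have h1 : HasFDerivAt (fun b : Fin n → ℂ => conj (b m)) _ b :=
    (conjCLE : ℂ →L[ℝ] ℂ).hasFDerivAt.comp b (hp m)
  have hD := one_sub_conj_mul_ne_zero (hb m) (hb k).le
  have h2 : HasFDerivAt (fun b : Fin n → ℂ => Real.log ‖1 - conj (b m) * b k‖)
      (reCLM ∘L ((1 - conj (b m) * b k)⁻¹ • -_)) b :=
    HasFDerivAt.log_norm ((h1.mul (hp k)).const_sub 1) hD
  refine ⟨_, h2, fun u => ?_⟩
  have h3 : (conj (b k) / (1 - conj (b k) * b m) * u m).re =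
      (b k / (1 - conj (b m) * b k) * conj (u m)).re := by
    rw [← conj_re]
    simp [mul_comm]
  rw [h3]
  simp only [ContinuousLinearMap.comp_apply, smul_apply, smul_eq_mul,
    reCLM_apply, add_apply, neg_apply,
    ContinuousLinearMap.proj_apply, ContinuousLinearEquiv.coe_coe, conjCLE_apply]
  rw [← neg_re, ← sub_re]
  congr 1
  field_simp
  ring

theorem logHyp_self (b : Fin n → ℂ) (k : Fin n) : logHyp b k k = 0 := by
  simp [logHyp, pseudoHyp, discAut_self]

theorem hasFDerivAt_logHyp {b : Fin n → ℂ} (hb : ∀ k, ‖b k‖ < 1) (hinj : Function.Injective b)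
    (k m : Fin n) : ∃ ℓ : (Fin n → ℂ) →L[ℝ] ℝ, HasFDerivAt (fun b => logHyp b k m) ℓ b ∧
      ∀ u, ℓ u = if k = m then 0 else (hypCoeff b k m * u k).re + (hypCoeff b m k * u m).re := by
  by_cases hkm : k = m
  · subst hkm
    refine ⟨0, ?_, fun u => by simp⟩
    simp only [logHyp_self]
    exact hasFDerivAt_const _ _
  obtain ⟨ℓ, h1, h2⟩ := hasFDerivAt_log_norm_one_sub hb k m
  have hs : b k - b m ≠ 0 := sub_ne_zero.2 (hinj.ne hkm)
  have h3 : HasFDerivAt (fun b : Fin n → ℂ => Real.log ‖b k - b m‖)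
      (reCLM ∘L ((b k - b m)⁻¹ • (_ - _))) b :=
    HasFDerivAt.log_norm ((hasFDerivAt_apply (𝕜 := ℝ) k b).sub (hasFDerivAt_apply m b)) hs
  refine ⟨_, (h3.sub h1).congr_of_eventuallyEq ?_, fun u => ?_⟩
  · have e1 : ∀ᶠ b' in 𝓝 b, b' k - b' m ≠ 0 :=
      ContinuousAt.eventually_ne (g := fun b' : Fin n → ℂ => b' k - b' m) (by fun_prop) hs
    have e2 : ∀ᶠ b' in 𝓝 b, 1 - conj (b' m) * b' k ≠ 0 :=
      ContinuousAt.eventually_ne (g := fun b' : Fin n → ℂ => 1 - conj (b' m) * b' k)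
        (by fun_prop) (one_sub_conj_mul_ne_zero (hb m) (hb k).le)
    filter_upwards [e1, e2] with b' h4 h5
    rw [logHyp, pseudoHyp, discAut, norm_div, Real.log_div (norm_ne_zero_iff.2 h4)
      (norm_ne_zero_iff.2 h5)]
    rfl
  · rw [if_neg hkm, sub_apply, h2]
    simp only [ContinuousLinearMap.comp_apply, smul_apply, smul_eq_mul,
      reCLM_apply, sub_apply, ContinuousLinearMap.proj_apply, hypCoeff]
    have h6 : (b k - b m)⁻¹ * (u k - u m) = 1 / (b k - b m) * u k + 1 / (b m - b k) * u m := by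
      rw [← neg_sub (b k) (b m)]
      field_simp
      ring
    rw [h6, add_re, add_mul, add_mul, add_re, add_re]
    ring

theorem spinCorr_comm (L : Fin n → Fin n → ℝ) (k m : Fin n) : spinCorr L k m = spinCorr L m k := by
  rw [spinCorr, spinCorr]
  congr 1
  exact Finset.sum_congr rfl fun μ _ => by rw [mul_comm (spin (μ k))]

/-- The logarithm of the correlation function of the unit disc. -/
def discLogCorr (b : Fin n → ℂ) : ℝ :=
  1 / 2 * Real.log (spinPartition (logHyp b)) - 1 / 8 * ∑ j, Real.log (1 - ‖b j‖ ^ 2) -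
    n / 4 * Real.log 2

/-- The derivative of log Z is the Gibbs mean of that of the exponent. Each pair contributes through
both of its points, and by symmetry this turns the factor 1/4 into 1/2. -/
theorem hasFDerivAt_log_spinPartition {b : Fin n → ℂ} (hb : ∀ k, ‖b k‖ < 1)
    (hinj : Function.Injective b) : ∃ ℓ : (Fin n → ℂ) →L[ℝ] ℝ,
      HasFDerivAt (fun b => Real.log (spinPartition (logHyp b))) ℓ b ∧
      ∀ u, ℓ u = 1 / 2 * ∑ k, ∑ m ∈ Finset.univ.erase k,
        (spinCorr (logHyp b) k m * hypCoeff b k m * u k).re := by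
  choose ℓ h1 h2 using fun k m => hasFDerivAt_logHyp hb hinj k m
  have hw : ∀ μ : Fin n → Bool, HasFDerivAt (fun b => spinWeight (logHyp b) μ)
      (spinWeight (logHyp b) μ • ((1 / 4 : ℝ) • ∑ k, ∑ m, (spin (μ k) * spin (μ m)) • ℓ k m)) b := by
    intro μ
    unfold spinWeight
    have h3 : HasFDerivAt (fun b : Fin n → ℂ => ∑ k, ∑ m, spin (μ k) * spin (μ m) * logHyp b k m)
        (∑ k, ∑ m, (spin (μ k) * spin (μ m)) • ℓ k m) b :=
      HasFDerivAt.fun_sum fun k _ => HasFDerivAt.fun_sum fun m _ => (h1 k m).const_mul _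
    exact (h3.const_mul (1 / 4)).exp
  have hZ : HasFDerivAt (fun b => spinPartition (logHyp b)) (∑ μ, spinWeight (logHyp b) μ •
      ((1 / 4 : ℝ) • ∑ k, ∑ m, (spin (μ k) * spin (μ m)) • ℓ k m)) b := by
    unfold spinPartition
    exact HasFDerivAt.fun_sum fun μ _ => hw μ
  have hZ0 := (spinPartition_pos (logHyp b)).ne'
  refine ⟨_, hZ.log hZ0, fun u => ?_⟩
  simp only [smul_apply, sum_apply, smul_eq_mul]
  set x : Fin n → Fin n → ℝ := fun k m => (hypCoeff b k m * u k).re with hx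
  set C := spinCorr (logHyp b) with hC
  have e1 : (spinPartition (logHyp b))⁻¹ * ∑ μ, spinWeight (logHyp b) μ *
      (1 / 4 * ∑ k, ∑ m, spin (μ k) * spin (μ m) * ℓ k m u) =
      1 / 4 * ∑ k, ∑ m, C k m * ℓ k m u := by
    have e2 : ∀ k m, C k m * ℓ k m u = (spinPartition (logHyp b))⁻¹ *
        ∑ μ, spinWeight (logHyp b) μ * (spin (μ k) * spin (μ m) * ℓ k m u) := by
      intro k m
      rw [hC, spinCorr, div_eq_inv_mul, mul_assoc, Finset.sum_mul]
      simp only [mul_assoc]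
    simp only [e2]
    simp only [← Finset.mul_sum]
    rw [mul_left_comm]
    congr 1
    have e3 : ∑ k, ∑ m, ∑ μ, spinWeight (logHyp b) μ * (spin (μ k) * spin (μ m) * ℓ k m u) =
        ∑ μ, ∑ k, ∑ m, spinWeight (logHyp b) μ * (spin (μ k) * spin (μ m) * ℓ k m u) := by
      rw [Finset.sum_comm]
      conv_rhs => rw [Finset.sum_comm]
      rw [Finset.sum_comm]
      refine Finset.sum_congr rfl fun k _ => ?_
      rw [Finset.sum_comm]
    rw [e3, Finset.mul_sum]
    refine Finset.sum_congr rfl fun μ _ => ?_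
    simp only [← Finset.mul_sum]
    ring
  rw [e1]
  have e4 : ∀ k m, C k m * ℓ k m u =
      (if k = m then 0 else C k m * x k m) + if m = k then 0 else C m k * x m k := by
    intro k m
    rw [h2]
    by_cases h : k = m
    · simp [h]
    · rw [if_neg h, if_neg h, if_neg (Ne.symm h), hC, spinCorr_comm _ m k, mul_add]
  simp only [e4, Finset.sum_add_distrib]
  rw [Finset.sum_comm (f := fun k m => if m = k then 0 else C m k * x m k), ← two_mul, ← mul_assoc,
    show (1 / 4 * 2 : ℝ) = 1 / 2 by norm_num]
  congr 1
  refine Finset.sum_congr rfl fun k _ => ?_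
  rw [← Finset.sum_erase_add _ _ (Finset.mem_univ k), if_pos rfl, add_zero]
  refine Finset.sum_congr rfl fun m hm => ?_
  rw [if_neg (Finset.ne_of_mem_erase hm).symm, mul_assoc, re_ofReal_mul]

theorem hasFDerivAt_discLogCorr {b : Fin n → ℂ} (hb : ∀ k, ‖b k‖ < 1)
    (hinj : Function.Injective b) :
    HasFDerivAt discLogCorr (reForm fun j => discCoeff b j / 4) b := by
  obtain ⟨ℓ, h1, h2⟩ := hasFDerivAt_log_spinPartition hb hinj
  choose ℓ' h3 h4 using fun j => hasFDerivAt_log_norm_one_sub hb j j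
  have h5 := ((h1.const_mul (1 / 2)).sub
    ((HasFDerivAt.fun_sum fun j (_ : j ∈ Finset.univ) => h3 j).const_mul (1 / 8))).sub_const
      (n / 4 * Real.log 2)
  have h6 : discLogCorr = fun b : Fin n → ℂ => 1 / 2 * Real.log (spinPartition (logHyp b)) -
      1 / 8 * ∑ j, Real.log ‖1 - conj (b j) * b j‖ - n / 4 * Real.log 2 := by
    ext b
    have h7 : ∀ z : ℂ, Real.log ‖1 - conj z * z‖ = Real.log (1 - ‖z‖ ^ 2) := by
      intro z
      rw [mul_comm, mul_conj, normSq_eq_norm_sq, ← ofReal_one, ← ofReal_sub, norm_real,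
        Real.norm_eq_abs, Real.log_abs]
    simp only [h7, discLogCorr]
  rw [h6]
  refine h5.congr_fderiv ?_
  ext u
  simp only [sub_apply, smul_apply,
    sum_apply, smul_eq_mul, h2, h4, reForm_apply]
  rw [← mul_assoc, Finset.mul_sum, Finset.mul_sum, ← Finset.sum_sub_distrib]
  refine Finset.sum_congr rfl fun j _ => ?_
  have h8 : discCoeff b j / 4 * u j = (1 / 4 : ℝ) * (conj (b j) / (1 - conj (b j) * b j) * u j +
      ∑ m ∈ Finset.univ.erase j, spinCorr (logHyp b) j m * hypCoeff b j m * u j) := by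
    rw [discCoeff, ← Finset.sum_mul]
    simp only [hypCoeff]
    push_cast
    ring
  rw [h8, re_ofReal_mul, add_re, re_sum]
  ring

/-- The logarithm of the correlation function of a domain, in terms of a conformal map onto the
unit disc. -/
def logCorr (φ : ℂ → ℂ) (a : Fin n → ℂ) : ℝ :=
  discLogCorr (fun j => φ (a j)) + 1 / 8 * ∑ j, Real.log ‖deriv φ (a j)‖

theorem hasFDerivAt_logCorr {Ω : PlanarDomain} {φ : ℂ → ℂ} {a : Fin n → ℂ}
    (hφ : IsConformalMap φ Ω.carrier unitDisc) (ha : a ∈ configSet Ω n) :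
    HasFDerivAt (logCorr φ) (reForm (obsCoeff φ a)) a := by
  have hcomp : ∀ {f : ℂ → ℂ} (j : Fin n), AnalyticAt ℂ f (a j) →
      HasFDerivAt (fun a : Fin n → ℂ => f (a j)) (deriv f (a j) •
        ContinuousLinearMap.proj (R := ℝ) (φ := fun _ : Fin n => ℂ) j) a := by
    intro f j hf
    have h1 := (hf.differentiableAt.hasDerivAt.hasFDerivAt.restrictScalars ℝ).comp a
      (hasFDerivAt_apply (𝕜 := ℝ) j a)
    refine h1.congr_fderiv ?_
    ext v
    simp [mul_comm]
  have h1 : HasFDerivAt (fun a : Fin n → ℂ => fun j => φ (a j)) _ a :=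
    hasFDerivAt_pi.2 fun j => hcomp j (hφ.analyticAt (ha.2 j))
  have h2 := (hasFDerivAt_discLogCorr (hφ.norm_lt_one ha) (hφ.injective_comp ha)).comp a h1
  have h3 : ∀ j, HasFDerivAt (fun a : Fin n → ℂ => Real.log ‖deriv φ (a j)‖) _ a := fun j =>
    HasFDerivAt.log_norm (hcomp j (hφ.analyticAt (ha.2 j)).deriv)
      (hφ.deriv_ne_zero Ω.isOpen (ha.2 j))
  have h4 := h2.add ((HasFDerivAt.fun_sum fun j (_ : j ∈ Finset.univ) => h3 j).const_mul (1 / 8))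
  refine h4.congr_fderiv ?_
  ext v
  simp only [add_apply, ContinuousLinearMap.comp_apply, reForm_apply,
    smul_apply, sum_apply, smul_eq_mul, reCLM_apply,
    ContinuousLinearMap.coe_pi', ContinuousLinearMap.proj_apply]
  rw [Finset.mul_sum, ← Finset.sum_add_distrib]
  refine Finset.sum_congr rfl fun j _ => ?_
  have h0 := hφ.deriv_ne_zero Ω.isOpen (ha.2 j)
  rw [← re_ofReal_mul, ← add_re, obsCoeff]
  congr 1
  push_cast
  field_simp
  ring

end

section

open Metric Set Complex ComplexConjugate

variable {n : ℕ}

/-! ### The space of configurations -/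

theorem isOpen_configSet (Ω : PlanarDomain) (n : ℕ) : IsOpen (configSet Ω n) := by
  have h1 : configSet Ω n = (⋂ i, ⋂ j, {a : Fin n → ℂ | a i = a j → i = j}) ∩
      ⋂ j, {a | a j ∈ Ω.carrier} := by
    ext a
    simp only [configSet, Function.Injective, mem_ofPred_eq, mem_inter_iff, mem_iInter]
  rw [h1]
  refine IsOpen.inter (isOpen_iInter_of_finite fun i => isOpen_iInter_of_finite fun j => ?_)
    (isOpen_iInter_of_finite fun j => Ω.isOpen.preimage (continuous_apply j))
  by_cases h : i = j
  · simp [h]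
  · simp only [h, imp_false]
    exact isOpen_ne_fun (continuous_apply i) (continuous_apply j)

/-- On the complex line joining two injective tuples, two given coordinates collide for at most one
parameter; ℂ without finitely many points is connected. -/
theorem isPreconnected_injective (n : ℕ) :
    IsPreconnected {a : Fin n → ℂ | Function.Injective a} := by
  refine isPreconnected_of_forall_pair fun a ha b hb => ?_
  set B : Set ℂ := {t | ¬ Function.Injective (fun i => a i + t * (b i - a i))} with hB
  have hfin : B.Finite := by
    have h1 : B ⊆ ⋃ p : Fin n × Fin n, {t | p.1 ≠ p.2 ∧
        a p.1 - a p.2 + t * ((b p.1 - a p.1) - (b p.2 - a p.2)) = 0} := by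
      intro t ht
      simp only [hB, mem_ofPred_eq, Function.Injective] at ht
      push Not at ht
      obtain ⟨i, j, h2, h3⟩ := ht
      exact mem_iUnion.2 ⟨(i, j), h3, by linear_combination h2⟩
    refine (finite_iUnion fun p => ?_).subset h1
    refine Set.Subsingleton.finite ?_
    rintro s ⟨hp, hs⟩ t ⟨-, ht⟩
    have h2 : (s - t) * ((b p.1 - a p.1) - (b p.2 - a p.2)) = 0 := by linear_combination hs - ht
    rcases mul_eq_zero.1 h2 with h3 | h3
    · exact sub_eq_zero.1 h3
    · rw [h3, mul_zero, add_zero] at hs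
      exact absurd (ha (sub_eq_zero.1 hs)) hp
  have hrank : 1 < Module.rank ℝ ℂ := by
    rw [Complex.rank_real_complex]; exact Nat.one_lt_ofNat
  have hconn := (hfin.countable.isConnected_compl_of_one_lt_rank hrank).isPreconnected
  have h0 : (0 : ℂ) ∈ Bᶜ := by simpa [hB] using ha
  have h1 : (1 : ℂ) ∈ Bᶜ := by simpa [hB] using hb
  refine ⟨(fun t : ℂ => fun i => a i + t * (b i - a i)) '' Bᶜ, ?_, ⟨0, h0, by simp⟩,
    ⟨1, h1, by simp⟩, hconn.image _ (by fun_prop)⟩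
  rintro _ ⟨t, ht, rfl⟩
  simpa [hB] using ht

/-- By the Riemann map and a homeomorphism of ℂ with the disc, this reduces to tuples in ℂ. -/
theorem isPreconnected_configSet (Ω : PlanarDomain) (n : ℕ) :
    IsPreconnected (configSet Ω n) := by
  obtain ⟨φ, hφ⟩ := Ω.exists_conformalMap
  obtain ⟨g, hg, hgφ, -⟩ := hφ.exists_inverse Ω.isOpen
  set u : ℂ ≃ₜ ball (0 : ℂ) 1 := Homeomorph.unitBall with hu
  have hc : Continuous fun z => g (u z) :=
    hg.1.continuousOn.comp_continuous (continuous_subtype_val.comp u.continuous) fun z => (u z).2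
  have hinj : Function.Injective fun z => g (u z) := fun z w h =>
    u.injective (Subtype.ext (hg.2.injOn (u z).2 (u w).2 h))
  have himg : configSet Ω n = (fun a : Fin n → ℂ => fun i => g (u (a i))) ''
      {a | Function.Injective a} := by
    ext a
    constructor
    · intro ha
      have h1 : ∀ i, φ (a i) ∈ ball (0 : ℂ) 1 := fun i => hφ.2.mapsTo (ha.2 i)
      have h2 : ∀ i, g (u (u.symm ⟨φ (a i), h1 i⟩)) = a i := fun i => by
        rw [u.apply_symm_apply]; exact hgφ (ha.2 i)
      refine ⟨fun i => u.symm ⟨φ (a i), h1 i⟩, fun i j h => ha.1 ?_, funext h2⟩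
      rw [← h2 i, ← h2 j]
      exact congrArg (fun z => g (u z)) h
    · rintro ⟨b, hb, rfl⟩
      exact ⟨hinj.comp hb, fun j => hg.2.mapsTo (u (b j)).2⟩
  rw [himg]
  exact (isPreconnected_injective n).image _
    (continuous_pi fun i => hc.comp (continuous_apply i)).continuousOn

/-! ### Independence of the conformal map -/

/-- Z is a function of invariant distances only, and 1 - |b|² is multiplied by |ψ'|. -/
theorem discLogCorr_conformal {ψ : ℂ → ℂ} (hψ : IsConformalMap ψ unitDisc unitDisc)
    {b : Fin n → ℂ} (hb : ∀ k, b k ∈ unitDisc) :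
    discLogCorr (fun j => ψ (b j)) = discLogCorr b - 1 / 8 * ∑ j, Real.log ‖deriv ψ (b j)‖ := by
  have h1 : logHyp (fun j => ψ (b j)) = logHyp b := by
    ext k m
    rw [logHyp, logHyp, pseudoHyp_conformal hψ (hb k) (hb m)]
  have h2 : ∀ j, Real.log (1 - ‖ψ (b j)‖ ^ 2) =
      Real.log (1 - ‖b j‖ ^ 2) + Real.log ‖deriv ψ (b j)‖ := by
    intro j
    have h3 : ‖b j‖ < 1 := mem_ball_zero_iff.1 (hb j)
    rw [← norm_deriv_conformal hψ (hb j), Real.log_mul, add_comm]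
    · exact norm_ne_zero_iff.2 (hψ.deriv_ne_zero isOpen_ball (hb j))
    · nlinarith [norm_nonneg (b j)]
  rw [discLogCorr, discLogCorr, h1]
  simp only [h2, Finset.sum_add_distrib]
  ring

theorem logCorr_comp {Ω Ω' : PlanarDomain} {φ χ : ℂ → ℂ} {V : Set ℂ}
    (hφ : IsConformalMap φ Ω.carrier Ω'.carrier) (hχ : IsConformalMap χ Ω'.carrier V)
    {a : Fin n → ℂ} (ha : a ∈ configSet Ω n) :
    logCorr (χ ∘ φ) a = logCorr χ (fun j => φ (a j)) + 1 / 8 * ∑ j, Real.log ‖deriv φ (a j)‖ := by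
  have h1 : ∀ j, Real.log ‖deriv (χ ∘ φ) (a j)‖ =
      Real.log ‖deriv χ (φ (a j))‖ + Real.log ‖deriv φ (a j)‖ := by
    intro j
    rw [deriv_comp _ (hχ.differentiableAt Ω'.isOpen (hφ.2.mapsTo (ha.2 j)))
      (hφ.differentiableAt Ω.isOpen (ha.2 j)), norm_mul, Real.log_mul]
    · exact norm_ne_zero_iff.2 (hχ.deriv_ne_zero Ω'.isOpen (hφ.2.mapsTo (ha.2 j)))
    · exact norm_ne_zero_iff.2 (hφ.deriv_ne_zero Ω.isOpen (ha.2 j))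
  simp only [logCorr, h1, Finset.sum_add_distrib, Function.comp_apply]
  ring

theorem logCorr_eq {Ω : PlanarDomain} {φ χ : ℂ → ℂ} (hφ : IsConformalMap φ Ω.carrier unitDisc)
    (hχ : IsConformalMap χ Ω.carrier unitDisc) {a : Fin n → ℂ} (ha : a ∈ configSet Ω n) :
    logCorr χ a = logCorr φ a := by
  obtain ⟨g, hg, hgφ, -⟩ := hφ.exists_inverse Ω.isOpen
  have hψ : IsConformalMap (χ ∘ g) unitDisc unitDisc := hχ.comp hg
  have hb : ∀ j, φ (a j) ∈ unitDisc := fun j => hφ.2.mapsTo (ha.2 j)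
  have h1 : ∀ j, χ (a j) = (χ ∘ g) (φ (a j)) := fun j => by
    rw [Function.comp_apply, hgφ (ha.2 j)]
  have h2 : ∀ j, Real.log ‖deriv χ (a j)‖ =
      Real.log ‖deriv (χ ∘ g) (φ (a j))‖ + Real.log ‖deriv φ (a j)‖ := by
    intro j
    have h3 : χ =ᶠ[𝓝 (a j)] (χ ∘ g) ∘ φ := by
      filter_upwards [Ω.isOpen.mem_nhds (ha.2 j)] with z hz
      simp only [Function.comp_apply, hgφ hz]
    rw [h3.deriv_eq, deriv_comp _ (hψ.differentiableAt isOpen_ball (hb j))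
      (hφ.differentiableAt Ω.isOpen (ha.2 j)), norm_mul, Real.log_mul]
    · exact norm_ne_zero_iff.2 (hψ.deriv_ne_zero isOpen_ball (hb j))
    · exact norm_ne_zero_iff.2 (hφ.deriv_ne_zero Ω.isOpen (ha.2 j))
  have h4 : (fun j => χ (a j)) = fun j => (χ ∘ g) (φ (a j)) := funext h1
  rw [logCorr, logCorr, h4, discLogCorr_conformal hψ hb]
  simp only [h2, Finset.sum_add_distrib]
  ring

/-- Both sides are coefficients of the derivative of the same function. This is needed because each
coefficient of ℒ may be realized with its own conformal map. -/
theorem obsCoeff_eq {Ω : PlanarDomain} {φ χ : ℂ → ℂ} (hφ : IsConformalMap φ Ω.carrier unitDisc)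
    (hχ : IsConformalMap χ Ω.carrier unitDisc) {a : Fin n → ℂ} (ha : a ∈ configSet Ω n) :
    obsCoeff χ a = obsCoeff φ a := by
  refine reForm_injective ((hasFDerivAt_logCorr hχ ha).unique
    ((hasFDerivAt_logCorr hφ ha).congr_of_eventuallyEq ?_))
  filter_upwards [(isOpen_configSet Ω n).mem_nhds ha] with a' ha'
  exact logCorr_eq hφ hχ ha'

theorem isFormL_iff {Ω : PlanarDomain} {φ : ℂ → ℂ} (hφ : IsConformalMap φ Ω.carrier unitDisc)
    {a : Fin n → ℂ} (ha : a ∈ configSet Ω n) {ℓ : (Fin n → ℂ) →L[ℝ] ℝ} :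
    IsFormL Ω a ℓ ↔ ℓ = reForm (obsCoeff φ a) := by
  have hA : ∀ {j A}, IsCoeffA Ω a j A → A = obsCoeff φ a j := by
    intro j A h
    obtain ⟨χ, hχ, h1⟩ := h.exists_eq_obsCoeff ha
    rw [h1, obsCoeff_eq hφ hχ ha]
  constructor
  · rintro ⟨A, h1, h2⟩
    ext v
    rw [h2, reForm_apply]
    exact Finset.sum_congr rfl fun j _ => by rw [hA (h1 j)]
  · rintro rfl
    refine ⟨obsCoeff φ a, fun j => ?_, fun v => reForm_apply _ _⟩
    obtain ⟨A, h⟩ := exists_isCoeffA ha j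
    rwa [← hA h]

/-- The exponentials of primitives are the positive multiples of an explicit one. -/
theorem isExpPrimitive_iff {Ω : PlanarDomain} {φ : ℂ → ℂ}
    (hφ : IsConformalMap φ Ω.carrier unitDisc) {c : Config Ω n → ℝ} :
    IsExpPrimitive c ↔ ∃ K : ℝ, 0 < K ∧ ∀ a, c a = K * Real.exp (logCorr φ a.1) := by
  constructor
  · rintro ⟨H, h1, h2⟩
    have h3 : ∀ a ∈ configSet Ω n, HasFDerivAt (fun a => H a - logCorr φ a)
        (0 : (Fin n → ℂ) →L[ℝ] ℝ) a := by
      intro a ha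
      obtain ⟨ℓ, h4, h5⟩ := h1 a ha
      rw [isFormL_iff hφ ha] at h4
      have := h5.sub (hasFDerivAt_logCorr hφ ha)
      rw [h4, sub_self] at this
      exact this
    obtain ⟨x, hx⟩ := (isOpen_configSet Ω n).exists_is_const_of_fderiv_eq_zero (𝕜 := ℝ)
      (isPreconnected_configSet Ω n)
      (fun a ha => (h3 a ha).differentiableAt.differentiableWithinAt) (fun a ha => (h3 a ha).fderiv)
    refine ⟨Real.exp x, Real.exp_pos x, fun a => ?_⟩
    rw [h2, ← Real.exp_add, ← hx a.1 a.2, sub_add_cancel]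
  · rintro ⟨K, hK, h⟩
    refine ⟨fun a => Real.log K + logCorr φ a, fun a ha => ⟨_, (isFormL_iff hφ ha).2 rfl,
      (hasFDerivAt_logCorr hφ ha).const_add _⟩, fun a => ?_⟩
    rw [h, Real.exp_add, Real.exp_log hK]

end

section

open Metric Set Complex ComplexConjugate

variable {n : ℕ}

/-! ### Distance to the boundary -/

theorem PlanarDomain.nonempty (Ω : PlanarDomain) : Ω.carrier.Nonempty := by
  obtain ⟨φ, hφ⟩ := Ω.exists_conformalMap
  obtain ⟨z, hz, -⟩ := hφ.2.surjOn (mem_ball_self one_pos)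
  exact ⟨z, hz⟩

theorem PlanarDomain.frontier_nonempty (Ω : PlanarDomain) : (frontier Ω.carrier).Nonempty :=
  nonempty_frontier_iff.2 ⟨Ω.nonempty, Ω.ne_univ⟩

theorem PlanarDomain.notMem_frontier (Ω : PlanarDomain) {z : ℂ} (hz : z ∈ Ω.carrier) :
    z ∉ frontier Ω.carrier := by
  rw [Ω.isOpen.frontier_eq]
  exact fun h => h.2 hz

theorem PlanarDomain.infDist_pos (Ω : PlanarDomain) {z : ℂ} (hz : z ∈ Ω.carrier) :
    0 < infDist z (frontier Ω.carrier) :=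
  (isClosed_frontier.notMem_iff_infDist_pos Ω.frontier_nonempty).1 (Ω.notMem_frontier hz)

theorem PlanarDomain.ball_infDist_subset (Ω : PlanarDomain) {z : ℂ} (hz : z ∈ Ω.carrier) :
    ball z (infDist z (frontier Ω.carrier)) ⊆ Ω.carrier := by
  refine IsPreconnected.subset_left_of_subset_union Ω.isOpen isClosed_closure.isOpen_compl
    (disjoint_compl_right.mono_left subset_closure) (fun w hw => ?_)
    ⟨z, mem_ball_self (Ω.infDist_pos hz), hz⟩ (convex_ball _ _).isPreconnected
  by_cases h : w ∈ closure Ω.carrier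
  · left
    by_contra h2
    exact ball_infDist_subset_compl hw (by rw [Ω.isOpen.frontier_eq]; exact ⟨h, h2⟩)
  · exact Or.inr h

/-! ### Asymptotics of the spin sum -/

theorem continuous_spinPartition : Continuous (spinPartition (n := n)) := by
  unfold spinPartition spinWeight
  fun_prop

/-- A spin without interaction only contributes its two values. -/
theorem spinPartition_of_zero {L : Fin (n + 1) → Fin (n + 1) → ℝ} (h1 : ∀ m, L 0 m = 0)
    (h2 : ∀ m, L m 0 = 0) :
    spinPartition L = 2 * spinPartition fun k m : Fin n => L k.succ m.succ := by
  rw [spinPartition, ← (Fin.consEquiv fun _ => Bool).sum_comp, Fintype.sum_prod_type,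
    Fintype.sum_bool, two_mul]
  have : ∀ (s : Bool) (μ : Fin n → Bool), spinWeight L (Fin.consEquiv (fun _ => Bool) (s, μ)) =
      spinWeight (fun k m => L k.succ m.succ) μ := by
    intro s μ
    simp [spinWeight, Fin.sum_univ_succ, h1, h2, Fin.consEquiv]
  simp only [this]
  rfl

theorem spinPartition_logHyp_one (b : Fin 1 → ℂ) : spinPartition (logHyp b) = 2 := by
  simp [spinPartition, spinWeight, Fin.fin_one_eq_zero, logHyp_self]

theorem spinPartition_logHyp_two {b : Fin 2 → ℂ} (h : 0 < pseudoHyp (b 0) (b 1)) :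
    spinPartition (logHyp b) =
      2 * (pseudoHyp (b 0) (b 1) ^ (-(1 / 2) : ℝ) * (1 + pseudoHyp (b 0) (b 1))) := by
  set r := pseudoHyp (b 0) (b 1) with hr
  have h01 : logHyp b 0 1 = Real.log r := rfl
  have h10 : logHyp b 1 0 = Real.log r := by rw [logHyp_comm, h01]
  have e1 : Real.exp (1 / 2 * Real.log r) = r ^ (-(1 / 2) : ℝ) * r := by
    conv_rhs => rw [← Real.rpow_one r, ← Real.rpow_mul h.le, ← Real.rpow_add h]
    rw [Real.rpow_def_of_pos h]
    congr 1; ring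
  have e2 : Real.exp (-(1 / 2 * Real.log r)) = r ^ (-(1 / 2) : ℝ) := by
    rw [Real.rpow_def_of_pos h]
    congr 1; ring
  rw [spinPartition, ← (finTwoArrowEquiv Bool).symm.sum_comp, Fintype.sum_prod_type]
  simp only [Fintype.sum_bool, spinWeight, Fin.sum_univ_two, logHyp_self, h01, h10]
  simp only [finTwoArrowEquiv_symm_apply, Matrix.cons_val_zero, Matrix.cons_val_one, spin_true,
    spin_false]
  ring_nf
  rw [show Real.log r * (1 / 2) = 1 / 2 * Real.log r by ring,
    show Real.log r * (-1 / 2) = -(1 / 2 * Real.log r) by ring, e1, e2]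
  ring_nf

/-! ### Decorrelation at the boundary -/

/-- The preimage of a smaller closed disc is compact in Ω, hence at positive distance from the
boundary. -/
theorem IsConformalMap.tendsto_norm {Ω : PlanarDomain} {φ : ℂ → ℂ}
    (hφ : IsConformalMap φ Ω.carrier unitDisc) {α : Type*} {l : Filter α} {f : α → ℂ}
    (hf : ∀ x, f x ∈ Ω.carrier)
    (hl : Tendsto (fun x => infDist (f x) (frontier Ω.carrier)) l (𝓝 0)) :
    Tendsto (fun x => ‖φ (f x)‖) l (𝓝 1) := by
  obtain ⟨g, hg, hgφ, -⟩ := hφ.exists_inverse Ω.isOpen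
  refine tendsto_order.2 ⟨fun r hr => ?_, fun r hr => Eventually.of_forall fun x =>
    (mem_ball_zero_iff.1 (hφ.2.mapsTo (hf x))).trans hr⟩
  have hsub : closedBall (0 : ℂ) r ⊆ unitDisc := closedBall_subset_ball hr
  have hK : IsCompact (g '' closedBall (0 : ℂ) r) :=
    (isCompact_closedBall _ _).image_of_continuousOn (hg.1.continuousOn.mono hsub)
  obtain ⟨δ, hδ, h1⟩ : ∃ δ > 0, ∀ z ∈ g '' closedBall (0 : ℂ) r,
      δ ≤ infDist z (frontier Ω.carrier) := by
    rcases (g '' closedBall (0 : ℂ) r).eq_empty_or_nonempty with he | hne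
    · exact ⟨1, one_pos, by simp [he]⟩
    · obtain ⟨z, hz, hmin⟩ := hK.exists_isMinOn hne (continuous_infDist_pt _).continuousOn
      obtain ⟨w, hw, rfl⟩ := hz
      exact ⟨_, Ω.infDist_pos (hg.2.mapsTo (hsub hw)), fun z hz => hmin hz⟩
  filter_upwards [hl.eventually (gt_mem_nhds hδ)] with x hx
  by_contra! hcon
  exact absurd (h1 (f x) ⟨φ (f x), mem_closedBall_zero_iff.2 hcon, hgφ (hf x)⟩) (not_le.2 hx)

theorem tendsto_pseudoHyp {α : Type*} {l : Filter α} {f : α → ℂ} (hf : ∀ x, ‖f x‖ < 1)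
    (hl : Tendsto (fun x => ‖f x‖) l (𝓝 1)) {c : ℂ} (hc : ‖c‖ < 1) :
    Tendsto (fun x => pseudoHyp (f x) c) l (𝓝 1) := by
  have h1 : Tendsto (fun x => 1 - pseudoHyp (f x) c ^ 2) l (𝓝 0) := by
    have h2 : Tendsto (fun x => (1 - ‖f x‖ ^ 2) / (1 - ‖c‖) ^ 2) l (𝓝 0) := by
      simpa using ((hl.pow 2).const_sub 1).div_const ((1 - ‖c‖) ^ 2)
    refine squeeze_zero (fun x => ?_) (fun x => ?_) h2
    · have := norm_discAut_lt_one hc (hf x)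
      rw [pseudoHyp]
      nlinarith [norm_nonneg (discAut c (f x))]
    · rw [pseudoHyp, one_sub_sq_norm_discAut hc (hf x)]
      have h3 : 1 - ‖c‖ ≤ ‖1 - conj c * f x‖ := by
        have h4 := norm_sub_norm_le 1 (conj c * f x)
        rw [norm_mul, norm_conj, norm_one] at h4
        nlinarith [norm_nonneg c, hf x]
      have h5 : 0 ≤ 1 - ‖f x‖ ^ 2 := by nlinarith [norm_nonneg (f x), hf x]
      have h6 : (1 - ‖c‖ ^ 2) * (1 - ‖f x‖ ^ 2) ≤ 1 - ‖f x‖ ^ 2 := by nlinarith [norm_nonneg c]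
      have h7 : 0 < 1 - ‖c‖ := by linarith
      gcongr
  have h2 := ((h1.const_sub 1).sqrt)
  simpa [Real.sqrt_sq, pseudoHyp] using h2

/-- The one-point factors and the powers of 2 are additive over the points and cancel. The 2 on the
right is the one-point partition function. -/
theorem exp_logCorr_div {Ω : PlanarDomain} {φ : ℂ → ℂ} (b : Config Ω (n + 1)) :
    logCorr φ b.1 - logCorr φ b.head.1 - logCorr φ b.tail.1 =
      1 / 2 * (Real.log (spinPartition (logHyp fun j => φ (b.1 j))) -
        Real.log (2 * spinPartition (logHyp fun j => φ (b.tail.1 j)))) := by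
  rw [Real.log_mul two_ne_zero (spinPartition_pos _).ne']
  simp only [logCorr, discLogCorr, Fin.sum_univ_succ, spinPartition_logHyp_one, Config.head,
    Config.tail, Finset.univ_unique, Finset.sum_singleton]
  push_cast
  ring

theorem tendsto_boundary {Ω : PlanarDomain} {φ : ℂ → ℂ}
    (hφ : IsConformalMap φ Ω.carrier unitDisc) (as : Config Ω n) :
    Tendsto (fun b : Config Ω (n + 1) =>
        Real.exp (logCorr φ b.1) / (Real.exp (logCorr φ b.head.1) * Real.exp (logCorr φ as.1)))
      (comap (fun b => infDist (b.1 0) (frontier Ω.carrier)) (𝓝 0) ⊓ 𝓟 {b | b.tail = as})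
      (𝓝 1) := by
  set l := comap (fun b : Config Ω (n + 1) => infDist (b.1 0) (frontier Ω.carrier)) (𝓝 0) ⊓
    𝓟 {b | b.tail = as} with hl
  have htail : ∀ᶠ b in l, b.tail = as := mem_inf_of_right (mem_principal_self _)
  have hdist : Tendsto (fun b : Config Ω (n + 1) => infDist (b.1 0) (frontier Ω.carrier)) l
      (𝓝 0) := tendsto_comap.mono_left inf_le_left
  have hnorm := hφ.tendsto_norm (f := fun b : Config Ω (n + 1) => b.1 0) (fun b => b.2.2 0) hdist
  have hlog : ∀ m, Tendsto (fun b : Config Ω (n + 1) => Real.log (pseudoHyp (φ (b.1 0))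
      (φ (as.1 m)))) l (𝓝 0) := by
    intro m
    have h1 := tendsto_pseudoHyp (fun b : Config Ω (n + 1) =>
      mem_ball_zero_iff.1 (hφ.2.mapsTo (b.2.2 0))) hnorm
      (mem_ball_zero_iff.1 (hφ.2.mapsTo (as.2.2 m)))
    simpa using h1.log one_ne_zero
  set L : Fin (n + 1) → Fin (n + 1) → ℝ := fun k m => Fin.cases 0
    (fun k' => Fin.cases 0 (fun m' => logHyp (fun j => φ (as.1 j)) k' m') m) k with hL
  have hlim : Tendsto (fun b : Config Ω (n + 1) => logHyp fun j => φ (b.1 j)) l (𝓝 L) := by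
    refine tendsto_pi_nhds.2 fun k => tendsto_pi_nhds.2 fun m => ?_
    have hb : ∀ᶠ b in l, ∀ j, b.1 j.succ = as.1 j := by
      filter_upwards [htail] with b h j
      rw [← h]; rfl
    induction k using Fin.cases with
    | zero =>
      induction m using Fin.cases with
      | zero => simpa [logHyp_self, hL] using tendsto_const_nhds
      | succ m =>
        refine (hlog m).congr' ?_
        filter_upwards [hb] with b h
        rw [logHyp, h]
    | succ k =>
      induction m using Fin.cases with
      | zero =>
        refine (hlog k).congr' ?_
        filter_upwards [hb] with b h
        rw [logHyp, h, pseudoHyp_comm]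
      | succ m =>
        refine tendsto_const_nhds.congr' ?_
        filter_upwards [hb] with b h
        simp only [hL, Fin.cases_succ, logHyp, h]
  have hZ : Tendsto (fun b : Config Ω (n + 1) => spinPartition (logHyp fun j => φ (b.1 j))) l
      (𝓝 (2 * spinPartition (logHyp fun j => φ (as.1 j)))) := by
    have h1 := (continuous_spinPartition.tendsto L).comp hlim
    rw [spinPartition_of_zero (fun m => rfl) (fun m => by
      induction m using Fin.cases <;> rfl)] at h1
    exact h1
  have h2 : (2 * spinPartition (logHyp fun j => φ (as.1 j))) ≠ 0 :=
    (mul_pos two_pos (spinPartition_pos _)).ne'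
  have h3 := (((hZ.log h2).sub_const (Real.log (2 * spinPartition (logHyp fun j =>
    φ (as.1 j))))).const_mul (1 / 2)).rexp
  rw [sub_self, mul_zero, Real.exp_zero] at h3
  refine h3.congr' ?_
  filter_upwards [htail] with b h
  rw [← Real.exp_add, ← Real.exp_sub]
  congr 1
  have := exp_logCorr_div (φ := φ) b
  rw [h] at this
  rw [← this]
  ring

/-- Without this the limit condition could be vacuous and would not determine the constants. -/
theorem neBot_boundary {Ω : PlanarDomain} (as : Config Ω n) :
    (comap (fun b : Config Ω (n + 1) => infDist (b.1 0) (frontier Ω.carrier)) (𝓝 0) ⊓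
      𝓟 {b | b.tail = as}).NeBot := by
  obtain ⟨x, hx⟩ := Ω.frontier_nonempty
  have hx2 : x ∈ closure Ω.carrier := frontier_subset_closure hx
  have hxa : ∀ j, x ≠ as.1 j := fun j h => Ω.notMem_frontier (as.2.2 j) (h ▸ hx)
  refine inf_principal_neBot_iff.2 fun U hU => ?_
  obtain ⟨t, ht, hsub⟩ := hU
  have h1 : Tendsto (fun z => infDist z (frontier Ω.carrier)) (𝓝 x) (𝓝 0) := by
    have := (continuous_infDist_pt (frontier Ω.carrier)).tendsto x
    rwa [infDist_zero_of_mem hx] at this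
  have h2 : ∀ᶠ z in 𝓝 x, infDist z (frontier Ω.carrier) ∈ t ∧ ∀ j, z ≠ as.1 j :=
    (h1.eventually ht).and (eventually_all.2 fun j => isOpen_ne.mem_nhds (hxa j))
  obtain ⟨z, ⟨hz1, hz2⟩, hzΩ⟩ := mem_closure_iff_nhds.1 hx2 _ h2
  refine ⟨⟨Fin.cons z as.1, Fin.cons_injective_iff.2 ⟨?_, as.2.1⟩, ?_⟩, hsub hz1, rfl⟩
  · rintro ⟨j, hj⟩
    exact hz2 j hj.symm
  · intro j
    induction j using Fin.cases with
    | zero => exact hzΩ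
    | succ j => exact as.2.2 j

end

section

open Metric Set Complex ComplexConjugate

variable {n : ℕ}

/-! ### Normalization in the bulk -/

theorem PlanarDomain.exists_conformalMap_eq_zero (Ω : PlanarDomain) {a : ℂ}
    (ha : a ∈ Ω.carrier) : ∃ φ, IsConformalMap φ Ω.carrier unitDisc ∧ φ a = 0 := by
  obtain ⟨φ, hφ⟩ := Ω.exists_conformalMap
  have h := mem_ball_zero_iff.1 (hφ.2.mapsTo ha)
  exact ⟨_, (isConformalMap_discAut h).comp hφ, discAut_self _⟩

/-- The Schwarz lemma on the largest disc around the first point inside Ω, whose radius is its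
distance to the boundary. -/
theorem norm_le_bulkDepth {Ω : PlanarDomain} {φ : ℂ → ℂ}
    (hφ : IsConformalMap φ Ω.carrier unitDisc) (p : Config Ω 2) (h0 : φ (p.1 0) = 0)
    (hp : bulkDepth p < 1) : ‖φ (p.1 1)‖ ≤ bulkDepth p := by
  set R := infDist (p.1 0) (frontier Ω.carrier) with hR
  have hR0 : 0 < R := Ω.infDist_pos (p.2.2 0)
  have hm : 0 < min R (infDist (p.1 1) (frontier Ω.carrier)) :=
    lt_min hR0 (Ω.infDist_pos (p.2.2 1))
  have h1 : ‖p.1 0 - p.1 1‖ / R ≤ bulkDepth p :=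
    div_le_div_of_nonneg_left (norm_nonneg _) hm (min_le_left _ _)
  have hsub := Ω.ball_infDist_subset (p.2.2 0)
  have hmem : p.1 1 ∈ ball (p.1 0) R := by
    rw [mem_ball, dist_comm, dist_eq_norm]
    have := (h1.trans_lt hp)
    rwa [div_lt_one hR0] at this
  have h2 := Complex.dist_le_div_mul_dist_of_mapsTo_ball (R₂ := 1) (hφ.1.mono hsub)
    (fun z hz => by
      rw [h0]
      exact ball_subset_closedBall (hφ.2.mapsTo (hsub hz))) hmem
  rw [h0, dist_zero_right, dist_comm, dist_eq_norm] at h2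
  refine h2.trans (le_trans (le_of_eq ?_) h1)
  ring

/-- Written so that every logarithm on the right has an argument tending to 1: with w = φ(p_1), the
singular |w|^{-1/4} coming from Z combines with |p_0 - p_1|^{1/4} into a difference quotient of g.
-/
theorem logCorr_two {Ω : PlanarDomain} {φ g : ℂ → ℂ} (hφ : IsConformalMap φ Ω.carrier unitDisc)
    (hg : IsConformalMap g unitDisc Ω.carrier) (hgφ : LeftInvOn g φ Ω.carrier)
    (p : Config Ω 2) (h0 : φ (p.1 0) = 0) :
    logCorr φ p.1 + 1 / 4 * Real.log ‖p.1 0 - p.1 1‖ =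
      1 / 4 * Real.log ‖(g (φ (p.1 1)) - g 0) / (φ (p.1 1) * deriv g 0)‖ +
      1 / 2 * Real.log (1 + ‖φ (p.1 1)‖) - 1 / 8 * Real.log (1 - ‖φ (p.1 1)‖ ^ 2) -
      1 / 8 * Real.log ‖deriv g (φ (p.1 1)) / deriv g 0‖ := by
  have hne : p.1 0 ≠ p.1 1 := p.2.1.ne (by decide)
  have hw0 : φ (p.1 1) ≠ 0 := fun h => hne (hφ.2.injOn (p.2.2 0) (p.2.2 1) (h0.trans h.symm))
  have hr : pseudoHyp (φ (p.1 0)) (φ (p.1 1)) = ‖φ (p.1 1)‖ := by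
    simp [h0, pseudoHyp, discAut]
  have hd : ∀ j, ‖deriv φ (p.1 j)‖ = ‖deriv g (φ (p.1 j))‖⁻¹ := by
    intro j
    have h1 := deriv_leftInvOn_mul Ω.isOpen hφ.1 hgφ (p.2.2 j)
    have h2 := congrArg norm h1
    rw [norm_mul, norm_one] at h2
    exact eq_inv_of_mul_eq_one_right h2
  have hg0 : ‖deriv g 0‖ ≠ 0 :=
    norm_ne_zero_iff.2 (hg.deriv_ne_zero isOpen_ball (mem_ball_self one_pos))
  have hgw : ‖deriv g (φ (p.1 1))‖ ≠ 0 :=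
    norm_ne_zero_iff.2 (hg.deriv_ne_zero isOpen_ball (hφ.2.mapsTo (p.2.2 1)))
  have e1 : g (φ (p.1 1)) - g 0 = p.1 1 - p.1 0 := by
    rw [hgφ (p.2.2 1), ← h0, hgφ (p.2.2 0)]
  have hr0 : 0 < ‖φ (p.1 1)‖ := norm_pos_iff.2 hw0
  rw [e1, norm_div, norm_mul, norm_div, norm_sub_rev (p.1 1), Real.log_div
    (norm_ne_zero_iff.2 (sub_ne_zero.2 hne)) (mul_ne_zero hr0.ne' hg0), Real.log_mul hr0.ne' hg0,
    Real.log_div hgw hg0, logCorr, discLogCorr, spinPartition_logHyp_two (by rwa [hr]), hr,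
    Real.log_mul two_ne_zero (by positivity), Real.log_mul (by positivity) (by positivity),
    Real.log_rpow hr0]
  simp only [Fin.sum_univ_two, hd, h0, norm_zero, Real.log_inv]
  norm_num
  ring

theorem tendsto_bulk {Ω : PlanarDomain} {φ : ℂ → ℂ} (hφ : IsConformalMap φ Ω.carrier unitDisc) :
    Tendsto (fun p : Config Ω 2 => Real.exp (logCorr φ p.1) /
      ‖p.1 0 - p.1 1‖ ^ (-(1 / 4) : ℝ)) (comap bulkDepth (𝓝 0)) (𝓝 1) := by
  -- Each pair gets its own Riemann map, sending the first point to 0; `logCorr` does not notice,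
  -- and the distortion bounds depend on `bulkDepth` alone.
  have hlog : ∀ p : Config Ω 2, ∃ x y r : ℝ,
      logCorr φ p.1 + 1 / 4 * Real.log ‖p.1 0 - p.1 1‖ =
        1 / 4 * Real.log x + 1 / 2 * Real.log (1 + r) - 1 / 8 * Real.log (1 - r ^ 2) -
          1 / 8 * Real.log y ∧
      (bulkDepth p < 1 / 2 → |x - 1| ≤ Real.exp (160 * bulkDepth p) - 1 ∧
        |y - 1| ≤ Real.exp (160 * bulkDepth p) - 1 ∧ |r| ≤ bulkDepth p) := by
    intro p
    obtain ⟨χ, hχ, h0⟩ := Ω.exists_conformalMap_eq_zero (p.2.2 0)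
    obtain ⟨g, hg, hgχ, -⟩ := hχ.exists_inverse Ω.isOpen
    refine ⟨_, _, _, (logCorr_eq hχ hφ p.2 ▸ logCorr_two hχ hg hgχ p h0), fun hp => ?_⟩
    have h1 := norm_le_bulkDepth hχ p h0 (by linarith)
    have hw0 : χ (p.1 1) ≠ 0 := fun h =>
      p.2.1.ne (by decide) (hχ.2.injOn (p.2.2 0) (p.2.2 1) (h0.trans h.symm))
    have h2 : Real.exp (160 * ‖χ (p.1 1)‖) - 1 ≤ Real.exp (160 * bulkDepth p) - 1 := by gcongr
    have h3 : ∀ z : ℂ, |‖z‖ - 1| ≤ ‖z - 1‖ := fun z => by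
      simpa using abs_norm_sub_norm_le z 1
    exact ⟨(h3 _).trans ((norm_sub_div_sub_one_le hg.1 hg.2.injOn (by linarith) hw0).trans h2),
      (h3 _).trans ((norm_deriv_div_sub_one_le hg.1 hg.2.injOn (by linarith)).trans h2),
      by rwa [abs_norm]⟩
  choose x y r h1 h2 using hlog
  have hx0 : Tendsto (bulkDepth (Ω := Ω)) (comap bulkDepth (𝓝 0)) (𝓝 0) := tendsto_comap
  have hev : ∀ᶠ p in comap (bulkDepth (Ω := Ω)) (𝓝 0), bulkDepth p < 1 / 2 :=
    hx0.eventually (gt_mem_nhds (by norm_num))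
  have hE : Tendsto (fun p : Config Ω 2 => Real.exp (160 * bulkDepth p) - 1)
      (comap bulkDepth (𝓝 0)) (𝓝 0) := by
    simpa using ((hx0.const_mul 160).rexp).sub_const 1
  have key : ∀ {f : Config Ω 2 → ℝ}, (∀ p, bulkDepth p < 1 / 2 →
      |f p - 1| ≤ Real.exp (160 * bulkDepth p) - 1) →
      Tendsto (fun p => Real.log (f p)) (comap bulkDepth (𝓝 0)) (𝓝 0) := by
    intro f hf
    have h3 : Tendsto (fun p => f p - 1) (comap bulkDepth (𝓝 0)) (𝓝 0) :=
      squeeze_zero_norm' (by filter_upwards [hev] with p hp using hf p hp) hE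
    have h4 : Tendsto f (comap bulkDepth (𝓝 0)) (𝓝 1) := by simpa using h3.add_const 1
    simpa using h4.log one_ne_zero
  have hr : Tendsto r (comap bulkDepth (𝓝 0)) (𝓝 0) :=
    squeeze_zero_norm' (by filter_upwards [hev] with p hp using (h2 p hp).2.2) hx0
  have hr1 : Tendsto (fun p => Real.log (1 + r p)) (comap bulkDepth (𝓝 0)) (𝓝 0) := by
    simpa using (hr.const_add 1).log (by norm_num)
  have hr2 : Tendsto (fun p => Real.log (1 - r p ^ 2)) (comap bulkDepth (𝓝 0)) (𝓝 0) := by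
    simpa using ((hr.pow 2).const_sub 1).log (by norm_num)
  have hfin := (((((key fun p hp => (h2 p hp).1).const_mul (1 / 4)).add
    (hr1.const_mul (1 / 2))).sub (hr2.const_mul (1 / 8))).sub
    ((key fun p hp => (h2 p hp).2.1).const_mul (1 / 8))).rexp
  norm_num at hfin
  refine hfin.congr fun p => ?_
  have hpos : 0 < ‖p.1 0 - p.1 1‖ := norm_pos_iff.2 (sub_ne_zero.2 (p.2.1.ne (by decide)))
  rw [Real.rpow_def_of_pos hpos, ← Real.exp_sub]
  congr 1
  linear_combination -(h1 p)

theorem neBot_bulk (Ω : PlanarDomain) : (comap (bulkDepth (Ω := Ω)) (𝓝 0)).NeBot := by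
  obtain ⟨a, ha⟩ := Ω.nonempty
  refine comap_neBot fun t ht => ?_
  have h1 : ContinuousAt (fun b => ‖a - b‖ / min (infDist a (frontier Ω.carrier))
      (infDist b (frontier Ω.carrier))) a := by
    refine ContinuousAt.div (by fun_prop) ?_ ?_
    · exact continuousAt_const.min (continuous_infDist_pt _).continuousAt
    · rw [min_self]; exact (Ω.infDist_pos ha).ne'
  have h2 := h1.tendsto
  simp only [sub_self, norm_zero, zero_div] at h2
  have h3 := (h2.eventually ht).and (Ω.isOpen.mem_nhds ha)
  obtain ⟨b, ⟨hb1, hb2⟩, hb3⟩ := ((h3.filter_mono nhdsWithin_le_nhds).and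
    (self_mem_nhdsWithin (a := a) (s := {a}ᶜ))).exists
  refine ⟨⟨![a, b], ?_, ?_⟩, hb1⟩
  · have hab : a ≠ b := fun h => hb3 h.symm
    intro i j
    fin_cases i <;> fin_cases j <;> simp [hab, hab.symm]
  · intro j
    fin_cases j
    · exact ha
    · exact hb2

/-! ### The normalized correlation functions -/

/-- The normalized correlation functions. -/
def spinCorrelation : CorrFamily := fun Ω _ a =>
  Real.exp (logCorr Ω.exists_conformalMap.choose a.1)

theorem spinCorrelation_eq {Ω : PlanarDomain} {φ : ℂ → ℂ}
    (hφ : IsConformalMap φ Ω.carrier unitDisc) {k : ℕ} (a : Config Ω (k + 1)) :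
    spinCorrelation Ω k a = Real.exp (logCorr φ a.1) := by
  rw [spinCorrelation, logCorr_eq hφ Ω.exists_conformalMap.choose_spec a.2]

theorem isNormalizedCorr_spinCorrelation : IsNormalizedCorr spinCorrelation := by
  refine ⟨fun Ω k => (isExpPrimitive_iff Ω.exists_conformalMap.choose_spec).2
    ⟨1, one_pos, fun a => (one_mul _).symm⟩, fun Ω k as => ?_, fun Ω => ?_⟩
  · exact tendsto_boundary Ω.exists_conformalMap.choose_spec as
  · exact tendsto_bulk Ω.exists_conformalMap.choose_spec

theorem IsNormalizedCorr.eq_spinCorrelation {corr : CorrFamily} (h : IsNormalizedCorr corr) :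
    corr = spinCorrelation := by
  obtain ⟨h1, h2, h3⟩ := h
  obtain ⟨-, h2', h3'⟩ := isNormalizedCorr_spinCorrelation
  choose K hK hcorr using fun Ω k =>
    (isExpPrimitive_iff Ω.exists_conformalMap.choose_spec).1 (h1 Ω k)
  have hcorr : ∀ Ω k a, corr Ω k a = K Ω k * spinCorrelation Ω k a := hcorr
  -- Both families satisfy the boundary condition, so the ratio of their constants tends to 1.
  have hmul : ∀ Ω k, K Ω (k + 1) = K Ω 0 * K Ω k := by
    intro Ω k
    obtain ⟨as⟩ : Nonempty (Config Ω (k + 1)) := by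
      have : (configSet Ω (k + 1)).Nonempty := by
        have hinf : Ω.carrier.Infinite :=
          infinite_of_mem_nhds _ (Ω.isOpen.mem_nhds Ω.nonempty.some_mem)
        obtain ⟨f⟩ : Nonempty (ℕ ↪ Ω.carrier) := ⟨hinf.natEmbedding⟩
        exact ⟨fun i => f i, fun i j hij => Fin.ext (f.injective (Subtype.ext hij)),
          fun i => (f i).2⟩
      exact this.to_subtype
    have := neBot_boundary as
    have hlim := (h2' Ω k as).const_mul (K Ω (k + 1) / (K Ω 0 * K Ω k))
    rw [mul_one] at hlim
    have heq := tendsto_nhds_unique (h2 Ω k as) (hlim.congr fun b => by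
      rw [hcorr, hcorr, hcorr, div_mul_div_comm, mul_mul_mul_comm])
    rw [eq_comm, div_eq_one_iff_eq (mul_pos (hK _ _) (hK _ _)).ne'] at heq
    exact heq
  have hK1 : ∀ Ω, K Ω 1 = 1 := by
    intro Ω
    have := neBot_bulk Ω
    have hlim := (h3' Ω).const_mul (K Ω 1)
    rw [mul_one] at hlim
    exact (tendsto_nhds_unique (h3 Ω) (hlim.congr fun b => by rw [hcorr, mul_div_assoc])).symm
  have hone : ∀ Ω k, K Ω k = 1 := by
    intro Ω k
    -- The recursion at k = 0 and the bulk condition give K_0² = K_1 = 1; positivity selects the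
    -- root.
    have h0 : K Ω 0 = 1 := by
      have h4 := hmul Ω 0
      rw [zero_add, hK1] at h4
      nlinarith [hK Ω 0]
    induction k with
    | zero => exact h0
    | succ k ih => rw [hmul, h0, ih, one_mul]
  ext Ω k a
  rw [hcorr, hone, one_mul]

theorem conformallyCovariant_spinCorrelation : ConformallyCovariant spinCorrelation := by
  intro Ω Ω' φ hφ k a
  obtain ⟨χ, hχ⟩ := Ω'.exists_conformalMap
  have hpos : ∀ j, 0 < ‖deriv φ (a.1 j)‖ := fun j =>
    norm_pos_iff.2 (hφ.deriv_ne_zero Ω.isOpen (a.2.2 j))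
  rw [spinCorrelation_eq (hχ.comp hφ), spinCorrelation_eq hχ, logCorr_comp hφ hχ a.2, Real.exp_add,
    Finset.mul_sum, Real.exp_sum]
  congr 1
  refine Finset.prod_congr rfl fun j _ => ?_
  rw [Real.rpow_def_of_pos (hpos j), mul_comm]

end

end IsingSpin

end

theorem mainTheorem11 :
    (∃! corr : IsingSpin.CorrFamily, IsingSpin.IsNormalizedCorr corr) ∧
    ∀ corr : IsingSpin.CorrFamily,
      IsingSpin.IsNormalizedCorr corr → IsingSpin.ConformallyCovariant corr :=
  ⟨⟨IsingSpin.spinCorrelation, IsingSpin.isNormalizedCorr_spinCorrelation,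
    fun _ h => h.eq_spinCorrelation⟩,
    fun _ h => h.eq_spinCorrelation ▸ IsingSpin.conformallyCovariant_spinCorrelation⟩
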